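/- Let $\Bbbk$ be a field, $H$ a Hopf algebra over $\Bbbk$ and $B$ a unital associative $\Bbbk$-algebra; $\otimes=\otimes_\Bbbk$, and $\Delta(h)=h_1\otimes h_2$. **Crossed products.** Let $H$ measure $B$, i.e. let $\cdot:H\otimes B\to B$ be linear with $h\cdot 1=\varepsilon(h)1$ and $h\cdot(bb')=(h_1\cdot b)(h_2\cdot b')$, and let $\sigma:H\otimes H\to B$ be linear with convolution inverse $\sigma^{-1}$. Assume that $B$ is a $\sigma$-twisted left $H$-module algebra: $1_H\cdot b=b$, $h\cdot(h'\cdot b)=\sigma(h_1\otimes h'_1)(h_2h'_2\cdot b)\sigma^{-1}(h_3\otimes h'_3)$, $\sigma(h\otimes 1)=\varepsilon(h)1=\sigma(1\otimes h)$ and $(h_1\cdot\sigma(h'_1\otimes h''_1))\,\sigma(h_2\otimes h'_2h''_2)=\sigma(h_1\otimes h'_1)\,\sigma(h_2h'_2\otimes h'')$. Let $B\#_\sigma H$ be $B\otimes H$ with unit $1\otimes1$, product $(b\otimes h)(b'\otimes h')=b(h_1\cdot b')\sigma(h_2\otimes h'_1)\otimes h_3h'_2$, and right $H$-coaction $\rho(b\otimes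 h)=b\otimes h_1\otimes h_2$. **Differential calculi.** A differential calculus (DC) on an algebra $A$ is a differential graded algebra $(\Omega^\bullet(A),\wedge,\mathrm d)$, graded by $\mathbb N$, with $\Omega^0(A)=A$, such that for $n\ge1$ the space $\Omega^n(A)$ is spanned by the forms $a^0\mathrm da^1\wedge\cdots\wedge\mathrm da^n$. An algebra map $f:A\to A'$ is differentiable if it extends to a (necessarily unique) morphism of differential graded algebras $\Omega^\bullet(f):\Omega^\bullet(A)\to\Omega^\bullet(A')$. On $A\otimes A'$ one takes the tensor product calculus, $\Omega^n(A\otimes A')=\bigoplus_{k=0}^n\Omega^k(A)\otimes\Omega^{n-k}(A')$, with $(\omega\otimes\omega')\wedge(\eta\otimes\eta')=(-1)^{|\omega'||\eta|}(\omega\wedge\eta)\otimes(\omega'\wedge\eta')$ and $\mathrm d(\omega\otimes\omega')=\mathrm d\omega\otimes\omega'+(-1)^{|\omega|}\omega\otimes\mathrm d\omega'$. A DC on a right $H$-comodule algebra $A$ is right $H$-covariant if $\Omega^\bullet(A)$ is a graded right $H$-comodule algebra whose coaction extends that of $A$ and for which $\mathrm d$ is right $H$-colinear. A DC $\Omega^\bullet(B)$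 is a $\sigma$-twisted $H$-module DC if there are linear maps $\cdot:H\otimes\Omega^n(B)\to\Omega^n(B)$ for $n\ge1$ with $h\cdot(b^0\mathrm db^1\wedge\cdots\wedge\mathrm db^n)=(h_1\cdot b^0)(h_2\cdot\mathrm db^1)\wedge\cdots\wedge(h_{n+1}\cdot\mathrm db^n)$ and $h\cdot\mathrm db=\mathrm d(h\cdot b)$, and if $\mathrm d\circ\sigma=0$. **Theorem.** Let $(\Omega^\bullet(B),\mathrm d_B)$ be a $\sigma$-twisted $H$-module DC on $B$, and let $(\Omega^\bullet(H),\mathrm d_H)$ be a DC on $H$ for which $\Delta:H\to H\otimes H$ is differentiable. Write $\Omega^\bullet(\Delta)(\gamma)=\gamma_{[1]}\otimes\gamma_{[2]}$, and let $\gamma\mapsto\gamma_{-1}\otimes\gamma_0\in H\otimes\Omega^\bullet(H)$ be the component of $\Omega^\bullet(\Delta)(\gamma)$ in $\Omega^0(H)\otimes\Omega^\bullet(H)$; put $\gamma_{-2}\otimes\gamma_{-1}\otimes\gamma_0=\Delta(\gamma_{-1})\otimes\gamma_0$. Define, for $n\ge 0$, $$\Omega^n(B\#_\sigma H):=\bigoplus_{i=0}^n\Omega^{n-i}(B)\otimes\Omega^i(H)$$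 and, for $\omega\in\Omega^i(B)$, $\gamma\in\Omega^j(H)$, $\omega'\in\Omega^k(B)$ and $\gamma'\in\Omega^\bullet(H)$, $$(\omega\otimes\gamma)\wedge(\omega'\otimes\gamma'):=(-1)^{jk}\bigl(\omega\wedge(\gamma_{-2}\cdot\omega')\,\sigma(\gamma_{-1}\otimes\gamma'_{-1})\bigr)\otimes(\gamma_0\wedge\gamma'_0),$$ $$\mathrm d_{\#_\sigma}(\omega\otimes\gamma):=\mathrm d_B\omega\otimes\gamma+(-1)^i\omega\otimes\mathrm d_H\gamma.$$ Then $(\Omega^\bullet(B\#_\sigma H),\wedge,\mathrm d_{\#_\sigma})$ is a right $H$-covariant differential calculus on the right $H$-comodule algebra $B\#_\sigma H$. Moreover $\rho:B\#_\sigma H\to(B\#_\sigma H)\otimes H$ is differentiable (with respect to the tensor product calculus on the target), with $$\Omega^\bullet(\rho)(\omega\otimes\gamma)=\omega\otimes\gamma_{[1]}\otimes\gamma_{[2]}.$$ -/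

import Mathlib

open scoped TensorProduct

noncomputable section

namespace CrossedCalc

open TensorProduct WithConv

/-! ### Algebras, differential graded algebras and differential calculi

The product on `B ⊗ H`, and the wedge product on forms, are first defined as bilinear maps; the
associative, unital, ... laws are then *claimed* about them. So operations and laws are separated. -/

/-- A bilinear operation and a distinguished element on a vector space (no laws). -/
structure AlgStruct (k A : Type*) [Field k] [AddCommGroup A] [Module k A] where
  mul : A →ₗ[k] A →ₗ[k] A
  one : A

/-- The operations of a `k`-algebra. -/
def AlgStruct.of (k A : Type*) [Field k] [Ring A] [Algebra k A] : AlgStruct k A where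
  mul := LinearMap.mul k A
  one := 1

/-- The operations form an associative unital algebra. -/
structure AlgStruct.IsAlgebra {k A : Type*} [Field k] [AddCommGroup A] [Module k A]
    (S : AlgStruct k A) : Prop where
  mul_assoc : ∀ x y z, S.mul (S.mul x y) z = S.mul x (S.mul y z)
  one_mul : ∀ x, S.mul S.one x = x
  mul_one : ∀ x, S.mul x S.one = x

/-- The data of a differential graded algebra on the total space `V`: homogeneous components
`gr n`, product (`wedge`), unit and differential (no laws). -/
structure DGStruct (k V : Type*) [Field k] [AddCommGroup V] [Module k V]
    extends AlgStruct k V where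
  gr : ℕ → Submodule k V
  d : V →ₗ[k] V

/-- The laws of a differential graded algebra. -/
structure DGStruct.IsDGA {k V : Type*} [Field k] [AddCommGroup V] [Module k V]
    (Ω : DGStruct k V) : Prop where
  isInternal : DirectSum.IsInternal Ω.gr
  isAlgebra : Ω.toAlgStruct.IsAlgebra
  one_mem : Ω.one ∈ Ω.gr 0
  mul_mem : ∀ n m, ∀ x ∈ Ω.gr n, ∀ y ∈ Ω.gr m, Ω.mul x y ∈ Ω.gr (n + m)
  d_mem : ∀ n, ∀ x ∈ Ω.gr n, Ω.d x ∈ Ω.gr (n + 1)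
  d_d : ∀ x, Ω.d (Ω.d x) = 0
  leibniz : ∀ n, ∀ x ∈ Ω.gr n, ∀ y,
    Ω.d (Ω.mul x y) = Ω.mul (Ω.d x) y + (-1 : k) ^ n • Ω.mul x (Ω.d y)

/-- The data of a differential calculus on `A` with total space of forms `V`; `incl` is the
identification of `A` with the forms of degree zero. -/
structure CalcStruct (k A V : Type*) [Field k] [AddCommGroup A] [Module k A]
    [AddCommGroup V] [Module k V] extends DGStruct k V where
  incl : A →ₗ[k] V

section Calculus

variable {k A V A' V' : Type*} [Field k] [AddCommGroup A] [Module k A] [AddCommGroup V]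
  [Module k V] [AddCommGroup A'] [Module k A'] [AddCommGroup V'] [Module k V']

/-- `dWord [a₁, …, aₙ] = da₁ ∧ ⋯ ∧ daₙ` (the unit, for the empty list). -/
def CalcStruct.dWord (Ω : CalcStruct k A V) : List A → V
  | [] => Ω.one
  | a :: l => Ω.mul (Ω.d (Ω.incl a)) (Ω.dWord l)

/-- `Ω` is a differential calculus on the algebra `(A, S)`: a differential graded algebra whose
degree zero part is the algebra `A`, such that `Ωⁿ` is spanned by the forms
`a₀ da₁ ∧ ⋯ ∧ daₙ` for `n ≥ 1`. -/
structure CalcStruct.IsCalculus (Ω : CalcStruct k A V) (S : AlgStruct k A) : Prop where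
  base : S.IsAlgebra
  isDGA : Ω.toDGStruct.IsDGA
  incl_injective : Function.Injective Ω.incl
  range_incl : LinearMap.range Ω.incl = Ω.gr 0
  incl_one : Ω.incl S.one = Ω.one
  incl_mul : ∀ a b, Ω.incl (S.mul a b) = Ω.mul (Ω.incl a) (Ω.incl b)
  span_eq : ∀ n, 1 ≤ n → Ω.gr n =
    Submodule.span k {x | ∃ (a : A) (l : List A), l.length = n ∧ x = Ω.mul (Ω.incl a) (Ω.dWord l)}

/-- `F` is a morphism of differential graded algebras with degree zero part `f`; that is,
`F = Ω^•(f)`. -/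
structure IsDifferential (Ω : CalcStruct k A V) (Ω' : CalcStruct k A' V')
    (f : A →ₗ[k] A') (F : V →ₗ[k] V') : Prop where
  map_mem : ∀ n, ∀ x ∈ Ω.gr n, F x ∈ Ω'.gr n
  map_mul : ∀ x y, F (Ω.mul x y) = Ω'.mul (F x) (F y)
  map_d : ∀ x, F (Ω.d x) = Ω'.d (F x)
  map_incl : ∀ a, F (Ω.incl a) = Ω'.incl (f a)

end Calculus

/-! ### Degrees and Koszul signs -/

section Degree

variable {k V W : Type*} [Field k] [AddCommGroup V] [Module k V] [AddCommGroup W] [Module k W]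

open Classical in
/-- For `V = ⨁ gr n`: the linear endomorphism of `V` which is multiplication by `c n` on `gr n`. -/
def degScale (gr : ℕ → Submodule k V) (c : ℕ → k) : V →ₗ[k] V :=
  if h : Function.Bijective (DirectSum.coeLinearMap gr) then
    DirectSum.toModule k ℕ V (fun n => c n • (gr n).subtype) ∘ₗ
      (LinearEquiv.ofBijective (DirectSum.coeLinearMap gr) h).symm.toLinearMap
  else 0

theorem degScale_apply {gr : ℕ → Submodule k V} (h : DirectSum.IsInternal gr) (c : ℕ → k)
    {n : ℕ} {x : V} (hx : x ∈ gr n) : degScale gr c x = c n • x := by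
  have h' : Function.Bijective (DirectSum.coeLinearMap gr) := h
  have e : (LinearEquiv.ofBijective (DirectSum.coeLinearMap gr) h').symm x
      = DirectSum.lof k ℕ (fun i => gr i) n ⟨x, hx⟩ := by
    rw [LinearEquiv.symm_apply_eq, LinearEquiv.ofBijective_apply, DirectSum.coeLinearMap_lof]
  rw [degScale, dif_pos h', LinearMap.comp_apply, LinearEquiv.coe_coe, e, DirectSum.toModule_lof]
  simp

/-- The projection onto the component of degree `n`. -/
def degProj (gr : ℕ → Submodule k V) (n : ℕ) : V →ₗ[k] V :=
  degScale gr (fun m => if m = n then 1 else 0)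

/-- The projection onto the sum of the components of even degree. -/
def evenPart (gr : ℕ → Submodule k V) : V →ₗ[k] V :=
  degScale gr (fun m => if Even m then 1 else 0)

/-- The projection onto the sum of the components of odd degree. -/
def oddPart (gr : ℕ → Submodule k V) : V →ₗ[k] V :=
  degScale gr (fun m => if Even m then 0 else 1)

/-- The sign operator `x ↦ (-1)^|x| x`. -/
def degSign (gr : ℕ → Submodule k V) : V →ₗ[k] V :=
  degScale gr (fun m => (-1) ^ m)

/-- Insertion of the Koszul sign `(-1)^(|w| |v'|)` into a bilinear operation
`(v ⊗ w, v' ⊗ w') ↦ m (v ⊗ w) (v' ⊗ w')`. -/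
def koszul (grV : ℕ → Submodule k V) (grW : ℕ → Submodule k W)
    (m : V ⊗[k] W →ₗ[k] V ⊗[k] W →ₗ[k] V ⊗[k] W) :
    V ⊗[k] W →ₗ[k] V ⊗[k] W →ₗ[k] V ⊗[k] W :=
  m ∘ₗ (evenPart grW).lTensor V +
    (m ∘ₗ (oddPart grW).lTensor V).compl₂ ((degSign grV).rTensor W)

theorem koszul_tmul {grV : ℕ → Submodule k V} {grW : ℕ → Submodule k W}
    (hV : DirectSum.IsInternal grV) (hW : DirectSum.IsInternal grW)
    (m : V ⊗[k] W →ₗ[k] V ⊗[k] W →ₗ[k] V ⊗[k] W) {i j : ℕ} (v : V) {w : W} (hw : w ∈ grW j)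
    {v' : V} (hv' : v' ∈ grV i) (w' : W) :
    koszul grV grW m (v ⊗ₜ w) (v' ⊗ₜ w') = (-1 : k) ^ (j * i) • m (v ⊗ₜ w) (v' ⊗ₜ w') := by
  rcases Nat.even_or_odd j with hj | hj
  · simp [koszul, evenPart, oddPart, degSign, degScale_apply hV _ hv', degScale_apply hW _ hw, hj,
      pow_mul, hj.neg_one_pow]
  · have hj' : ¬ Even j := Nat.not_even_iff_odd.mpr hj
    simp [koszul, evenPart, oddPart, degSign, degScale_apply hV _ hv', degScale_apply hW _ hw, hj',
      pow_mul, hj.neg_one_pow, ← TensorProduct.smul_tmul']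

/-- The grading of a tensor product, `(V ⊗ W)ⁿ = ⨁_{p + q = n} V^p ⊗ W^q`, where `V^p ⊗ W^q` is
regarded as a subspace of `V ⊗ W`. -/
def tensorGr (grV : ℕ → Submodule k V) (grW : ℕ → Submodule k W) (n : ℕ) :
    Submodule k (V ⊗[k] W) :=
  ⨆ p ∈ Finset.HasAntidiagonal.antidiagonal n, LinearMap.range (TensorProduct.mapIncl (grV p.1) (grW p.2))

/-- The sum of the subspaces `V^p ⊗ W^q` of `V ⊗ W` is direct, and it is everything. -/
theorem isInternal_range_mapIncl {grV : ℕ → Submodule k V} {grW : ℕ → Submodule k W}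
    (hV : DirectSum.IsInternal grV) (hW : DirectSum.IsInternal grW) :
    DirectSum.IsInternal (fun p : ℕ × ℕ =>
      LinearMap.range (TensorProduct.mapIncl (grV p.1) (grW p.2))) := by
  have hinj : ∀ p : ℕ × ℕ,
      Function.Injective (TensorProduct.mapIncl (grV p.1) (grW p.2)) := fun p =>
    TensorProduct.map_injective_of_flat_flat _ _
      (grV p.1).subtype_injective (grW p.2).subtype_injective
  have hV' : Function.Bijective (DirectSum.coeLinearMap grV) := hV
  have hW' : Function.Bijective (DirectSum.coeLinearMap grW) := hW
  let e := (TensorProduct.directSum k k (fun i => grV i) (fun i => grW i)).symm ≪≫ₗ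
    TensorProduct.congr (LinearEquiv.ofBijective _ hV') (LinearEquiv.ofBijective _ hW')
  let f : (DirectSum (ℕ × ℕ) fun p => grV p.1 ⊗[k] grW p.2) ≃ₗ[k] DirectSum (ℕ × ℕ) fun p =>
      LinearMap.range (TensorProduct.mapIncl (grV p.1) (grW p.2)) :=
    DFinsupp.mapRange.linearEquiv fun p => LinearEquiv.ofInjective _ (hinj p)
  have key : DirectSum.coeLinearMap (fun p : ℕ × ℕ =>
      LinearMap.range (TensorProduct.mapIncl (grV p.1) (grW p.2))) ∘ₗ f.toLinearMap =
        e.toLinearMap := by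
    refine DirectSum.linearMap_ext k fun p => TensorProduct.ext' fun x y => ?_
    have h1 : f (DirectSum.lof k _ (fun p : ℕ × ℕ => grV p.1 ⊗[k] grW p.2) p (x ⊗ₜ y)) =
        DirectSum.lof k _ _ p (LinearEquiv.ofInjective _ (hinj p) (x ⊗ₜ y)) :=
      DFinsupp.mapRange_single (hf := fun p => map_zero (LinearEquiv.ofInjective _ (hinj p)))
    simp only [LinearMap.comp_apply, LinearEquiv.coe_coe, h1, DirectSum.coeLinearMap_lof]
    obtain ⟨i, j⟩ := p
    simp [e, TensorProduct.mapIncl, TensorProduct.directSum_symm_lof_tmul]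
  have hb : Function.Bijective (DirectSum.coeLinearMap (fun p : ℕ × ℕ =>
      LinearMap.range (TensorProduct.mapIncl (grV p.1) (grW p.2))) ∘ f) := by
    have : (DirectSum.coeLinearMap (fun p : ℕ × ℕ =>
      LinearMap.range (TensorProduct.mapIncl (grV p.1) (grW p.2))) ∘ f) = e :=
      funext fun t => LinearMap.congr_fun key t
    rw [this]
    exact e.bijective
  exact (Function.Bijective.of_comp_iff _ f.bijective).mp hb

/-- The differential `v ⊗ w ↦ dv ⊗ w + (-1)^|v| v ⊗ dw` on a tensor product. -/
def tensorD (Ω : DGStruct k V) (Ω' : DGStruct k W) : V ⊗[k] W →ₗ[k] V ⊗[k] W :=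
  Ω.d.rTensor W + TensorProduct.map (degSign Ω.gr) Ω'.d

/-- The tensor product calculus, with product
`(v ⊗ w) ∧ (v' ⊗ w') = (-1)^(|w| |v'|) (v ∧ v') ⊗ (w ∧ w')`. -/
def CalcStruct.tensor {A A' : Type*} [AddCommGroup A] [Module k A] [AddCommGroup A'] [Module k A']
    (Ω : CalcStruct k A V) (Ω' : CalcStruct k A' W) :
    CalcStruct k (A ⊗[k] A') (V ⊗[k] W) where
  gr := tensorGr Ω.gr Ω'.gr
  mul := koszul Ω.gr Ω'.gr (TensorProduct.map₂ Ω.mul Ω'.mul)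
  one := Ω.one ⊗ₜ Ω'.one
  d := tensorD Ω.toDGStruct Ω'.toDGStruct
  incl := TensorProduct.map Ω.incl Ω'.incl

/-- The projection `V → A` of a calculus onto its forms of degree zero. (A left inverse of `incl`
is only applied to elements of degree zero, so its choice is irrelevant.) -/
def CalcStruct.degZero {A : Type*} [AddCommGroup A] [Module k A] (Ω : CalcStruct k A V) :
    V →ₗ[k] A :=
  Ω.incl.leftInverse ∘ₗ degProj Ω.gr 0

end Degree

/-! ### Right comodule algebras and right covariant calculi -/

section Comodule

variable {k : Type*} [Field k] (H : Type*) [Ring H] [Bialgebra k H]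
  {A V : Type*} [AddCommGroup A] [Module k A] [AddCommGroup V] [Module k V]

/-- `R` is a right `H`-coaction making the algebra `(V, S)` a right `H`-comodule algebra. -/
structure IsRightComoduleAlgebra (S : AlgStruct k V) (R : V →ₗ[k] V ⊗[k] H) : Prop where
  coassoc : TensorProduct.assoc k V H H ∘ₗ R.rTensor H ∘ₗ R =
    (Coalgebra.comul (R := k) (A := H)).lTensor V ∘ₗ R
  counit : TensorProduct.rid k V ∘ₗ (Coalgebra.counit (R := k) (A := H)).lTensor V ∘ₗ R =
    LinearMap.id
  isAlgebra : S.IsAlgebra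
  map_one : R S.one = S.one ⊗ₜ 1
  map_mul : ∀ x y, R (S.mul x y) = TensorProduct.map₂ S.mul (LinearMap.mul k H) (R x) (R y)

/-- The calculus `Ω` on the right `H`-comodule algebra `(A, S, ρ)` is right `H`-covariant. -/
def CalcStruct.IsRightCovariant (Ω : CalcStruct k A V) (S : AlgStruct k A)
    (ρ : A →ₗ[k] A ⊗[k] H) : Prop :=
  Ω.IsCalculus S ∧ IsRightComoduleAlgebra H S ρ ∧
  ∃ R : V →ₗ[k] V ⊗[k] H,
    IsRightComoduleAlgebra H Ω.toAlgStruct R ∧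
    (∀ n, ∀ x ∈ Ω.gr n, R x ∈ LinearMap.range ((Ω.gr n).subtype.rTensor H)) ∧
    R ∘ₗ Ω.incl = Ω.incl.rTensor H ∘ₗ ρ ∧
    R ∘ₗ Ω.d = Ω.d.rTensor H ∘ₗ R

end Comodule

/-! ### Twisted module algebras -/

section Twisted

variable {k H B : Type*} [Field k] [Ring H] [Bialgebra k H] [Ring B] [Algebra k B]

/-- `H` measures `B` by `act`, the map `σ` has convolution inverse `σinv`, and `B` is a
`σ`-twisted left `H`-module algebra. Products of elements `toConv f` are convolution products of
linear maps from the coalgebras `H`, `H ⊗ H`, `H ⊗ (H ⊗ H)` to `B`. -/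
structure IsTwistedModuleAlgebra (act : H →ₗ[k] B →ₗ[k] B) (σ σinv : H ⊗[k] H →ₗ[k] B) :
    Prop where
  act_one : ∀ h, act h 1 = Coalgebra.counit (R := k) h • (1 : B)
  /-- `h · (b b') = (h₁ · b) (h₂ · b')` -/
  act_mul : ∀ b b', toConv (act.flip (b * b')) = toConv (act.flip b) * toConv (act.flip b')
  mul_inv : toConv σ * toConv σinv = 1
  inv_mul : toConv σinv * toConv σ = 1
  one_act : ∀ b, act 1 b = b
  /-- `h · (h' · b) = σ(h₁ ⊗ h'₁) (h₂ h'₂ · b) σ⁻¹(h₃ ⊗ h'₃)` -/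
  act_act : ∀ b, toConv (TensorProduct.lift (act.compl₂ (act.flip b))) =
    toConv σ * toConv (act.flip b ∘ₗ LinearMap.mul' k H) * toConv σinv
  map_tmul_one : ∀ h, σ (h ⊗ₜ 1) = Coalgebra.counit (R := k) h • (1 : B)
  map_one_tmul : ∀ h, σ (1 ⊗ₜ h) = Coalgebra.counit (R := k) h • (1 : B)
  /-- `(h₁ · σ(h'₁ ⊗ h''₁)) σ(h₂ ⊗ h'₂ h''₂) = σ(h₁ ⊗ h'₁) σ(h₂ h'₂ ⊗ h'')`, where the right-hand
  side is written as `(σ(h₁ ⊗ h'₁) ε(h''₁)) σ(h₂ h'₂ ⊗ h''₂)`. -/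
  cocycle :
    toConv (TensorProduct.lift (act.compl₂ σ)) *
        toConv (σ ∘ₗ (LinearMap.mul' k H).lTensor H) =
      toConv (TensorProduct.rid k B ∘ₗ TensorProduct.map σ (Coalgebra.counit (R := k) (A := H)) ∘ₗ
          (TensorProduct.assoc k H H H).symm.toLinearMap) *
        toConv (σ ∘ₗ (LinearMap.mul' k H).rTensor H ∘ₗ
          (TensorProduct.assoc k H H H).symm.toLinearMap)

variable {V : Type*} [AddCommGroup V] [Module k V]

/-- `actWord Ω actΩ [b₁, …, bₙ] h = (h₁ · db₁) ∧ ⋯ ∧ (hₙ · dbₙ)`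
(and `ε(h) 1` for the empty list). -/
def actWord (Ω : CalcStruct k B V) (actΩ : H →ₗ[k] V →ₗ[k] V) : List B → (H →ₗ[k] V)
  | [] => (Coalgebra.counit (R := k) (A := H)).smulRight Ω.one
  | b :: l => TensorProduct.lift Ω.mul ∘ₗ
      TensorProduct.map (actΩ.flip (Ω.d (Ω.incl b))) (actWord Ω actΩ l) ∘ₗ Coalgebra.comul

/-- `actΩ` collects the measure `act` (in degree zero) and linear maps `H ⊗ Ωⁿ(B) → Ωⁿ(B)`,
`n ≥ 1`, which make `Ω` a `σ`-twisted `H`-module differential calculus. -/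
structure IsTwistedModuleCalculus (act : H →ₗ[k] B →ₗ[k] B) (σ : H ⊗[k] H →ₗ[k] B)
    (Ω : CalcStruct k B V) (actΩ : H →ₗ[k] V →ₗ[k] V) : Prop where
  map_mem : ∀ h n, ∀ x ∈ Ω.gr n, actΩ h x ∈ Ω.gr n
  map_incl : ∀ h b, actΩ h (Ω.incl b) = Ω.incl (act h b)
  /-- `h · (b₀ db₁ ∧ ⋯ ∧ dbₙ) = (h₁ · b₀) (h₂ · db₁) ∧ ⋯ ∧ (hₙ₊₁ · dbₙ)` for `n ≥ 1` -/
  map_word : ∀ (h : H) (b : B) (l : List B), l ≠ [] →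
    actΩ h (Ω.mul (Ω.incl b) (Ω.dWord l)) =
      TensorProduct.lift Ω.mul
        (TensorProduct.map (actΩ.flip (Ω.incl b)) (actWord Ω actΩ l) (Coalgebra.comul (R := k) h))
  map_d : ∀ h b, actΩ h (Ω.d (Ω.incl b)) = Ω.d (Ω.incl (act h b))
  d_σ : ∀ t, Ω.d (Ω.incl (σ t)) = 0

end Twisted

/-! ### Crossed products -/

section Crossed

variable {k H X Y : Type*} [Field k] [Ring H] [Bialgebra k H]
  [AddCommGroup X] [Module k X] [AddCommGroup Y] [Module k Y]

/-- `(x ⊗ (h ⊗ g), x' ⊗ g') ↦ x ((h · x') s(g ⊗ g'))`. -/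
def twistedCoeff (mulX : X →ₗ[k] X →ₗ[k] X) (act : H →ₗ[k] X →ₗ[k] X) (s : H ⊗[k] H →ₗ[k] X) :
    X ⊗[k] (H ⊗[k] H) →ₗ[k] X ⊗[k] H →ₗ[k] X :=
  TensorProduct.lift (LinearMap.mk₂ k
    (fun x c => mulX x ∘ₗ TensorProduct.lift mulX ∘ₗ
      TensorProduct.map₂ act (TensorProduct.curry s) c)
    (fun _ _ _ => by ext; simp) (fun _ _ _ => by ext; simp)
    (fun _ _ _ => by ext; simp) (fun _ _ _ => by ext; simp))

/-- The twisted product on `X ⊗ Y`, for a left coaction `lam y = y₋₁ ⊗ y₀` of `H` on `Y`,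
an action of `H` on `X` and `s : H ⊗ H → X`:
`(x ⊗ y) (x' ⊗ y') = x (y₋₂ · x') s(y₋₁ ⊗ y'₋₁) ⊗ y₀ y'₀`. -/
def twistedMul (mulX : X →ₗ[k] X →ₗ[k] X) (act : H →ₗ[k] X →ₗ[k] X) (s : H ⊗[k] H →ₗ[k] X)
    (lam : Y →ₗ[k] H ⊗[k] Y) (mulY : Y →ₗ[k] Y →ₗ[k] Y) :
    X ⊗[k] Y →ₗ[k] X ⊗[k] Y →ₗ[k] X ⊗[k] Y :=
  (TensorProduct.map₂ (twistedCoeff mulX act s) mulY).compl₁₂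
    ((TensorProduct.assoc k X (H ⊗[k] H) Y).symm.toLinearMap ∘ₗ
      (Coalgebra.comul.rTensor Y ∘ₗ lam).lTensor X)
    ((TensorProduct.assoc k X H Y).symm.toLinearMap ∘ₗ lam.lTensor X)

theorem twistedMul_tmul (mulX : X →ₗ[k] X →ₗ[k] X) (act : H →ₗ[k] X →ₗ[k] X)
    (s : H ⊗[k] H →ₗ[k] X) (lam : Y →ₗ[k] H ⊗[k] Y) (mulY : Y →ₗ[k] Y →ₗ[k] Y)
    (x x' : X) (y y' : Y) {ι ι' : Type*} (I : Finset ι) (J : Finset ι')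
    (h g : ι → H) (z : ι → Y) (g' : ι' → H) (z' : ι' → Y)
    (hy : Coalgebra.comul.rTensor Y (lam y) = ∑ i ∈ I, (h i ⊗ₜ[k] g i) ⊗ₜ[k] z i)
    (hy' : lam y' = ∑ j ∈ J, g' j ⊗ₜ[k] z' j) :
    twistedMul mulX act s lam mulY (x ⊗ₜ y) (x' ⊗ₜ y') =
      ∑ i ∈ I, ∑ j ∈ J,
        mulX x (mulX (act (h i) x') (s (g i ⊗ₜ g' j))) ⊗ₜ[k] mulY (z i) (z' j) := by
  simp [twistedMul, twistedCoeff, hy, hy', TensorProduct.tmul_sum, LinearMap.sum_apply]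
  exact Finset.sum_comm

variable {B VB VH : Type*} [Ring B] [Algebra k B] [AddCommGroup VB] [Module k VB]
  [AddCommGroup VH] [Module k VH]

/-- The crossed product `B #_σ H` on `B ⊗ H`:
`(b ⊗ h) (b' ⊗ h') = b (h₁ · b') σ(h₂ ⊗ h'₁) ⊗ h₃ h'₂`, with unit `1 ⊗ 1`. -/
def crossedProduct (act : H →ₗ[k] B →ₗ[k] B) (σ : H ⊗[k] H →ₗ[k] B) :
    AlgStruct k (B ⊗[k] H) where
  mul := twistedMul (LinearMap.mul k B) act σ Coalgebra.comul (LinearMap.mul k H)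
  one := 1 ⊗ₜ 1

/-- The right `H`-coaction `b ⊗ h ↦ (b ⊗ h₁) ⊗ h₂` of `B #_σ H`. -/
def crossedCoaction (k H B : Type*) [Field k] [Ring H] [Bialgebra k H] [Ring B] [Algebra k B] :
    B ⊗[k] H →ₗ[k] (B ⊗[k] H) ⊗[k] H :=
  (TensorProduct.assoc k B H H).symm.toLinearMap ∘ₗ Coalgebra.comul.lTensor B

/-- The left coaction `γ ↦ γ₋₁ ⊗ γ₀` of `H` on `Ω^•(H)`: the component of `DΔ = Ω^•(Δ)` in
`Ω⁰(H) ⊗ Ω^•(H) = H ⊗ Ω^•(H)`. -/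
def leftCoaction (ΩH : CalcStruct k H VH) (DΔ : VH →ₗ[k] VH ⊗[k] VH) : VH →ₗ[k] H ⊗[k] VH :=
  ΩH.degZero.rTensor VH ∘ₗ DΔ

/-- The crossed product calculus, with `Ωⁿ = ⨁ᵢ Ωⁿ⁻ⁱ(B) ⊗ Ωⁱ(H)`,
`(ω ⊗ γ) ∧ (ω' ⊗ γ') = (-1)^(|γ| |ω'|) ω ∧ (γ₋₂ · ω') σ(γ₋₁ ⊗ γ'₋₁) ⊗ γ₀ ∧ γ'₀` and
`d(ω ⊗ γ) = dω ⊗ γ + (-1)^|ω| ω ⊗ dγ`. -/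
def crossedCalculus (σ : H ⊗[k] H →ₗ[k] B) (ΩB : CalcStruct k B VB) (actΩ : H →ₗ[k] VB →ₗ[k] VB)
    (ΩH : CalcStruct k H VH) (DΔ : VH →ₗ[k] VH ⊗[k] VH) :
    CalcStruct k (B ⊗[k] H) (VB ⊗[k] VH) where
  gr := tensorGr ΩB.gr ΩH.gr
  mul := koszul ΩB.gr ΩH.gr
    (twistedMul ΩB.mul actΩ (ΩB.incl ∘ₗ σ) (leftCoaction ΩH DΔ) ΩH.mul)
  one := ΩB.one ⊗ₜ ΩH.one
  d := tensorD ΩB.toDGStruct ΩH.toDGStruct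
  incl := TensorProduct.map ΩB.incl ΩH.incl

/-- The map `ω ⊗ γ ↦ (ω ⊗ γ_[1]) ⊗ γ_[2]`, where `DΔ γ = γ_[1] ⊗ γ_[2]`. -/
def crossedCoactionDifferential (VB : Type*) [AddCommGroup VB] [Module k VB]
    (DΔ : VH →ₗ[k] VH ⊗[k] VH) : VB ⊗[k] VH →ₗ[k] (VB ⊗[k] VH) ⊗[k] VH :=
  (TensorProduct.assoc k VB VH VH).symm.toLinearMap ∘ₗ DΔ.lTensor VB

end Crossed

end CrossedCalc

end

/-!
The crossed product calculus is a calculus because the algebra of forms `Ω(B)` is itself a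
`σ`-twisted `H`-module algebra, and `Ω(H)` is a left `H`-comodule algebra; the wedge product is then
the product of a crossed product `Ω(B) #_σ Ω(H)` with Koszul signs.

* Multiplication in a crossed product is governed by operators `x ⊗ m ↦ x f(m₋₁) ⊗ m₀` (`convAct`),
  for linear maps `f` from a coalgebra to an algebra. They compose like convolution products
  (`convAct_convAct`). Associativity of the twisted product (`twistedMul_assoc`) thus amounts to one
  identity in the convolution algebra of `H ⊗ H ⊗ H` (`twistedPair_comp_mul`), which follows from
  the twisted module condition and the cocycle condition. Since all operations respect the bigrading
  of `Ω(B) ⊗ Ω(H)`, Koszul signs may be inserted (`koszul_assoc`, `tensorD_koszul`).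
* `H` measures `Ω(B)` (`flip_mul`): in `db ∧ (c w)` the Leibniz rule moves `c` to the left. The set
  of forms which satisfy the remaining axioms is a subalgebra which contains all `b` and `db`
  (`isTwistedModuleAlgebra_forms`); here `d ∘ σ = 0` implies `d ∘ σ⁻¹ = 0`.
* A multiplicative map on a calculus which commutes with `d` is determined by its values in degree
  zero (`CalcStruct.IsCalculus.hom_ext`). This shows that `γ ↦ γ₋₁ ⊗ γ₀` is a coaction
  (`isLeftCoaction_leftCoaction`) and that it is compatible with `Ω(Δ)` (`lTensor_leftCoaction`), so
  that `ω ⊗ γ ↦ ω ⊗ γ_[1] ⊗ γ_[2]` is a morphism of differential graded algebras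
  (`isDifferential_crossedCoaction`).
* Forms on the crossed product are spanned by words because `1 ⊗ γ ∧ γ'` is a combination of
  products `(σ⁻¹(γ₋₁ ⊗ γ'₋₁) ⊗ 1) ∧ (1 ⊗ γ₀) ∧ (1 ⊗ γ'₀)`
  (`IsCrossedData.one_tmul_mul_mem_wordSpan`).
* Covariance follows from differentiability of the coaction: project the second factor of `Ω(ρ)` to
  degree zero (`IsDifferential.isRightCovariant`).
-/

open scoped TensorProduct

noncomputable section

namespace CrossedCalc

open TensorProduct WithConv

/-! ### Coactions and convolution operators -/

section ConvAct

variable {k C D M N X : Type*} [Field k] [AddCommGroup C] [Module k C]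
  [AddCommGroup D] [Module k D]
  [AddCommGroup M] [Module k M] [AddCommGroup N] [Module k N] [Ring X] [Algebra k X]

/-- The diagonal coaction of `C ⊗ D` on `M ⊗ N`. -/
def tensorCoaction (lam : M →ₗ[k] C ⊗[k] M) (lam' : N →ₗ[k] D ⊗[k] N) :
    M ⊗[k] N →ₗ[k] (C ⊗[k] D) ⊗[k] (M ⊗[k] N) :=
  (TensorProduct.tensorTensorTensorComm k C M D N).toLinearMap ∘ₗ TensorProduct.map lam lam'

theorem tensorCoaction_tmul (lam : M →ₗ[k] C ⊗[k] M) (lam' : N →ₗ[k] D ⊗[k] N) (m : M) (n : N) :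
    tensorCoaction lam lam' (m ⊗ₜ n) =
      TensorProduct.tensorTensorTensorComm k C M D N (lam m ⊗ₜ lam' n) := rfl

/-- The operator `x ⊗ m ↦ x f(m₋₁) ⊗ m₀` on `X ⊗ M`, for `lam m = m₋₁ ⊗ m₀` and `f : C → X`. -/
def convAct (lam : M →ₗ[k] C ⊗[k] M) (f : WithConv (C →ₗ[k] X)) : X ⊗[k] M →ₗ[k] X ⊗[k] M :=
  (LinearMap.mul' k X).rTensor M ∘ₗ (TensorProduct.assoc k X X M).symm.toLinearMap ∘ₗ
    (f.ofConv.rTensor M ∘ₗ lam).lTensor X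

theorem convAct_tmul (lam : M →ₗ[k] C ⊗[k] M) (f : WithConv (C →ₗ[k] X)) (x : X) (m : M) :
    convAct lam f (x ⊗ₜ m) = (LinearMap.mulLeft k x ∘ₗ f.ofConv).rTensor M (lam m) := by
  simp only [convAct, LinearMap.comp_apply, LinearMap.lTensor_tmul, LinearEquiv.coe_coe]
  generalize lam m = t
  induction t with
  | zero => simp
  | add x y hx hy => simp only [map_add, tmul_add, hx, hy]
  | tmul c m => simp

/-- Naturality of `convAct` along a map `ψ : M → N` covering `φ : C → D`. -/
theorem convAct_lTensor {lam : M →ₗ[k] C ⊗[k] M} {lam' : N →ₗ[k] D ⊗[k] N} (φ : C →ₗ[k] D)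
    (ψ : M →ₗ[k] N) (h : ∀ m, lam' (ψ m) = TensorProduct.map φ ψ (lam m))
    (f : WithConv (D →ₗ[k] X)) (t : X ⊗[k] M) :
    convAct lam' f (ψ.lTensor X t) = ψ.lTensor X (convAct lam (toConv (f.ofConv ∘ₗ φ)) t) := by
  induction t with
  | zero => simp
  | add x y hx hy => simp only [map_add, hx, hy]
  | tmul x m =>
    rw [LinearMap.lTensor_tmul, convAct_tmul, convAct_tmul, h]
    generalize lam m = t
    induction t with
    | zero => simp
    | add x y hx hy => simp only [map_add, hx, hy]
    | tmul c m => simp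

variable [Coalgebra k C] [Coalgebra k D]

/-- `lam` is a left coaction of the coalgebra `C` on `M`. -/
structure IsLeftCoaction (lam : M →ₗ[k] C ⊗[k] M) : Prop where
  coassoc : ∀ m, TensorProduct.assoc k C C M (Coalgebra.comul.rTensor M (lam m)) =
    lam.lTensor C (lam m)
  counit : ∀ m, TensorProduct.lid k M (Coalgebra.counit.rTensor M (lam m)) = m

theorem IsLeftCoaction.tensor {lam : M →ₗ[k] C ⊗[k] M} {lam' : N →ₗ[k] D ⊗[k] N}
    (h : IsLeftCoaction lam) (h' : IsLeftCoaction lam') :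
    IsLeftCoaction (tensorCoaction lam lam') where
  coassoc t := by
    induction t with
    | zero => simp
    | add x y hx hy => simp only [map_add, hx, hy]
    | tmul m n =>
      let Φ : (C ⊗[k] (C ⊗[k] M)) ⊗[k] (D ⊗[k] (D ⊗[k] N)) →ₗ[k]
          (C ⊗[k] D) ⊗[k] ((C ⊗[k] D) ⊗[k] (M ⊗[k] N)) :=
        (TensorProduct.tensorTensorTensorComm k C M D N).toLinearMap.lTensor _ ∘ₗ
          (TensorProduct.tensorTensorTensorComm k C (C ⊗[k] M) D (D ⊗[k] N)).toLinearMap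
      have e1 : ∀ (t : C ⊗[k] M) (t' : D ⊗[k] N),
          TensorProduct.assoc k _ _ _ (Coalgebra.comul.rTensor (M ⊗[k] N)
            (TensorProduct.tensorTensorTensorComm k C M D N (t ⊗ₜ t'))) =
          Φ (TensorProduct.assoc k C C M (Coalgebra.comul.rTensor M t) ⊗ₜ
            TensorProduct.assoc k D D N (Coalgebra.comul.rTensor N t')) := by
        intro t t'
        induction t with
        | zero => simp
        | add x y hx hy => simp only [map_add, add_tmul, hx, hy]
        | tmul c m =>
          induction t' with
          | zero => simp
          | add x y hx hy => simp only [map_add, tmul_add, hx, hy]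
          | tmul d n =>
            simp only [tensorTensorTensorComm_tmul, LinearMap.rTensor_tmul,
              TensorProduct.comul_tmul]
            generalize Coalgebra.comul (R := k) c = u
            generalize Coalgebra.comul (R := k) d = v
            induction u with
            | zero => simp
            | add x y hx hy => simp only [map_add, add_tmul, hx, hy]
            | tmul c1 c2 =>
              induction v with
              | zero => simp
              | add x y hx hy => simp only [map_add, tmul_add, add_tmul, hx, hy]
              | tmul d1 d2 => simp [Φ]
      have e2 : ∀ (t : C ⊗[k] M) (t' : D ⊗[k] N),
          (tensorCoaction lam lam').lTensor _
            (TensorProduct.tensorTensorTensorComm k C M D N (t ⊗ₜ t')) =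
          Φ (lam.lTensor C t ⊗ₜ lam'.lTensor D t') := by
        intro t t'
        induction t with
        | zero => simp
        | add x y hx hy => simp only [map_add, add_tmul, hx, hy]
        | tmul c m =>
          induction t' with
          | zero => simp
          | add x y hx hy => simp only [map_add, tmul_add, hx, hy]
          | tmul d n => simp [Φ, tensorCoaction_tmul]
      rw [tensorCoaction_tmul, e1, e2, h.coassoc, h'.coassoc]
  counit t := by
    induction t with
    | zero => simp
    | add x y hx hy => simp only [map_add, hx, hy]
    | tmul m n =>
      have e1 : ∀ (t : C ⊗[k] M) (t' : D ⊗[k] N),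
          TensorProduct.lid k _ (Coalgebra.counit.rTensor (M ⊗[k] N)
            (TensorProduct.tensorTensorTensorComm k C M D N (t ⊗ₜ t'))) =
          TensorProduct.lid k M (Coalgebra.counit.rTensor M t) ⊗ₜ
            TensorProduct.lid k N (Coalgebra.counit.rTensor N t') := by
        intro t t'
        induction t with
        | zero => simp
        | add x y hx hy => simp only [map_add, add_tmul, hx, hy]
        | tmul c m =>
          induction t' with
          | zero => simp
          | add x y hx hy => simp only [map_add, tmul_add, hx, hy]
          | tmul d n => simp [smul_tmul', smul_smul, mul_comm]
      rw [tensorCoaction_tmul, e1, h.counit, h'.counit]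

/-- The operators `convAct lam f` compose like the convolution algebra, in reverse order. -/
theorem convAct_convAct {lam : M →ₗ[k] C ⊗[k] M} (h : IsLeftCoaction lam)
    (f g : WithConv (C →ₗ[k] X)) (t : X ⊗[k] M) :
    convAct lam g (convAct lam f t) = convAct lam (f * g) t := by
  induction t with
  | zero => simp
  | add x y hx hy => simp only [map_add, hx, hy]
  | tmul x m =>
    let G : C ⊗[k] (C ⊗[k] M) →ₗ[k] X ⊗[k] M := (LinearMap.mul' k X).rTensor M ∘ₗ
      (TensorProduct.assoc k X X M).symm.toLinearMap ∘ₗ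
      TensorProduct.map (LinearMap.mulLeft k x ∘ₗ f.ofConv) (g.ofConv.rTensor M)
    have e1 : ∀ t : C ⊗[k] M, convAct lam g ((LinearMap.mulLeft k x ∘ₗ f.ofConv).rTensor M t) =
        G (lam.lTensor C t) := by
      intro t
      induction t with
      | zero => simp
      | add x y hx hy => simp only [map_add, hx, hy]
      | tmul c m =>
        simp only [LinearMap.rTensor_tmul, convAct_tmul, LinearMap.lTensor_tmul]
        generalize lam m = t
        induction t with
        | zero => simp
        | add x y hx hy => simp only [map_add, tmul_add, hx, hy]
        | tmul c m => simp [G, mul_assoc]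
    have e2 : ∀ t : C ⊗[k] M, (LinearMap.mulLeft k x ∘ₗ (f * g).ofConv).rTensor M t =
        G (TensorProduct.assoc k C C M (Coalgebra.comul.rTensor M t)) := by
      intro t
      induction t with
      | zero => simp
      | add x y hx hy => simp only [map_add, hx, hy]
      | tmul c m =>
        simp only [LinearMap.rTensor_tmul, LinearMap.convMul_def, LinearMap.comp_apply]
        generalize Coalgebra.comul (R := k) c = t
        induction t with
        | zero => simp
        | add x y hx hy => simp only [map_add, add_tmul, hx, hy]
        | tmul c m => simp [G, mul_assoc]
    rw [convAct_tmul, convAct_tmul, e1, e2, h.coassoc]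

theorem convAct_one {lam : M →ₗ[k] C ⊗[k] M} (h : IsLeftCoaction lam) (t : X ⊗[k] M) :
    convAct lam 1 t = t := by
  induction t with
  | zero => simp
  | add x y hx hy => simp only [map_add, hx, hy]
  | tmul x m =>
    have e : ∀ t : C ⊗[k] M,
        (LinearMap.mulLeft k x ∘ₗ (1 : WithConv (C →ₗ[k] X)).ofConv).rTensor M t =
        x ⊗ₜ TensorProduct.lid k M (Coalgebra.counit.rTensor M t) := by
      intro t
      induction t with
      | zero => simp
      | add x y hx hy => simp only [map_add, tmul_add, hx, hy]
      | tmul c m =>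
        simp [LinearMap.convOne_def, Algebra.algebraMap_eq_smul_one, smul_tmul]
    rw [convAct_tmul, e, h.counit]

/-- Precomposition with a morphism of coalgebras respects convolution products. -/
theorem convMul_comp (φ : C →ₗc[k] D) (f g : WithConv (D →ₗ[k] X)) :
    toConv ((f * g).ofConv ∘ₗ φ.toLinearMap) =
      toConv (f.ofConv ∘ₗ φ.toLinearMap) * toConv (g.ofConv ∘ₗ φ.toLinearMap) := by
  rw [LinearMap.convMul_comp_coalgHom_distrib]

end ConvAct

/-! ### The twisted product as a convolution operator -/

section TwistedMul

variable {k H X Y : Type*} [Field k] [Ring H] [Bialgebra k H] [Ring X] [Algebra k X]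
  [AddCommGroup Y] [Module k Y]

/-- The function `h ⊗ c ↦ ε(c) (h · x)` on `H ⊗ C`, as an element of the convolution algebra. -/
def actFst {C : Type*} [AddCommGroup C] [Module k C] [Coalgebra k C]
    (act : H →ₗ[k] X →ₗ[k] X) (x : X) : WithConv (H ⊗[k] C →ₗ[k] X) :=
  toConv (act.flip x ∘ₗ (TensorProduct.rid k H).toLinearMap ∘ₗ Coalgebra.counit.lTensor H)

theorem actFst_mul_apply {C : Type*} [AddCommGroup C] [Module k C] [Coalgebra k C]
    (act : H →ₗ[k] X →ₗ[k] X) (x : X) (s : WithConv (H ⊗[k] C →ₗ[k] X)) (h : H) (c : C) :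
    (actFst act x * s).ofConv (h ⊗ₜ c) = LinearMap.mul' k X
      (TensorProduct.map (act.flip x) (s.ofConv ∘ₗ (TensorProduct.mk k H C).flip c)
        (Coalgebra.comul (R := k) h)) := by
  simp only [LinearMap.convMul_def, LinearMap.comp_apply, TensorProduct.comul_tmul]
  generalize Coalgebra.comul (R := k) h = u
  induction u with
  | zero => simp
  | add x y hx hy => simp only [map_add, add_tmul, hx, hy]
  | tmul h1 h2 =>
    have e : ∀ v : C ⊗[k] C, LinearMap.mul' k X (TensorProduct.map (actFst act x).ofConv s.ofConv
        (AlgebraTensorModule.tensorTensorTensorComm k k k k H H C C ((h1 ⊗ₜ h2) ⊗ₜ v))) =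
        act h1 x * s.ofConv (h2 ⊗ₜ TensorProduct.lid k C (Coalgebra.counit.rTensor C v)) := by
      intro v
      induction v with
      | zero => simp
      | add x y hx hy => simp only [map_add, tmul_add, hx, hy, mul_add]
      | tmul c1 c2 => simp [actFst]
    rw [e]
    simp

/-- The function `h ⊗ g ↦ (h₁ · x) s(h₂ ⊗ g)`, as an element of the convolution algebra. -/
def twistedPair (act : H →ₗ[k] X →ₗ[k] X) (s : H ⊗[k] H →ₗ[k] X) (x : X) :
    WithConv (H ⊗[k] H →ₗ[k] X) :=
  actFst act x * toConv s

theorem twistedPair_apply (act : H →ₗ[k] X →ₗ[k] X) (s : H ⊗[k] H →ₗ[k] X) (x : X) (h g : H) :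
    (twistedPair act s x).ofConv (h ⊗ₜ g) = LinearMap.mul' k X
      (TensorProduct.map (act.flip x) (s ∘ₗ (TensorProduct.mk k H H).flip g)
        (Coalgebra.comul (R := k) h)) :=
  actFst_mul_apply act x (toConv s) h g

/-- The twisted product is the operator of the convolution product `twistedPair`, followed by
multiplication in `Y`. -/
theorem twistedMul_eq_convAct (act : H →ₗ[k] X →ₗ[k] X) (s : H ⊗[k] H →ₗ[k] X)
    (lam : Y →ₗ[k] H ⊗[k] Y) (mulY : Y →ₗ[k] Y →ₗ[k] Y) (x x' : X) (y y' : Y) :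
    twistedMul (LinearMap.mul k X) act s lam mulY (x ⊗ₜ y) (x' ⊗ₜ y') =
      (TensorProduct.lift mulY).lTensor X
        (convAct (tensorCoaction lam lam) (twistedPair act s x') (x ⊗ₜ (y ⊗ₜ y'))) := by
  rw [convAct_tmul, tensorCoaction_tmul]
  simp only [twistedMul, LinearMap.compl₁₂_apply, LinearMap.comp_apply, LinearMap.lTensor_tmul,
    LinearEquiv.coe_coe]
  generalize lam y = t
  generalize lam y' = t'
  induction t with
  | zero => simp
  | add x y hx hy => simp only [map_add, tmul_add, add_tmul, LinearMap.add_apply, hx, hy]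
  | tmul h z =>
    induction t' with
    | zero => simp
    | add x y hx hy => simp only [map_add, tmul_add, hx, hy]
    | tmul g z' =>
      simp only [tensorTensorTensorComm_tmul, LinearMap.rTensor_tmul, LinearMap.comp_apply,
        twistedPair_apply, assoc_symm_tmul]
      generalize Coalgebra.comul (R := k) h = u
      induction u with
      | zero => simp
      | add x y hx hy =>
        simp only [map_add, tmul_add, add_tmul, LinearMap.add_apply, hx, hy]
      | tmul h1 h2 => simp [twistedCoeff]

/-- `h ⊗ h' ⊗ h'' ↦ ε(h'') h ⊗ h'` -/
def forgetThird (k H : Type*) [Field k] [Ring H] [Bialgebra k H] :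
    H ⊗[k] (H ⊗[k] H) →ₗc[k] H ⊗[k] H :=
  Coalgebra.TensorProduct.map (CoalgHom.id k H)
    ((Coalgebra.TensorProduct.rid k k H).toCoalgHom.comp
      (Coalgebra.TensorProduct.map (CoalgHom.id k H) (Coalgebra.counitCoalgHom k H)))

/-- `h ⊗ h' ⊗ h'' ↦ h h' ⊗ h''` -/
def mulFirst (k H : Type*) [Field k] [Ring H] [Bialgebra k H] :
    H ⊗[k] (H ⊗[k] H) →ₗc[k] H ⊗[k] H :=
  (Coalgebra.TensorProduct.map (Bialgebra.mulCoalgHom k H) (CoalgHom.id k H)).comp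
    (Coalgebra.TensorProduct.assoc k k H H H).symm.toCoalgHom

/-- `h ⊗ h' ⊗ h'' ↦ h ⊗ h' h''` -/
def mulLast (k H : Type*) [Field k] [Ring H] [Bialgebra k H] :
    H ⊗[k] (H ⊗[k] H) →ₗc[k] H ⊗[k] H :=
  Coalgebra.TensorProduct.map (CoalgHom.id k H) (Bialgebra.mulCoalgHom k H)

@[simp]
theorem forgetThird_tmul (a b c : H) : forgetThird k H (a ⊗ₜ (b ⊗ₜ c)) =
    a ⊗ₜ (Coalgebra.counit (R := k) c • b) := rfl

@[simp]
theorem mulFirst_tmul (a b c : H) : mulFirst k H (a ⊗ₜ (b ⊗ₜ c)) =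
    (a * b) ⊗ₜ[k] c := rfl

@[simp]
theorem mulLast_tmul (a b c : H) : mulLast k H (a ⊗ₜ (b ⊗ₜ c)) =
    a ⊗ₜ[k] (b * c) := rfl

variable {act : H →ₗ[k] X →ₗ[k] X} {s sinv : H ⊗[k] H →ₗ[k] X}

theorem IsTwistedModuleAlgebra.act_mul_apply (hX : IsTwistedModuleAlgebra act s sinv)
    (h : H) (x x' : X) : act h (x * x') = LinearMap.mul' k X
      (TensorProduct.map (act.flip x) (act.flip x') (Coalgebra.comul (R := k) h)) := by
  simpa using congrArg (fun f => f.ofConv h) (hX.act_mul x x')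

/-- The map `f ↦ (h ⊗ c ↦ h · f(c))` respects convolution products, since `H` measures `X`. -/
theorem lift_compl₂_convMul {C : Type*} [AddCommGroup C] [Module k C] [Coalgebra k C]
    (hact : ∀ b b', toConv (act.flip (b * b')) = toConv (act.flip b) * toConv (act.flip b'))
    (f g : WithConv (C →ₗ[k] X)) :
    toConv (TensorProduct.lift (act.compl₂ (f * g).ofConv)) =
      toConv (TensorProduct.lift (act.compl₂ f.ofConv)) *
        toConv (TensorProduct.lift (act.compl₂ g.ofConv)) := by
  refine congrArg toConv (TensorProduct.ext' fun h c => ?_)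
  simp only [LinearMap.convMul_def, LinearMap.comp_apply, TensorProduct.comul_tmul,
    TensorProduct.lift.tmul, LinearMap.compl₂_apply]
  generalize Coalgebra.comul (R := k) c = v
  induction v with
  | zero => simp
  | add x y hx hy => simp only [map_add, tmul_add, hx, hy]
  | tmul c1 c2 =>
    have e := congrArg (fun F => F.ofConv h) (hact (f.ofConv c1) (g.ofConv c2))
    simp only [LinearMap.convMul_def, LinearMap.comp_apply, LinearMap.flip_apply] at e
    simp only [TensorProduct.map_tmul, LinearMap.mul'_apply, e]
    generalize Coalgebra.comul (R := k) h = u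
    induction u with
    | zero => simp
    | add x y hx hy => simp only [map_add, add_tmul, hx, hy]
    | tmul h1 h2 => simp

/-- The identity between convolution products which expresses the associativity of the twisted
product. -/
theorem twistedPair_comp_mul (hX : IsTwistedModuleAlgebra act s sinv) (x x' : X) :
    toConv ((twistedPair act s x).ofConv ∘ₗ (forgetThird k H).toLinearMap) *
        toConv ((twistedPair act s x').ofConv ∘ₗ (mulFirst k H).toLinearMap) =
      actFst act x * toConv (TensorProduct.lift (act.compl₂ (twistedPair act s x').ofConv)) *
        toConv (s ∘ₗ (mulLast k H).toLinearMap) := by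
  have e1 : toConv ((actFst act x).ofConv ∘ₗ (forgetThird k H).toLinearMap) = actFst act x := by
    refine congrArg toConv (TensorProduct.ext_threefold' fun a b c => ?_)
    simp [actFst, smul_smul, mul_comm]
  have e2 : toConv (TensorProduct.lift
      (act.compl₂ (actFst act x' : WithConv (H ⊗[k] H →ₗ[k] X)).ofConv)) =
      toConv (s ∘ₗ (forgetThird k H).toLinearMap) *
        toConv ((actFst act x').ofConv ∘ₗ (mulFirst k H).toLinearMap) *
        toConv (sinv ∘ₗ (forgetThird k H).toLinearMap) := by
    have e3 : TensorProduct.lift (act.compl₂ (actFst act x' : WithConv (H ⊗[k] H →ₗ[k] X)).ofConv) =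
        (TensorProduct.lift (act.compl₂ (act.flip x'))) ∘ₗ (forgetThird k H).toLinearMap :=
      TensorProduct.ext_threefold' fun a b c => by simp [actFst]
    have e4 : (actFst act x').ofConv ∘ₗ (mulFirst k H).toLinearMap =
        (act.flip x' ∘ₗ LinearMap.mul' k H) ∘ₗ (forgetThird k H).toLinearMap :=
      TensorProduct.ext_threefold' fun a b c => by simp [actFst]
    have e5 := congrArg (fun f => toConv (f.ofConv ∘ₗ (forgetThird k H).toLinearMap))
      (hX.act_act x')
    simp only [convMul_comp] at e5
    rw [e3, e4]
    exact e5
  have e6 : toConv (sinv ∘ₗ (forgetThird k H).toLinearMap) *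
      toConv (s ∘ₗ (forgetThird k H).toLinearMap) = 1 := by
    have e := congrArg (fun f => toConv (f.ofConv ∘ₗ (forgetThird k H).toLinearMap)) hX.inv_mul
    simp only [convMul_comp] at e
    refine e.trans (congrArg toConv (TensorProduct.ext_threefold' fun a b c => ?_))
    simp [LinearMap.convOne_def, mul_assoc]
  have e7 : toConv (TensorProduct.lift (act.compl₂ s)) *
      toConv (s ∘ₗ (mulLast k H).toLinearMap) =
      toConv (s ∘ₗ (forgetThird k H).toLinearMap) * toConv (s ∘ₗ (mulFirst k H).toLinearMap) := by
    refine hX.cocycle.trans (congrArg₂ (· * ·) ?_ ?_)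
    · refine congrArg toConv (TensorProduct.ext_threefold' fun a b c => ?_)
      simp
    · refine congrArg toConv (TensorProduct.ext_threefold' fun a b c => ?_)
      simp
  simp only [twistedPair, convMul_comp, lift_compl₂_convMul hX.act_mul, e1, e2]
  simp only [mul_assoc]
  rw [e7, ← mul_assoc (toConv (sinv ∘ₗ _)), e6, one_mul]

end TwistedMul

/-! ### Associativity, units and naturality of the twisted product -/

section TwistedAssoc

variable {k H X Y : Type*} [Field k] [Ring H] [Bialgebra k H] [Ring X] [Algebra k X]
  [AddCommGroup Y] [Module k Y] {act : H →ₗ[k] X →ₗ[k] X} {s sinv : H ⊗[k] H →ₗ[k] X}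

/-- `x ⊗ v ↦ x' (y₋₁ · x) ⊗ (y₀ ⊗ v)`, where `t = y₋₁ ⊗ y₀`. -/
def actPast {V : Type*} [AddCommGroup V] [Module k V] (act : H →ₗ[k] X →ₗ[k] X) (x' : X)
    (t : H ⊗[k] Y) : X ⊗[k] V →ₗ[k] X ⊗[k] (Y ⊗[k] V) :=
  (TensorProduct.assoc k X Y V).toLinearMap ∘ₗ
    ((LinearMap.mulLeft k x').rTensor Y ∘ₗ (LinearMap.rTensorHom Y ∘ₗ act.flip).flip t).rTensor V

theorem actPast_tmul_tmul {V : Type*} [AddCommGroup V] [Module k V] (x' : X) (h : H) (y : Y)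
    (x : X) (v : V) : actPast act x' (h ⊗ₜ[k] y) (x ⊗ₜ v) = (x' * act h x) ⊗ₜ (y ⊗ₜ v) := by
  simp [actPast]

theorem actPast_add {V : Type*} [AddCommGroup V] [Module k V] (x' : X) (t t' : H ⊗[k] Y) :
    (actPast act x' (t + t') : X ⊗[k] V →ₗ[k] _) = actPast act x' t + actPast act x' t' := by
  simp [actPast, LinearMap.comp_add, LinearMap.rTensor_add]

theorem actPast_zero {V : Type*} [AddCommGroup V] [Module k V] (x' : X) :
    (actPast act x' (0 : H ⊗[k] Y) : X ⊗[k] V →ₗ[k] _) = 0 := by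
  simp [actPast]

/-- Applying the operator of `f` and then `actPast` is the operator of the convolution product of
`h ↦ h · x'` and `h ⊗ c ↦ h · f(c)`. -/
theorem actPast_convAct {C V : Type*} [AddCommGroup C] [Module k C] [Coalgebra k C]
    [AddCommGroup V] [Module k V] (hX : IsTwistedModuleAlgebra act s sinv)
    (lam : Y →ₗ[k] H ⊗[k] Y) (lam' : V →ₗ[k] C ⊗[k] V) (f : WithConv (C →ₗ[k] X)) (x x' : X)
    (y : Y) (v : V) :
    actPast act x (lam y) (convAct lam' f (x' ⊗ₜ v)) =
      convAct (tensorCoaction lam lam')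
        (actFst act x' * toConv (TensorProduct.lift (act.compl₂ f.ofConv))) (x ⊗ₜ (y ⊗ₜ v)) := by
  rw [convAct_tmul, convAct_tmul, tensorCoaction_tmul]
  generalize lam y = t
  generalize lam' v = t'
  induction t with
  | zero => simp [actPast_zero]
  | add x y hx hy => simp only [map_add, add_tmul, actPast_add, LinearMap.add_apply, hx, hy]
  | tmul h y =>
    induction t' with
    | zero => simp
    | add x y hx hy => simp only [map_add, tmul_add, hx, hy]
    | tmul c v =>
      simp only [tensorTensorTensorComm_tmul, LinearMap.rTensor_tmul, LinearMap.comp_apply,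
        actFst_mul_apply, actPast_tmul_tmul, LinearMap.mulLeft_apply, hX.act_mul_apply]
      congr 5

/-- The operator of `actFst` is `actPast`: it only sees the coaction on the first tensor factor. -/
theorem convAct_actFst {C V : Type*} [AddCommGroup C] [Module k C] [Coalgebra k C]
    [AddCommGroup V] [Module k V]
    (lam : Y →ₗ[k] H ⊗[k] Y) {lam' : V →ₗ[k] C ⊗[k] V} (h' : IsLeftCoaction lam') (x x' : X)
    (y : Y) (v : V) :
    convAct (tensorCoaction lam lam') (actFst act x') (x ⊗ₜ (y ⊗ₜ v)) =
      actPast act x (lam y) (x' ⊗ₜ v) := by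
  have e : ∀ t' : C ⊗[k] V, (LinearMap.mulLeft k x ∘ₗ (actFst act x').ofConv).rTensor (Y ⊗[k] V)
      (TensorProduct.tensorTensorTensorComm k H Y C V (lam y ⊗ₜ t')) =
      actPast act x (lam y) (x' ⊗ₜ (TensorProduct.lid k V (Coalgebra.counit.rTensor V t'))) := by
    intro t'
    generalize lam y = t
    induction t with
    | zero => simp [actPast_zero]
    | add x y hx hy => simp only [map_add, add_tmul, actPast_add, LinearMap.add_apply, hx, hy]
    | tmul h y =>
      induction t' with
      | zero => simp
      | add x y hx hy => simp only [map_add, tmul_add, hx, hy]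
      | tmul c v => simp [actFst, actPast_tmul_tmul, smul_tmul']
  rw [convAct_tmul, tensorCoaction_tmul, e, h'.counit]

/-- `mulY` is a bilinear operation for which the coaction `lam` is multiplicative. -/
def IsMulCoaction (lam : Y →ₗ[k] H ⊗[k] Y) (mulY : Y →ₗ[k] Y →ₗ[k] Y) : Prop :=
  ∀ y y', lam (mulY y y') = TensorProduct.map₂ (LinearMap.mul k H) mulY (lam y) (lam y')

variable {lam : Y →ₗ[k] H ⊗[k] Y} {mulY : Y →ₗ[k] Y →ₗ[k] Y}

theorem IsMulCoaction.lift (hm : IsMulCoaction lam mulY) (y y' : Y) :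
    lam (mulY y y') = TensorProduct.map (LinearMap.mul' k H) (TensorProduct.lift mulY)
      (tensorCoaction lam lam (y ⊗ₜ y')) := by
  rw [hm, tensorCoaction_tmul]
  generalize lam y = t
  generalize lam y' = t'
  induction t with
  | zero => simp
  | add x y hx hy => simp only [map_add, add_tmul, LinearMap.add_apply, hx, hy]
  | tmul h y =>
    induction t' with
    | zero => simp
    | add x y hx hy => simp only [map_add, tmul_add, hx, hy]
    | tmul c v => simp

theorem twistedMul_assoc (hX : IsTwistedModuleAlgebra act s sinv) (hl : IsLeftCoaction lam)
    (hm : IsMulCoaction lam mulY) (hassoc : ∀ x y z, mulY (mulY x y) z = mulY x (mulY y z))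
    (a b c : X ⊗[k] Y) :
    twistedMul (LinearMap.mul k X) act s lam mulY
        (twistedMul (LinearMap.mul k X) act s lam mulY a b) c =
      twistedMul (LinearMap.mul k X) act s lam mulY a
        (twistedMul (LinearMap.mul k X) act s lam mulY b c) := by
  let lam2 := tensorCoaction lam lam
  let lam3 := tensorCoaction lam lam2
  have h2 : IsLeftCoaction lam2 := hl.tensor hl
  have h3 : IsLeftCoaction lam3 := hl.tensor h2
  let μ := TensorProduct.lift mulY
  let μ3 : Y ⊗[k] (Y ⊗[k] Y) →ₗ[k] Y := μ ∘ₗ μ.lTensor Y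
  let ψ : Y ⊗[k] (Y ⊗[k] Y) →ₗ[k] Y ⊗[k] Y :=
    μ.rTensor Y ∘ₗ (TensorProduct.assoc k Y Y Y).symm.toLinearMap
  have hψ : μ ∘ₗ ψ = μ3 := TensorProduct.ext_threefold' fun x y z => by simp [μ, ψ, μ3, hassoc]
  have hψlam : ∀ m, lam2 (ψ m) = TensorProduct.map (mulFirst k H).toLinearMap ψ (lam3 m) := by
    refine fun m => LinearMap.congr_fun (f := lam2 ∘ₗ ψ)
      (g := TensorProduct.map (mulFirst k H).toLinearMap ψ ∘ₗ lam3) ?_ m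
    refine TensorProduct.ext_threefold' fun x y z => ?_
    simp only [LinearMap.comp_apply, LinearEquiv.coe_coe, assoc_symm_tmul, LinearMap.rTensor_tmul,
      lam2, lam3, tensorCoaction_tmul, ψ, μ, TensorProduct.lift.tmul, hm.lift]
    generalize lam x = t1
    generalize lam y = t2
    generalize lam z = t3
    induction t1 with
    | zero => simp
    | add x y hx hy => simp only [map_add, add_tmul, hx, hy]
    | tmul h y =>
      induction t2 with
      | zero => simp
      | add x y hx hy => simp only [map_add, add_tmul, tmul_add, hx, hy]
      | tmul h y =>
        induction t3 with
        | zero => simp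
        | add x y hx hy => simp only [map_add, tmul_add, hx, hy]
        | tmul h y => simp
  have hμlam : ∀ m, lam2 (μ.lTensor Y m) =
      TensorProduct.map (mulLast k H).toLinearMap (μ.lTensor Y) (lam3 m) := by
    refine fun m => LinearMap.congr_fun (f := lam2 ∘ₗ μ.lTensor Y)
      (g := TensorProduct.map (mulLast k H).toLinearMap (μ.lTensor Y) ∘ₗ lam3) ?_ m
    refine TensorProduct.ext_threefold' fun x y z => ?_
    simp only [LinearMap.comp_apply, LinearMap.lTensor_tmul,
      lam2, lam3, tensorCoaction_tmul, μ, TensorProduct.lift.tmul, hm.lift]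
    generalize lam x = t1
    generalize lam y = t2
    generalize lam z = t3
    induction t1 with
    | zero => simp
    | add x y hx hy => simp only [map_add, add_tmul, hx, hy]
    | tmul h y =>
      induction t2 with
      | zero => simp
      | add x y hx hy => simp only [map_add, add_tmul, tmul_add, hx, hy]
      | tmul h y =>
        induction t3 with
        | zero => simp
        | add x y hx hy => simp only [map_add, tmul_add, hx, hy]
        | tmul h y => simp
  -- Both sides are trilinear, so pure tensors suffice.
  induction a with
  | zero => simp
  | add x y hx hy => simp only [map_add, LinearMap.add_apply, hx, hy]
  | tmul x y =>
  induction b with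
  | zero => simp
  | add x y hx hy => simp only [map_add, LinearMap.add_apply, hx, hy]
  | tmul x' y' =>
  induction c with
  | zero => simp
  | add x y hx hy => simp only [map_add, hx, hy]
  | tmul x'' y'' =>
  let J : X ⊗[k] (Y ⊗[k] Y) →ₗ[k] X ⊗[k] (Y ⊗[k] (Y ⊗[k] Y)) :=
    (((TensorProduct.mk k Y Y).flip y'').lTensor Y).lTensor X
  have L1 : ∀ w, twistedMul (LinearMap.mul k X) act s lam mulY (μ.lTensor X w) (x'' ⊗ₜ y'') =
      μ3.lTensor X (convAct lam3
        (toConv ((twistedPair act s x'').ofConv ∘ₗ (mulFirst k H).toLinearMap)) (J w)) := by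
    intro w
    induction w with
    | zero => simp
    | add x y hx hy => simp only [map_add, LinearMap.add_apply, hx, hy]
    | tmul z v =>
      induction v with
      | zero => simp
      | add x y hx hy => simp only [map_add, tmul_add, LinearMap.add_apply, hx, hy]
      | tmul u u' =>
        rw [LinearMap.lTensor_tmul, TensorProduct.lift.tmul, twistedMul_eq_convAct, ← hψ,
          LinearMap.lTensor_comp, LinearMap.comp_apply,
          ← convAct_lTensor (mulFirst k H).toLinearMap ψ hψlam]
        simp [J, ψ, μ, lam2]
  have L2 : ∀ f w, J (convAct lam2 f w) =
      convAct lam3 (toConv (f.ofConv ∘ₗ (forgetThird k H).toLinearMap)) (J w) := by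
    intro f w
    induction w with
    | zero => simp
    | add x y hx hy => simp only [map_add, hx, hy]
    | tmul z v =>
      induction v with
      | zero => simp
      | add x y hx hy => simp only [map_add, tmul_add, hx, hy]
      | tmul u u' =>
        simp only [J, LinearMap.lTensor_tmul, LinearMap.flip_apply, TensorProduct.mk_apply,
          convAct_tmul, lam2, lam3, tensorCoaction_tmul]
        nth_rewrite 1 [← hl.counit y'']
        generalize lam u = t1
        generalize lam u' = t2
        generalize lam y'' = t3
        induction t1 with
        | zero => simp
        | add x y hx hy => simp only [map_add, add_tmul, hx, hy]
        | tmul h y =>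
          induction t2 with
          | zero => simp
          | add x y hx hy => simp only [map_add, add_tmul, tmul_add, hx, hy]
          | tmul h y =>
            induction t3 with
            | zero => simp
            | add x y hx hy =>
              simp only [map_add, tmul_add, LinearMap.lTensor_add, LinearMap.add_apply, hx, hy]
            | tmul h y => simp [← smul_tmul']
  have R1 : ∀ w, twistedMul (LinearMap.mul k X) act s lam mulY (x ⊗ₜ y) (μ.lTensor X w) =
      μ3.lTensor X (convAct lam3 (toConv (s ∘ₗ (mulLast k H).toLinearMap))
        (actPast act x (lam y) w)) := by
    intro w
    induction w with
    | zero => simp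
    | add x y hx hy => simp only [map_add, hx, hy]
    | tmul z v =>
      rw [LinearMap.lTensor_tmul, twistedMul_eq_convAct, ← convAct_actFst lam h2,
        convAct_convAct h3]
      have e : actFst act z * toConv (s ∘ₗ (mulLast k H).toLinearMap) =
          toConv ((twistedPair act s z).ofConv ∘ₗ (mulLast k H).toLinearMap) := by
        rw [twistedPair, convMul_comp]
        congr 1
        refine congrArg toConv (TensorProduct.ext_threefold' fun a b c => ?_)
        simp [actFst, mul_comm]
      rw [e]
      simp only [μ3, LinearMap.lTensor_comp, LinearMap.comp_apply]
      rw [← convAct_lTensor (mulLast k H).toLinearMap (μ.lTensor Y) hμlam]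
      simp [lam2, μ]
  rw [twistedMul_eq_convAct _ _ _ _ x x', twistedMul_eq_convAct _ _ _ _ x' x'', L1, L2,
    convAct_convAct h3, R1, actPast_convAct hX, convAct_convAct h3, twistedPair_comp_mul hX]
  simp [J, lam3]

/-- The twisted product is left `X`-linear. -/
theorem twistedMul_mul_left (act : H →ₗ[k] X →ₗ[k] X) (s : H ⊗[k] H →ₗ[k] X)
    (lam : Y →ₗ[k] H ⊗[k] Y) (mulY : Y →ₗ[k] Y →ₗ[k] Y) (x x' : X) (y : Y) (t : X ⊗[k] Y) :
    twistedMul (LinearMap.mul k X) act s lam mulY ((x * x') ⊗ₜ y) t =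
      (LinearMap.mulLeft k x).rTensor Y
        (twistedMul (LinearMap.mul k X) act s lam mulY (x' ⊗ₜ y) t) := by
  induction t with
  | zero => simp
  | add x y hx hy => simp only [map_add, hx, hy]
  | tmul x'' y' =>
    rw [twistedMul_eq_convAct, twistedMul_eq_convAct, convAct_tmul, convAct_tmul]
    generalize tensorCoaction lam lam (y ⊗ₜ y') = u
    induction u with
    | zero => simp
    | add x y hx hy => simp only [map_add, hx, hy]
    | tmul c m => simp

theorem one_twistedMul (hX : IsTwistedModuleAlgebra act s sinv) (hl : IsLeftCoaction lam)
    {e : Y} (he : lam e = 1 ⊗ₜ e) (hone : ∀ y, mulY e y = y) (a : X ⊗[k] Y) :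
    twistedMul (LinearMap.mul k X) act s lam mulY (1 ⊗ₜ e) a = a := by
  induction a with
  | zero => simp
  | add x y hx hy => simp only [map_add, hx, hy]
  | tmul x y =>
    have key : ∀ t : H ⊗[k] Y, (TensorProduct.lift mulY).lTensor X
      ((LinearMap.mulLeft k (1 : X) ∘ₗ (twistedPair act s x).ofConv).rTensor (Y ⊗[k] Y)
        (TensorProduct.tensorTensorTensorComm k H Y H Y (((1 : H) ⊗ₜ e) ⊗ₜ t))) =
        x ⊗ₜ TensorProduct.lid k Y (Coalgebra.counit.rTensor Y t) := by
      intro t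
      induction t with
      | zero => simp
      | add x y hx hy => simp only [map_add, tmul_add, hx, hy]
      | tmul h y =>
        simp [twistedPair_apply, hX.map_one_tmul, hX.one_act, hone,
          Algebra.TensorProduct.one_def, smul_tmul]
    rw [twistedMul_eq_convAct, convAct_tmul, tensorCoaction_tmul, he, key, hl.counit]

/-- Multiplying from the right by an element `x' ⊗ 1` only involves the action. -/
theorem twistedMul_tmul_one (hX : IsTwistedModuleAlgebra act s sinv)
    {e : Y} (he : lam e = 1 ⊗ₜ e) (hone : ∀ y, mulY y e = y) (x x' : X) (y : Y) :
    twistedMul (LinearMap.mul k X) act s lam mulY (x ⊗ₜ y) (x' ⊗ₜ e) =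
      (LinearMap.mulLeft k x ∘ₗ act.flip x').rTensor Y (lam y) := by
  have key : ∀ t : H ⊗[k] Y, (TensorProduct.lift mulY).lTensor X
      ((LinearMap.mulLeft k x ∘ₗ (twistedPair act s x').ofConv).rTensor (Y ⊗[k] Y)
        (TensorProduct.tensorTensorTensorComm k H Y H Y (t ⊗ₜ ((1 : H) ⊗ₜ e)))) =
        (LinearMap.mulLeft k x ∘ₗ act.flip x').rTensor Y t := by
    intro t
    induction t with
    | zero => simp
    | add x y hx hy => simp only [map_add, add_tmul, hx, hy]
    | tmul h y =>
      have : ∀ u : H ⊗[k] H, LinearMap.mul' k X (TensorProduct.map (act.flip x')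
          (s ∘ₗ (TensorProduct.mk k H H).flip 1) u) =
          act (TensorProduct.rid k H (Coalgebra.counit.lTensor H u)) x' := by
        intro u
        induction u with
        | zero => simp
        | add x y hx hy => simp only [map_add, LinearMap.add_apply, hx, hy]
        | tmul a b => simp [hX.map_tmul_one]
      simp [twistedPair_apply, this, hone]
  rw [twistedMul_eq_convAct, convAct_tmul, tensorCoaction_tmul, he, key]

theorem twistedMul_one (hX : IsTwistedModuleAlgebra act s sinv) (hl : IsLeftCoaction lam)
    {e : Y} (he : lam e = 1 ⊗ₜ e) (hone : ∀ y, mulY y e = y) (a : X ⊗[k] Y) :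
    twistedMul (LinearMap.mul k X) act s lam mulY a (1 ⊗ₜ e) = a := by
  induction a with
  | zero => simp
  | add x y hx hy => simp only [map_add, LinearMap.add_apply, hx, hy]
  | tmul x y =>
    have key : ∀ t : H ⊗[k] Y, (LinearMap.mulLeft k x ∘ₗ act.flip 1).rTensor Y t =
        x ⊗ₜ TensorProduct.lid k Y (Coalgebra.counit.rTensor Y t) := by
      intro t
      induction t with
      | zero => simp
      | add x y hx hy => simp only [map_add, tmul_add, hx, hy]
      | tmul h y => simp [hX.act_one, smul_tmul]
    rw [twistedMul_tmul_one hX he hone, key, hl.counit]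

/-- Naturality of the twisted product in all of its data. -/
theorem map_twistedMul {X₁ X₂ Y₁ Y₂ : Type*} [AddCommGroup X₁] [Module k X₁] [AddCommGroup X₂]
    [Module k X₂] [AddCommGroup Y₁] [Module k Y₁] [AddCommGroup Y₂] [Module k Y₂]
    {mul₁ : X₁ →ₗ[k] X₁ →ₗ[k] X₁} {mul₂ : X₂ →ₗ[k] X₂ →ₗ[k] X₂}
    {act₁ : H →ₗ[k] X₁ →ₗ[k] X₁} {act₂ : H →ₗ[k] X₂ →ₗ[k] X₂}
    {s₁ : H ⊗[k] H →ₗ[k] X₁} {s₂ : H ⊗[k] H →ₗ[k] X₂}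
    {lam₁ : Y₁ →ₗ[k] H ⊗[k] Y₁} {lam₂ : Y₂ →ₗ[k] H ⊗[k] Y₂}
    {mulY₁ : Y₁ →ₗ[k] Y₁ →ₗ[k] Y₁} {mulY₂ : Y₂ →ₗ[k] Y₂ →ₗ[k] Y₂}
    (φ : X₁ →ₗ[k] X₂) (ψ : Y₁ →ₗ[k] Y₂) (hφ : ∀ x y, φ (mul₁ x y) = mul₂ (φ x) (φ y))
    (hact : ∀ h x, φ (act₁ h x) = act₂ h (φ x)) (hs : ∀ t, φ (s₁ t) = s₂ t)
    (hψ : ∀ x y, ψ (mulY₁ x y) = mulY₂ (ψ x) (ψ y)) (hlam : ∀ y, lam₂ (ψ y) = ψ.lTensor H (lam₁ y))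
    (a b : X₁ ⊗[k] Y₁) :
    TensorProduct.map φ ψ (twistedMul mul₁ act₁ s₁ lam₁ mulY₁ a b) =
      twistedMul mul₂ act₂ s₂ lam₂ mulY₂ (TensorProduct.map φ ψ a) (TensorProduct.map φ ψ b) := by
  induction a with
  | zero => simp
  | add x y hx hy => simp only [map_add, LinearMap.add_apply, hx, hy]
  | tmul x y =>
  induction b with
  | zero => simp
  | add x y hx hy => simp only [map_add, hx, hy]
  | tmul x' y' =>
  simp only [TensorProduct.map_tmul, twistedMul, LinearMap.compl₁₂_apply, LinearMap.comp_apply,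
    LinearMap.lTensor_tmul, LinearEquiv.coe_coe, hlam]
  generalize lam₁ y = t
  generalize lam₁ y' = t'
  induction t with
  | zero => simp
  | add x y hx hy => simp only [map_add, tmul_add, LinearMap.add_apply, hx, hy]
  | tmul h z =>
    induction t' with
    | zero => simp
    | add x y hx hy => simp only [map_add, tmul_add, hx, hy]
    | tmul g z' =>
      simp only [LinearMap.rTensor_tmul, LinearMap.lTensor_tmul]
      generalize Coalgebra.comul (R := k) h = u
      induction u with
      | zero => simp
      | add x y hx hy =>
        simp only [map_add, tmul_add, add_tmul, LinearMap.add_apply, hx, hy]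
      | tmul h1 h2 => simp [twistedCoeff, hφ, hψ, hs, hact]

end TwistedAssoc

/-! ### Tensor products of graded spaces -/

section Graded

variable {k V W : Type*} [Field k] [AddCommGroup V] [Module k V] [AddCommGroup W] [Module k W]
  {grV : ℕ → Submodule k V} {grW : ℕ → Submodule k W}

@[elab_as_elim]
theorem homogeneous_induction (hV : DirectSum.IsInternal grV) {p : V → Prop}
    (mem : ∀ n, ∀ x ∈ grV n, p x) (zero : p 0) (add : ∀ x y, p x → p y → p (x + y)) (x : V) :
    p x := by
  have hx : x ∈ ⨆ n, grV n := by
    rw [hV.submodule_iSup_eq_top]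
    trivial
  exact Submodule.iSup_induction grV (motive := p) hx mem zero add

@[elab_as_elim]
theorem homogeneous_tmul_induction (hV : DirectSum.IsInternal grV) (hW : DirectSum.IsInternal grW)
    {p : V ⊗[k] W → Prop} (mem : ∀ i j, ∀ v ∈ grV i, ∀ w ∈ grW j, p (v ⊗ₜ w)) (zero : p 0)
    (add : ∀ x y, p x → p y → p (x + y)) (x : V ⊗[k] W) : p x := by
  induction x with
  | zero => exact zero
  | add x y hx hy => exact add x y hx hy
  | tmul v w =>
    refine homogeneous_induction hV (p := fun v => p (v ⊗ₜ w)) ?_ ?_ ?_ v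
    · intro i v hv
      refine homogeneous_induction hW (p := fun w => p (v ⊗ₜ w)) ?_ ?_ ?_ w
      · exact fun j w hw => mem i j v hv w hw
      · simpa using zero
      · intro x y hx hy
        rw [tmul_add]
        exact add _ _ hx hy
    · simpa using zero
    · intro x y hx hy
      rw [add_tmul]
      exact add _ _ hx hy

/-- The subspace `V^i ⊗ W^j` of `V ⊗ W`. -/
def biGr (grV : ℕ → Submodule k V) (grW : ℕ → Submodule k W) (i j : ℕ) : Submodule k (V ⊗[k] W) :=
  LinearMap.range (TensorProduct.mapIncl (grV i) (grW j))

theorem tmul_mem_biGr {i j : ℕ} {v : V} {w : W} (hv : v ∈ grV i) (hw : w ∈ grW j) :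
    v ⊗ₜ[k] w ∈ biGr grV grW i j :=
  ⟨⟨v, hv⟩ ⊗ₜ ⟨w, hw⟩, rfl⟩

theorem biGr_induction {i j : ℕ} {p : V ⊗[k] W → Prop}
    (mem : ∀ v ∈ grV i, ∀ w ∈ grW j, p (v ⊗ₜ w)) (zero : p 0)
    (add : ∀ x y, p x → p y → p (x + y)) {x : V ⊗[k] W} (hx : x ∈ biGr grV grW i j) : p x := by
  obtain ⟨u, rfl⟩ := hx
  induction u with
  | zero => simpa using zero
  | add x y hx hy => simpa using add _ _ hx hy
  | tmul v w => exact mem v v.2 w w.2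

theorem biGr_le_tensorGr {i j n : ℕ} (h : i + j = n) : biGr grV grW i j ≤ tensorGr grV grW n :=
  le_iSup₂_of_le (f := fun p (_ : p ∈ Finset.HasAntidiagonal.antidiagonal n) =>
    biGr grV grW p.1 p.2) (i, j) (by simpa using h) le_rfl

theorem tmul_mem_tensorGr {i j n : ℕ} (h : i + j = n) {v : V} {w : W} (hv : v ∈ grV i)
    (hw : w ∈ grW j) : v ⊗ₜ[k] w ∈ tensorGr grV grW n :=
  biGr_le_tensorGr h (tmul_mem_biGr hv hw)

theorem tensorGr_induction {n : ℕ} {p : V ⊗[k] W → Prop}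
    (mem : ∀ i j, i + j = n → ∀ v ∈ grV i, ∀ w ∈ grW j, p (v ⊗ₜ w)) (zero : p 0)
    (add : ∀ x y, p x → p y → p (x + y)) {x : V ⊗[k] W} (hx : x ∈ tensorGr grV grW n) : p x := by
  rw [tensorGr, iSup_subtype'] at hx
  refine Submodule.iSup_induction _ (motive := p) hx ?_ zero add
  rintro ⟨⟨i, j⟩, hij⟩ x hx
  exact biGr_induction (mem i j (by simpa using hij)) zero add hx

theorem tensorGr_isInternal (hV : DirectSum.IsInternal grV) (hW : DirectSum.IsInternal grW) :
    DirectSum.IsInternal (tensorGr grV grW) := by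
  have h := isInternal_range_mapIncl hV hW
  rw [DirectSum.isInternal_submodule_iff_iSupIndep_and_iSup_eq_top]
  constructor
  · intro n
    have hd := h.submodule_iSupIndep.disjoint_biSup_biSup
      (s := {p : ℕ × ℕ | p.1 + p.2 = n}) (t := {p | p.1 + p.2 ≠ n})
      (Set.disjoint_left.mpr fun p hp hp' => hp' hp)
    refine hd.mono ?_ ?_
    · refine iSup₂_le fun p hp => ?_
      exact le_iSup₂_of_le (f := fun (p : ℕ × ℕ) (_ : p ∈ {p : ℕ × ℕ | p.1 + p.2 = n}) =>
        LinearMap.range (TensorProduct.mapIncl (grV p.1) (grW p.2))) p (by simpa using hp) le_rfl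
    · refine iSup₂_le fun m hm => iSup₂_le fun p hp => ?_
      refine le_iSup₂_of_le (f := fun (p : ℕ × ℕ) (_ : p ∈ {p : ℕ × ℕ | p.1 + p.2 ≠ n}) =>
        LinearMap.range (TensorProduct.mapIncl (grV p.1) (grW p.2))) p ?_ le_rfl
      have : p.1 + p.2 = m := by simpa using hp
      simpa [this] using hm
  · rw [eq_top_iff, ← h.submodule_iSup_eq_top]
    exact iSup_le fun p => (biGr_le_tensorGr (i := p.1) (j := p.2) rfl).trans (le_iSup _ _)

theorem koszul_of_mem (hV : DirectSum.IsInternal grV) (hW : DirectSum.IsInternal grW)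
    (m : V ⊗[k] W →ₗ[k] V ⊗[k] W →ₗ[k] V ⊗[k] W) {i j i' j' : ℕ} {t t' : V ⊗[k] W}
    (ht : t ∈ biGr grV grW i j) (ht' : t' ∈ biGr grV grW i' j') :
    koszul grV grW m t t' = (-1 : k) ^ (j * i') • m t t' := by
  refine biGr_induction (p := fun t => koszul grV grW m t t' = (-1 : k) ^ (j * i') • m t t')
    (fun v hv w hw => ?_) (by simp) (fun x y hx hy => by simp [hx, hy]) ht
  refine biGr_induction (p := fun t' => koszul grV grW m (v ⊗ₜ w) t' =
    (-1 : k) ^ (j * i') • m (v ⊗ₜ w) t')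
    (fun v' hv' w' hw' => ?_) (by simp) (fun x y hx hy => by simp [hx, hy]) ht'
  exact koszul_tmul hV hW m v hw hv' w'

/-- The bilinear operation `m` on `V ⊗ W` respects the bigrading. -/
def IsBigraded (grV : ℕ → Submodule k V) (grW : ℕ → Submodule k W)
    (m : V ⊗[k] W →ₗ[k] V ⊗[k] W →ₗ[k] V ⊗[k] W) : Prop :=
  ∀ i j i' j', ∀ v ∈ grV i, ∀ w ∈ grW j, ∀ v' ∈ grV i', ∀ w' ∈ grW j',
    m (v ⊗ₜ w) (v' ⊗ₜ w') ∈ biGr grV grW (i + i') (j + j')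

theorem koszul_assoc (hV : DirectSum.IsInternal grV) (hW : DirectSum.IsInternal grW)
    {m : V ⊗[k] W →ₗ[k] V ⊗[k] W →ₗ[k] V ⊗[k] W} (hm : IsBigraded grV grW m)
    (hassoc : ∀ a b c, m (m a b) c = m a (m b c)) (a b c : V ⊗[k] W) :
    koszul grV grW m (koszul grV grW m a b) c = koszul grV grW m a (koszul grV grW m b c) := by
  refine homogeneous_tmul_induction hV hW (fun i j v hv w hw => ?_) (by simp)
    (fun x y hx hy => by simp only [map_add, LinearMap.add_apply, hx, hy]) a
  refine homogeneous_tmul_induction hV hW (fun i' j' v' hv' w' hw' => ?_) (by simp)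
    (fun x y hx hy => by simp only [map_add, LinearMap.add_apply, hx, hy]) b
  refine homogeneous_tmul_induction hV hW (fun i'' j'' v'' hv'' w'' hw'' => ?_) (by simp)
    (fun x y hx hy => by simp only [map_add, hx, hy]) c
  rw [koszul_tmul hV hW m v hw hv' w', koszul_tmul hV hW m v' hw' hv'' w'', map_smul, map_smul,
    LinearMap.smul_apply,
    koszul_of_mem hV hW m (hm _ _ _ _ _ hv _ hw _ hv' _ hw') (tmul_mem_biGr hv'' hw''),
    koszul_of_mem hV hW m (tmul_mem_biGr hv hw) (hm _ _ _ _ _ hv' _ hw' _ hv'' _ hw''), hassoc,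
    smul_smul, smul_smul]
  congr 1
  ring

theorem koszul_mem (hV : DirectSum.IsInternal grV) (hW : DirectSum.IsInternal grW)
    {m : V ⊗[k] W →ₗ[k] V ⊗[k] W →ₗ[k] V ⊗[k] W} (hm : IsBigraded grV grW m) {n n' : ℕ}
    {t t' : V ⊗[k] W} (ht : t ∈ tensorGr grV grW n) (ht' : t' ∈ tensorGr grV grW n') :
    koszul grV grW m t t' ∈ tensorGr grV grW (n + n') := by
  refine tensorGr_induction (p := fun t => koszul grV grW m t t' ∈ tensorGr grV grW (n + n'))
    (fun i j hij v hv w hw => ?_) (by simp)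
    (fun x y hx hy => by simpa using Submodule.add_mem _ hx hy) ht
  refine tensorGr_induction (p := fun t' => koszul grV grW m (v ⊗ₜ w) t' ∈
    tensorGr grV grW (n + n')) (fun i' j' hij' v' hv' w' hw' => ?_) (by simp)
    (fun x y hx hy => by simpa using Submodule.add_mem _ hx hy) ht'
  rw [koszul_tmul hV hW m v hw hv' w']
  exact Submodule.smul_mem _ _ (biGr_le_tensorGr (by omega) (hm _ _ _ _ _ hv _ hw _ hv' _ hw'))

/-- An element of degree `0` in the second factor can be multiplied from the left without signs. -/
theorem koszul_left_of_zero (hV : DirectSum.IsInternal grV) (hW : DirectSum.IsInternal grW)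
    (m : V ⊗[k] W →ₗ[k] V ⊗[k] W →ₗ[k] V ⊗[k] W) (v : V) {w : W} (hw : w ∈ grW 0)
    (t : V ⊗[k] W) : koszul grV grW m (v ⊗ₜ w) t = m (v ⊗ₜ w) t := by
  refine homogeneous_tmul_induction hV hW (fun i j v' hv' w' _ => ?_) (by simp)
    (fun x y hx hy => by simp only [map_add, hx, hy]) t
  simpa using koszul_tmul hV hW m v hw hv' w'

/-- An element of degree `0` in the first factor can be multiplied from the right without signs. -/
theorem koszul_right_of_zero (hV : DirectSum.IsInternal grV) (hW : DirectSum.IsInternal grW)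
    (m : V ⊗[k] W →ₗ[k] V ⊗[k] W →ₗ[k] V ⊗[k] W) (t : V ⊗[k] W) {v : V} (hv : v ∈ grV 0)
    (w : W) : koszul grV grW m t (v ⊗ₜ w) = m t (v ⊗ₜ w) := by
  refine homogeneous_tmul_induction hV hW (fun i j v' _ w' hw' => ?_) (by simp)
    (fun x y hx hy => by simp only [map_add, LinearMap.add_apply, hx, hy]) t
  simpa using koszul_tmul hV hW m v' hw' hv w

/-- A linear map of degree `0` commutes with the sign operator. -/
theorem degSign_map (hV : DirectSum.IsInternal grV) (hW : DirectSum.IsInternal grW) (F : V →ₗ[k] W)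
    (hF : ∀ n, ∀ x ∈ grV n, F x ∈ grW n) (x : V) : F (degSign grV x) = degSign grW (F x) := by
  refine homogeneous_induction hV (fun n x hx => ?_) (by simp)
    (fun x y hx hy => by simp only [map_add, hx, hy]) x
  rw [degSign, degSign, degScale_apply hV _ hx, degScale_apply hW _ (hF n x hx), map_smul]

theorem tensorD_tmul (Ω : DGStruct k V) (Ω' : DGStruct k W) (hV : DirectSum.IsInternal Ω.gr)
    {i : ℕ} {v : V} (hv : v ∈ Ω.gr i) (w : W) :
    tensorD Ω Ω' (v ⊗ₜ w) = Ω.d v ⊗ₜ w + (-1 : k) ^ i • v ⊗ₜ Ω'.d w := by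
  simp [tensorD, degSign, degScale_apply hV _ hv, smul_tmul']

theorem tensorD_of_mem (Ω : DGStruct k V) (Ω' : DGStruct k W) (hV : DirectSum.IsInternal Ω.gr)
    {i j : ℕ} {t : V ⊗[k] W} (ht : t ∈ biGr Ω.gr Ω'.gr i j) :
    tensorD Ω Ω' t = Ω.d.rTensor W t + (-1 : k) ^ i • Ω'.d.lTensor V t := by
  refine biGr_induction (p := fun t => tensorD Ω Ω' t = Ω.d.rTensor W t +
    (-1 : k) ^ i • Ω'.d.lTensor V t) (fun v hv w _ => ?_) (by simp) (fun x y hx hy => ?_) ht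
  · simp [tensorD_tmul Ω Ω' hV hv]
  · simp only [map_add, hx, hy, smul_add]
    abel

theorem DGStruct.IsDGA.tensorD_mem {Ω : DGStruct k V} {Ω' : DGStruct k W} (h : Ω.IsDGA)
    (h' : Ω'.IsDGA) {n : ℕ} {t : V ⊗[k] W} (ht : t ∈ tensorGr Ω.gr Ω'.gr n) :
    tensorD Ω Ω' t ∈ tensorGr Ω.gr Ω'.gr (n + 1) := by
  refine tensorGr_induction (p := fun t => tensorD Ω Ω' t ∈ tensorGr Ω.gr Ω'.gr (n + 1))
    (fun i j hij v hv w hw => ?_) (by simp)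
    (fun x y hx hy => by simpa using Submodule.add_mem _ hx hy) ht
  rw [tensorD_tmul Ω Ω' h.isInternal hv]
  exact Submodule.add_mem _ (tmul_mem_tensorGr (by omega) (h.d_mem _ _ hv) hw)
    (Submodule.smul_mem _ _ (tmul_mem_tensorGr (by omega) hv (h'.d_mem _ _ hw)))

theorem DGStruct.IsDGA.tensorD_tensorD {Ω : DGStruct k V} {Ω' : DGStruct k W} (h : Ω.IsDGA)
    (h' : Ω'.IsDGA) (t : V ⊗[k] W) : tensorD Ω Ω' (tensorD Ω Ω' t) = 0 := by
  refine homogeneous_tmul_induction h.isInternal h'.isInternal (fun i j v hv w hw => ?_) (by simp)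
    (fun x y hx hy => by simp only [map_add, hx, hy, add_zero]) t
  rw [tensorD_tmul Ω Ω' h.isInternal hv, map_add, map_smul, tensorD_tmul Ω Ω' h.isInternal hv,
    tensorD_tmul Ω Ω' h.isInternal (h.d_mem _ _ hv), h.d_d, h'.d_d]
  simp [pow_succ]

theorem DGStruct.IsDGA.d_one {Ω : DGStruct k V} (h : Ω.IsDGA) : Ω.d Ω.one = 0 := by
  have e := h.leibniz 0 Ω.one h.one_mem Ω.one
  simpa [h.isAlgebra.one_mul, h.isAlgebra.mul_one] using e

/-- The Leibniz rule, with the sign operator. -/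
theorem DGStruct.IsDGA.d_mul {Ω : DGStruct k V} (h : Ω.IsDGA) (x y : V) :
    Ω.d (Ω.mul x y) = Ω.mul (Ω.d x) y + Ω.mul (degSign Ω.gr x) (Ω.d y) := by
  refine homogeneous_induction h.isInternal (fun n x hx => ?_) (by simp)
    (fun x y hx hy => ?_) x
  · rw [h.leibniz n x hx, degSign, degScale_apply h.isInternal _ hx, map_smul,
      LinearMap.smul_apply]
  · simp only [map_add, LinearMap.add_apply, hx, hy]
    abel

end Graded

/-! ### The Leibniz rule for the twisted product -/

section TwistedGraded

variable {k H X Y : Type*} [Field k] [Ring H] [Bialgebra k H]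
  [AddCommGroup X] [Module k X] [AddCommGroup Y] [Module k Y]
  {mulX : X →ₗ[k] X →ₗ[k] X} {act : H →ₗ[k] X →ₗ[k] X} {s : H ⊗[k] H →ₗ[k] X}
  {lam : Y →ₗ[k] H ⊗[k] Y} {mulY : Y →ₗ[k] Y →ₗ[k] Y}

theorem isBigraded_twistedMul {grX : ℕ → Submodule k X} {grY : ℕ → Submodule k Y}
    (hmulX : ∀ n m, ∀ x ∈ grX n, ∀ y ∈ grX m, mulX x y ∈ grX (n + m))
    (hact : ∀ h n, ∀ x ∈ grX n, act h x ∈ grX n) (hs : ∀ t, s t ∈ grX 0)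
    (hlam : ∀ n, ∀ y ∈ grY n, lam y ∈ LinearMap.range ((grY n).subtype.lTensor H))
    (hmulY : ∀ n m, ∀ x ∈ grY n, ∀ y ∈ grY m, mulY x y ∈ grY (n + m)) :
    IsBigraded grX grY (twistedMul mulX act s lam mulY) := by
  intro i j i' j' v hv w hw v' hv' w' hw'
  simp only [twistedMul, LinearMap.compl₁₂_apply, LinearMap.comp_apply, LinearMap.lTensor_tmul,
    LinearEquiv.coe_coe]
  obtain ⟨t, ht⟩ := hlam j w hw
  obtain ⟨t', ht'⟩ := hlam j' w' hw'
  rw [← ht, ← ht']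
  clear ht ht'
  induction t with
  | zero => simp
  | add x y hx hy =>
    simp only [map_add, tmul_add, LinearMap.add_apply]
    exact Submodule.add_mem _ hx hy
  | tmul h z =>
    induction t' with
    | zero => simp
    | add x y hx hy =>
      simp only [map_add, tmul_add]
      exact Submodule.add_mem _ hx hy
    | tmul g z' =>
      simp only [LinearMap.rTensor_tmul, LinearMap.lTensor_tmul, Submodule.subtype_apply]
      generalize Coalgebra.comul (R := k) h = u
      induction u with
      | zero => simp
      | add x y hx hy =>
        simp only [map_add, tmul_add, add_tmul, LinearMap.add_apply]
        exact Submodule.add_mem _ hx hy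
      | tmul h1 h2 =>
        simp only [assoc_symm_tmul, TensorProduct.map₂_apply_tmul, twistedCoeff,
          TensorProduct.lift.tmul, LinearMap.mk₂_apply]
        refine tmul_mem_biGr ?_ (hmulY _ _ _ z.2 _ z'.2)
        exact hmulX _ _ _ hv _ (hmulX i' 0 _ (hact _ _ _ hv') _ (hs _))

/-- A twisted derivation of `X` which commutes with the action and kills `s` is a twisted derivation
of the twisted product. -/
theorem rTensor_twistedMul {d sgn : X →ₗ[k] X}
    (hd : ∀ x y, d (mulX x y) = mulX (d x) y + mulX (sgn x) (d y))
    (hact : ∀ h x, d (act h x) = act h (d x)) (hs : ∀ t, d (s t) = 0) (x x' : X) (y y' : Y) :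
    d.rTensor Y (twistedMul mulX act s lam mulY (x ⊗ₜ y) (x' ⊗ₜ y')) =
      twistedMul mulX act s lam mulY (d x ⊗ₜ y) (x' ⊗ₜ y') +
      twistedMul mulX act s lam mulY (sgn x ⊗ₜ y) (d x' ⊗ₜ y') := by
  simp only [twistedMul, LinearMap.compl₁₂_apply, LinearMap.comp_apply, LinearMap.lTensor_tmul,
    LinearEquiv.coe_coe]
  generalize Coalgebra.comul.rTensor Y (lam y) = t
  generalize lam y' = t'
  induction t with
  | zero => simp
  | add x y hx hy =>
    simp only [map_add, tmul_add, LinearMap.add_apply, hx, hy]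
    abel
  | tmul u z =>
    induction t' with
    | zero => simp
    | add x y hx hy =>
      simp only [map_add, tmul_add, hx, hy]
      abel
    | tmul g z' =>
      induction u with
      | zero => simp
      | add x y hx hy =>
        simp only [map_add, tmul_add, add_tmul, LinearMap.add_apply, hx, hy]
        abel
      | tmul h1 h2 => simp [twistedCoeff, hd, hact, hs, add_tmul]

/-- A twisted derivation of `Y` which commutes with the coaction is a twisted derivation of the
twisted product. -/
theorem lTensor_twistedMul {d sgn : Y →ₗ[k] Y}
    (hd : ∀ x y, d (mulY x y) = mulY (d x) y + mulY (sgn x) (d y))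
    (hlam : ∀ y, lam (d y) = d.lTensor H (lam y))
    (hlam' : ∀ y, lam (sgn y) = sgn.lTensor H (lam y)) (x x' : X) (y y' : Y) :
    d.lTensor X (twistedMul mulX act s lam mulY (x ⊗ₜ y) (x' ⊗ₜ y')) =
      twistedMul mulX act s lam mulY (x ⊗ₜ d y) (x' ⊗ₜ y') +
      twistedMul mulX act s lam mulY (x ⊗ₜ sgn y) (x' ⊗ₜ d y') := by
  simp only [twistedMul, LinearMap.compl₁₂_apply, LinearMap.comp_apply, LinearMap.lTensor_tmul,
    LinearEquiv.coe_coe, hlam, hlam']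
  generalize lam y = t
  generalize lam y' = t'
  induction t with
  | zero => simp
  | add x y hx hy =>
    simp only [map_add, tmul_add, LinearMap.add_apply, hx, hy]
    abel
  | tmul h z =>
    induction t' with
    | zero => simp
    | add x y hx hy =>
      simp only [map_add, tmul_add, hx, hy]
      abel
    | tmul g z' =>
      simp only [LinearMap.rTensor_tmul, LinearMap.lTensor_tmul]
      generalize Coalgebra.comul (R := k) h = u
      induction u with
      | zero => simp
      | add x y hx hy =>
        simp only [map_add, tmul_add, add_tmul, LinearMap.add_apply, hx, hy]
        abel
      | tmul h1 h2 => simp [twistedCoeff, hd, tmul_add]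

/-- The graded Leibniz rule for the differential of a tensor product, with respect to a bigraded
operation `m` with Koszul signs. -/
theorem tensorD_koszul {ΩX : DGStruct k X} {ΩY : DGStruct k Y} (hX : ΩX.IsDGA) (hY : ΩY.IsDGA)
    {m : X ⊗[k] Y →ₗ[k] X ⊗[k] Y →ₗ[k] X ⊗[k] Y} (hm : IsBigraded ΩX.gr ΩY.gr m)
    (hdX : ∀ x x' y y', ΩX.d.rTensor Y (m (x ⊗ₜ y) (x' ⊗ₜ y')) =
      m (ΩX.d x ⊗ₜ y) (x' ⊗ₜ y') + m (degSign ΩX.gr x ⊗ₜ y) (ΩX.d x' ⊗ₜ y'))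
    (hdY : ∀ x x' y y', ΩY.d.lTensor X (m (x ⊗ₜ y) (x' ⊗ₜ y')) =
      m (x ⊗ₜ ΩY.d y) (x' ⊗ₜ y') + m (x ⊗ₜ degSign ΩY.gr y) (x' ⊗ₜ ΩY.d y'))
    {n : ℕ} {a : X ⊗[k] Y} (ha : a ∈ tensorGr ΩX.gr ΩY.gr n) (b : X ⊗[k] Y) :
    tensorD ΩX ΩY (koszul ΩX.gr ΩY.gr m a b) = koszul ΩX.gr ΩY.gr m (tensorD ΩX ΩY a) b +
      (-1 : k) ^ n • koszul ΩX.gr ΩY.gr m a (tensorD ΩX ΩY b) := by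
  have hV := hX.isInternal
  have hW := hY.isInternal
  refine tensorGr_induction (p := fun a => tensorD ΩX ΩY (koszul ΩX.gr ΩY.gr m a b) =
    koszul ΩX.gr ΩY.gr m (tensorD ΩX ΩY a) b +
      (-1 : k) ^ n • koszul ΩX.gr ΩY.gr m a (tensorD ΩX ΩY b))
    (fun i j hij v hv w hw => ?_) (by simp) (fun x y hx hy => ?_) ha
  swap
  · simp only [map_add, LinearMap.add_apply, hx, hy, smul_add]
    abel
  refine homogeneous_tmul_induction hV hW (fun i' j' v' hv' w' hw' => ?_) (by simp)
    (fun x y hx hy => ?_) b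
  swap
  · simp only [map_add, hx, hy, smul_add]
    abel
  subst hij
  have hv1 := hX.d_mem _ _ hv
  have hw1 := hY.d_mem _ _ hw
  have hv1' := hX.d_mem _ _ hv'
  have hsv : degSign ΩX.gr v = (-1 : k) ^ i • v := degScale_apply hV _ hv
  have hsw : degSign ΩY.gr w = (-1 : k) ^ j • w := degScale_apply hW _ hw
  rw [koszul_tmul hV hW m v hw hv' w', map_smul,
    tensorD_of_mem ΩX ΩY hV (hm _ _ _ _ _ hv _ hw _ hv' _ hw'), hdX, hdY,
    tensorD_tmul ΩX ΩY hV hv, tensorD_tmul ΩX ΩY hV hv', hsv, hsw]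
  simp only [map_add, map_smul, LinearMap.add_apply, LinearMap.smul_apply,
    koszul_tmul hV hW m _ hw hv' _, koszul_tmul hV hW m _ hw1 hv' _,
    koszul_tmul hV hW m _ hw hv1' _, ← smul_tmul']
  rcases Nat.even_or_odd i with hi | hi <;> rcases Nat.even_or_odd j with hj | hj <;>
    rcases Nat.even_or_odd i' with hi' | hi' <;>
    simp [pow_add, pow_mul, hi.neg_one_pow, hj.neg_one_pow, hi'.neg_one_pow, mul_add, add_mul,
      tmul_neg] <;>
    abel

end TwistedGraded

/-! ### Forms as words in functions and exact one-forms -/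

section Words

variable {k A V : Type*} [Field k] [AddCommGroup A] [Module k A] [AddCommGroup V] [Module k V]
  {Ω : CalcStruct k A V} {S : AlgStruct k A}

/-- The span of the forms `a₀ da₁ ∧ ⋯ ∧ daₙ`. -/
def CalcStruct.wordSpan (Ω : CalcStruct k A V) (n : ℕ) : Submodule k V :=
  Submodule.span k {x | ∃ (a : A) (l : List A), l.length = n ∧ x = Ω.mul (Ω.incl a) (Ω.dWord l)}

theorem CalcStruct.word_mem_wordSpan (Ω : CalcStruct k A V) (a : A) (l : List A) :
    Ω.mul (Ω.incl a) (Ω.dWord l) ∈ Ω.wordSpan l.length :=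
  Submodule.subset_span ⟨a, l, rfl, rfl⟩

theorem CalcStruct.incl_mem_wordSpan (hΩ : Ω.IsDGA) (a : A) :
    Ω.incl a ∈ Ω.wordSpan 0 := by
  simpa [CalcStruct.dWord, hΩ.isAlgebra.mul_one] using Ω.word_mem_wordSpan a []

theorem CalcStruct.IsCalculus.gr_eq (h : Ω.IsCalculus S) (n : ℕ) : Ω.gr n = Ω.wordSpan n := by
  rcases Nat.eq_zero_or_pos n with rfl | hn
  · rw [← h.range_incl]
    refine le_antisymm ?_ (Submodule.span_le.mpr ?_)
    · rintro _ ⟨a, rfl⟩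
      exact Ω.incl_mem_wordSpan h.isDGA a
    · rintro _ ⟨a, l, hl, rfl⟩
      obtain rfl := List.length_eq_zero_iff.mp hl
      exact ⟨a, by simp [CalcStruct.dWord, h.isDGA.isAlgebra.mul_one]⟩
  · exact h.span_eq n hn

@[elab_as_elim]
theorem CalcStruct.IsCalculus.word_induction (h : Ω.IsCalculus S) {p : V → Prop}
    (word : ∀ a l, p (Ω.mul (Ω.incl a) (Ω.dWord l))) (zero : p 0)
    (add : ∀ x y, p x → p y → p (x + y)) (smul : ∀ (c : k) x, p x → p (c • x)) (x : V) : p x := by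
  refine homogeneous_induction h.isDGA.isInternal (fun n x hx => ?_) zero add x
  rw [h.gr_eq] at hx
  refine Submodule.span_induction (p := fun x _ => p x) ?_ zero (fun x y _ _ => add x y)
    (fun c x _ => smul c x) hx
  rintro _ ⟨a, l, -, rfl⟩
  exact word a l

theorem CalcStruct.IsCalculus.incl_mem (h : Ω.IsCalculus S) (a : A) : Ω.incl a ∈ Ω.gr 0 := by
  rw [← h.range_incl]
  exact ⟨a, rfl⟩

/-- Multiplicative maps on a calculus which commute with a differential are determined by their
values in degree zero. -/
theorem CalcStruct.IsCalculus.hom_ext (h : Ω.IsCalculus S) {W : Type*} [AddCommGroup W] [Module k W]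
    {F G : V →ₗ[k] W} (mulW : W →ₗ[k] W →ₗ[k] W) (D : W →ₗ[k] W)
    (hF : ∀ x y, F (Ω.mul x y) = mulW (F x) (F y)) (hG : ∀ x y, G (Ω.mul x y) = mulW (G x) (G y))
    (hFd : ∀ x, F (Ω.d x) = D (F x)) (hGd : ∀ x, G (Ω.d x) = D (G x))
    (hFG : ∀ a, F (Ω.incl a) = G (Ω.incl a)) : F = G := by
  have hw : ∀ l, F (Ω.dWord l) = G (Ω.dWord l) := by
    intro l
    induction l with
    | nil => rw [CalcStruct.dWord, ← h.incl_one, hFG]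
    | cons a l ih => rw [CalcStruct.dWord, hF, hG, hFd, hGd, hFG, ih]
  ext x
  refine h.word_induction (fun a l => ?_) (by simp) (fun x y hx hy => by
    simp only [map_add, hx, hy]) (fun c x hx => by simp only [map_smul, hx]) x
  rw [hF, hG, hFG, hw]

theorem DGStruct.IsDGA.d_mul_of_zero {Ω : DGStruct k V} (h : Ω.IsDGA) {x : V} (hx : x ∈ Ω.gr 0)
    (y : V) : Ω.d (Ω.mul x y) = Ω.mul (Ω.d x) y + Ω.mul x (Ω.d y) := by
  simpa using h.leibniz 0 x hx y

end Words

/-! ### Convolution products with values in forms -/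

section ModuleCalculus

variable {k H B A : Type*} [Field k] [Ring H] [Bialgebra k H] [Ring B] [Algebra k B]
  [Ring A] [Algebra k A] {act : H →ₗ[k] B →ₗ[k] B} {σ σinv : H ⊗[k] H →ₗ[k] B}
  {Ω : CalcStruct k B A} {actΩ : H →ₗ[k] A →ₗ[k] A}

/-- The inclusion `incl` of `B` as the forms of degree zero, as a homomorphism of algebras. -/
def inclHom (hΩ : Ω.IsCalculus (AlgStruct.of k B)) (hmul : Ω.mul = LinearMap.mul k A)
    (hone : Ω.one = 1) : B →ₐ[k] A :=
  AlgHom.ofLinearMap Ω.incl (hΩ.incl_one.trans hone) fun x y => by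
    simpa [hmul, AlgStruct.of] using hΩ.incl_mul x y

/-- The algebra of forms is generated by the elements `b` and `db`. -/
theorem mem_subalgebra_of_incl_of_d (hΩ : Ω.IsCalculus (AlgStruct.of k B))
    (hmul : Ω.mul = LinearMap.mul k A) (hone : Ω.one = 1)
    (T : Subalgebra k A) (h0 : ∀ b, Ω.incl b ∈ T) (h1 : ∀ b, Ω.d (Ω.incl b) ∈ T)
    (x : A) : x ∈ T := by
  have hw : ∀ l, Ω.dWord l ∈ T := by
    intro l
    induction l with
    | nil => rw [CalcStruct.dWord, hone]; exact T.one_mem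
    | cons a l ih =>
      rw [CalcStruct.dWord, hmul]
      exact T.mul_mem (h1 a) ih
  refine hΩ.word_induction (fun a l => ?_) T.zero_mem (fun x y => T.add_mem)
    (fun c x hx => T.smul_mem hx c) x
  rw [hmul]
  exact T.mul_mem (h0 a) (hw l)

theorem incl_comp_convMul (hΩ : Ω.IsCalculus (AlgStruct.of k B)) (hmul : Ω.mul = LinearMap.mul k A)
    (hone : Ω.one = 1) {C : Type*} [AddCommGroup C] [Module k C] [Coalgebra k C]
    (f g : WithConv (C →ₗ[k] B)) : toConv (Ω.incl ∘ₗ (f * g).ofConv) =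
      toConv (Ω.incl ∘ₗ f.ofConv) * toConv (Ω.incl ∘ₗ g.ofConv) :=
  congrArg toConv (LinearMap.algHom_comp_convMul_distrib (inclHom hΩ hmul hone) f g)

theorem incl_comp_convOne (hΩ : Ω.IsCalculus (AlgStruct.of k B)) (hmul : Ω.mul = LinearMap.mul k A)
    (hone : Ω.one = 1) {C : Type*} [AddCommGroup C] [Module k C] [Coalgebra k C] :
    toConv (Ω.incl ∘ₗ (1 : WithConv (C →ₗ[k] B)).ofConv) = 1 := by
  refine congrArg toConv (LinearMap.ext fun c => ?_)
  exact (inclHom hΩ hmul hone).commutes _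

/-- The Leibniz rule for a convolution product whose first factor has values in degree zero. -/
theorem d_comp_convMul (hΩ : Ω.IsCalculus (AlgStruct.of k B)) (hmul : Ω.mul = LinearMap.mul k A)
    {C : Type*} [AddCommGroup C] [Module k C] [Coalgebra k C]
    (f : C →ₗ[k] B) (g : WithConv (C →ₗ[k] A)) :
    toConv (Ω.d ∘ₗ (toConv (Ω.incl ∘ₗ f) * g).ofConv) =
      toConv (Ω.d ∘ₗ Ω.incl ∘ₗ f) * g + toConv (Ω.incl ∘ₗ f) * toConv (Ω.d ∘ₗ g.ofConv) := by
  refine congrArg toConv (LinearMap.ext fun c => ?_)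
  change Ω.d (LinearMap.mul' k A (TensorProduct.map (Ω.incl ∘ₗ f) g.ofConv
      (Coalgebra.comul (R := k) c))) =
    LinearMap.mul' k A (TensorProduct.map (Ω.d ∘ₗ Ω.incl ∘ₗ f) g.ofConv
      (Coalgebra.comul (R := k) c)) +
    LinearMap.mul' k A (TensorProduct.map (Ω.incl ∘ₗ f) (Ω.d ∘ₗ g.ofConv)
      (Coalgebra.comul (R := k) c))
  generalize Coalgebra.comul (R := k) c = u
  induction u with
  | zero => simp
  | add x y hx hy =>
    simp only [map_add, hx, hy]
    abel
  | tmul a b =>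
    have e := hΩ.isDGA.d_mul_of_zero (hΩ.incl_mem (f a)) (g.ofConv b)
    simpa [hmul] using e

theorem toConv_actWord_cons (hmul : Ω.mul = LinearMap.mul k A) (b : B) (l : List B) :
    toConv (actWord Ω actΩ (b :: l)) =
      toConv (actΩ.flip (Ω.d (Ω.incl b))) * toConv (actWord Ω actΩ l) := by
  rw [actWord, hmul]
  rfl

theorem toConv_actWord_nil (hone : Ω.one = 1) : toConv (actWord Ω actΩ []) = 1 := by
  rw [actWord, hone]
  refine congrArg toConv (LinearMap.ext fun h => ?_)
  simp [Algebra.algebraMap_eq_smul_one]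

theorem flip_one (hB : IsTwistedModuleAlgebra act σ σinv)
    (hΩ : Ω.IsCalculus (AlgStruct.of k B)) (hact : IsTwistedModuleCalculus act σ Ω actΩ)
    (hone : Ω.one = 1) : toConv (actΩ.flip 1) = 1 := by
  refine congrArg toConv (LinearMap.ext fun h => ?_)
  have e := hact.map_incl h 1
  have e1 : Ω.incl 1 = 1 := hΩ.incl_one.trans hone
  rw [hB.act_one, map_smul, e1] at e
  simpa [Algebra.algebraMap_eq_smul_one] using e

/-- The map `h ↦ h · b`, for `b` in degree zero. -/
theorem flip_incl (hact : IsTwistedModuleCalculus act σ Ω actΩ) (b : B) :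
    actΩ.flip (Ω.incl b) = Ω.incl ∘ₗ act.flip b :=
  LinearMap.ext fun h => hact.map_incl h b

/-- The map `h ↦ h · db`. -/
theorem flip_d_incl (hact : IsTwistedModuleCalculus act σ Ω actΩ) (b : B) :
    actΩ.flip (Ω.d (Ω.incl b)) = Ω.d ∘ₗ Ω.incl ∘ₗ act.flip b :=
  LinearMap.ext fun h => hact.map_d h b

end ModuleCalculus

/-! ### The algebra of forms as a twisted module algebra -/

section TwistedForms

variable {k H B A : Type*} [Field k] [Ring H] [Bialgebra k H] [Ring B] [Algebra k B]
  [Ring A] [Algebra k A] {act : H →ₗ[k] B →ₗ[k] B} {σ σinv : H ⊗[k] H →ₗ[k] B}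
  {Ω : CalcStruct k B A} {actΩ : H →ₗ[k] A →ₗ[k] A}

/-- The defining formula for the action on words also holds for the empty word. -/
theorem flip_word (hact : IsTwistedModuleCalculus act σ Ω actΩ)
    (hmul : Ω.mul = LinearMap.mul k A) (hone : Ω.one = 1) (b : B) (l : List B) :
    toConv (actΩ.flip (Ω.incl b * Ω.dWord l)) =
      toConv (actΩ.flip (Ω.incl b)) * toConv (actWord Ω actΩ l) := by
  rcases eq_or_ne l [] with rfl | hl
  · rw [toConv_actWord_nil hone, mul_one, CalcStruct.dWord, hone, mul_one]
  · refine congrArg toConv (LinearMap.ext fun h => ?_)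
    have e := hact.map_word h b l hl
    rw [hmul] at e
    exact e

theorem flip_incl_mul (hB : IsTwistedModuleAlgebra act σ σinv)
    (hΩ : Ω.IsCalculus (AlgStruct.of k B)) (hact : IsTwistedModuleCalculus act σ Ω actΩ)
    (hmul : Ω.mul = LinearMap.mul k A) (hone : Ω.one = 1) (b c : B) :
    toConv (actΩ.flip (Ω.incl (b * c))) =
      toConv (actΩ.flip (Ω.incl b)) * toConv (actΩ.flip (Ω.incl c)) := by
  simp only [flip_incl hact]
  have e := congrArg (fun f => toConv (Ω.incl ∘ₗ f.ofConv)) (hB.act_mul b c)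
  exact e.trans (incl_comp_convMul hΩ hmul hone _ _)

theorem flip_d_incl_mul (hB : IsTwistedModuleAlgebra act σ σinv)
    (hΩ : Ω.IsCalculus (AlgStruct.of k B)) (hact : IsTwistedModuleCalculus act σ Ω actΩ)
    (hmul : Ω.mul = LinearMap.mul k A) (hone : Ω.one = 1) (b c : B) :
    toConv (actΩ.flip (Ω.d (Ω.incl (b * c)))) =
      toConv (actΩ.flip (Ω.d (Ω.incl b))) * toConv (actΩ.flip (Ω.incl c)) +
      toConv (actΩ.flip (Ω.incl b)) * toConv (actΩ.flip (Ω.d (Ω.incl c))) := by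
  have e := congrArg (fun f => toConv (Ω.d ∘ₗ f.ofConv))
    (flip_incl_mul hB hΩ hact hmul hone b c)
  simp only [flip_incl hact, d_comp_convMul hΩ hmul] at e
  simp only [flip_d_incl hact, flip_incl hact]
  exact e

/-- `H` measures the algebra of forms: `h · (x ∧ y) = (h₁ · x) ∧ (h₂ · y)`. -/
theorem flip_mul (hB : IsTwistedModuleAlgebra act σ σinv)
    (hΩ : Ω.IsCalculus (AlgStruct.of k B)) (hact : IsTwistedModuleCalculus act σ Ω actΩ)
    (hmul : Ω.mul = LinearMap.mul k A) (hone : Ω.one = 1) (x y : A) :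
    toConv (actΩ.flip (x * y)) = toConv (actΩ.flip x) * toConv (actΩ.flip y) := by
  have h1 := flip_one hB hΩ hact hone
  let T : Subalgebra k A :=
    { carrier := {x | ∀ y, toConv (actΩ.flip (x * y)) = toConv (actΩ.flip x) * toConv (actΩ.flip y)}
      mul_mem' := fun {a b} ha hb y => by rw [ha, mul_assoc, ha, hb, mul_assoc]
      add_mem' := fun {a b} ha hb y => by
        rw [add_mul, map_add, map_add, toConv_add, toConv_add, ha, hb, add_mul]
      algebraMap_mem' := fun r y => by
        rw [Algebra.algebraMap_eq_smul_one, smul_mul_assoc, map_smul, map_smul, toConv_smul,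
          toConv_smul, smul_mul_assoc, h1, one_mul, one_mul] }
  have hd : ∀ u v, Ω.d (u * v) = Ω.d u * v + degSign Ω.gr u * Ω.d v := by
    intro u v
    simpa [hmul] using hΩ.isDGA.d_mul u v
  have hincl : ∀ u v, Ω.incl (u * v) = Ω.incl u * Ω.incl v := (inclHom hΩ hmul hone).map_mul
  refine mem_subalgebra_of_incl_of_d hΩ hmul hone T (fun b y => ?_) (fun b y => ?_) x y
  · refine hΩ.word_induction (fun c l => ?_) (by simp) (fun x y hx hy => ?_) (fun c x hx => ?_) y
    · rw [hmul, LinearMap.mul_apply', ← mul_assoc, ← hincl, flip_word hact hmul hone,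
        flip_word hact hmul hone, flip_incl_mul hB hΩ hact hmul hone, mul_assoc]
    · rw [mul_add, map_add, map_add, toConv_add, toConv_add, hx, hy, mul_add]
    · rw [mul_smul_comm, map_smul, map_smul, toConv_smul, toConv_smul, hx, mul_smul_comm]
  · refine hΩ.word_induction (fun c l => ?_) (by simp) (fun x y hx hy => ?_) (fun c x hx => ?_) y
    · -- Move `c` to the left by the Leibniz rule: `db (c w) = d(bc) w - b dc w`.
      have e : Ω.d (Ω.incl b) * (Ω.incl c * Ω.dWord l) = Ω.incl 1 * Ω.dWord ((b * c) :: l) -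
          Ω.incl b * Ω.dWord (c :: l) := by
        have e1 := hΩ.isDGA.d_mul_of_zero (hΩ.incl_mem b) (Ω.incl c)
        have e2 : Ω.incl 1 = 1 := hΩ.incl_one.trans hone
        simp only [hmul, LinearMap.mul_apply'] at e1
        rw [CalcStruct.dWord, CalcStruct.dWord, hmul, e2, one_mul, hincl]
        simp only [LinearMap.mul_apply', e1]
        noncomm_ring
      have e2 : toConv (actΩ.flip (Ω.incl 1)) = 1 := by
        rw [← h1]
        exact congrArg (fun z => toConv (actΩ.flip z)) (hΩ.incl_one.trans hone)
      rw [hmul, LinearMap.mul_apply', e, map_sub, toConv_sub, flip_word hact hmul hone,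
        flip_word hact hmul hone, flip_word hact hmul hone, toConv_actWord_cons hmul,
        toConv_actWord_cons hmul, flip_d_incl_mul hB hΩ hact hmul hone, e2, one_mul]
      noncomm_ring
    · rw [mul_add, map_add, map_add, toConv_add, toConv_add, hx, hy, mul_add]
    · rw [mul_smul_comm, map_smul, map_smul, toConv_smul, toConv_smul, hx, mul_smul_comm]

/-- The action commutes with the differential on forms of all degrees. -/
theorem d_act (hB : IsTwistedModuleAlgebra act σ σinv)
    (hΩ : Ω.IsCalculus (AlgStruct.of k B)) (hact : IsTwistedModuleCalculus act σ Ω actΩ)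
    (hmul : Ω.mul = LinearMap.mul k A) (hone : Ω.one = 1) (h : H) (x : A) :
    Ω.d (actΩ h x) = actΩ h (Ω.d x) := by
  have hd : ∀ u v, Ω.d (u * v) = Ω.d u * v + degSign Ω.gr u * Ω.d v := by
    intro u v
    simpa [hmul] using hΩ.isDGA.d_mul u v
  have hm : ∀ h x y, actΩ h (x * y) = LinearMap.mul' k A
      (TensorProduct.map (actΩ.flip x) (actΩ.flip y) (Coalgebra.comul (R := k) h)) := fun h x y =>
    congrArg (fun f => f.ofConv h) (flip_mul hB hΩ hact hmul hone x y)
  have h0 : ∀ h b, Ω.d (actΩ h (Ω.incl b)) = actΩ h (Ω.d (Ω.incl b)) := fun h b => by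
    rw [hact.map_incl, hact.map_d]
  let T : Subalgebra k A :=
    { carrier := {x | ∀ h, Ω.d (actΩ h x) = actΩ h (Ω.d x)}
      mul_mem' := fun {a b} ha hb h => by
        rw [hm, hd, map_add, hm, hm]
        generalize Coalgebra.comul (R := k) h = u
        induction u with
        | zero => simp
        | add x y hx hy => simp only [map_add, hx, hy]; abel
        | tmul h1 h2 =>
          have e := degSign_map hΩ.isDGA.isInternal hΩ.isDGA.isInternal (actΩ h1)
            (hact.map_mem h1) a
          simp [hd, ha h1, hb h2, e]
      add_mem' := fun {a b} ha hb h => by simp only [map_add, ha h, hb h]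
      algebraMap_mem' := fun r h => by
        have e := h0 h (algebraMap k B r)
        rwa [show Ω.incl (algebraMap k B r) = algebraMap k A r from
          (inclHom hΩ hmul hone).commutes r] at e }
  exact mem_subalgebra_of_incl_of_d hΩ hmul hone T (fun b h => h0 h b)
    (fun b h => by rw [hact.map_d, hΩ.isDGA.d_d, hΩ.isDGA.d_d, map_zero]) x h

/-- Since `σ` is closed and `d(1) = 0`, the Leibniz rule for `σ * σ⁻¹` shows that `σ⁻¹` is
closed. -/
theorem d_comp_σinv (hB : IsTwistedModuleAlgebra act σ σinv)
    (hΩ : Ω.IsCalculus (AlgStruct.of k B)) (hact : IsTwistedModuleCalculus act σ Ω actΩ)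
    (hmul : Ω.mul = LinearMap.mul k A) (hone : Ω.one = 1) : Ω.d ∘ₗ Ω.incl ∘ₗ σinv = 0 := by
  have hσ : Ω.d ∘ₗ Ω.incl ∘ₗ σ = 0 := LinearMap.ext hact.d_σ
  have e1 : toConv (Ω.incl ∘ₗ σ) * toConv (Ω.incl ∘ₗ σinv) = 1 := by
    rw [← incl_comp_convOne hΩ hmul hone, ← hB.mul_inv]
    exact (incl_comp_convMul hΩ hmul hone _ _).symm
  have e2 : toConv (Ω.incl ∘ₗ σinv) * toConv (Ω.incl ∘ₗ σ) = 1 := by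
    rw [← incl_comp_convOne hΩ hmul hone, ← hB.inv_mul]
    exact (incl_comp_convMul hΩ hmul hone _ _).symm
  have e3 := d_comp_convMul hΩ hmul σ (toConv (Ω.incl ∘ₗ σinv))
  have e4 : Ω.d ∘ₗ (1 : WithConv (H ⊗[k] H →ₗ[k] A)).ofConv = 0 := by
    ext a b
    have e5 : Ω.d 1 = 0 := hone ▸ hΩ.isDGA.d_one
    simp [LinearMap.convOne_def, Algebra.algebraMap_eq_smul_one, e5]
  rw [e1, hσ, e4, toConv_zero, zero_mul, zero_add] at e3
  have e6 := congrArg (toConv (Ω.incl ∘ₗ σinv) * ·) e3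
  simp only [mul_zero, ← mul_assoc, e2, one_mul] at e6
  exact congrArg WithConv.ofConv e6.symm

/-- The algebra of forms of a twisted module calculus is a twisted module algebra. -/
theorem isTwistedModuleAlgebra_forms (hB : IsTwistedModuleAlgebra act σ σinv)
    (hΩ : Ω.IsCalculus (AlgStruct.of k B)) (hact : IsTwistedModuleCalculus act σ Ω actΩ)
    (hmul : Ω.mul = LinearMap.mul k A) (hone : Ω.one = 1) :
    IsTwistedModuleAlgebra actΩ (Ω.incl ∘ₗ σ) (Ω.incl ∘ₗ σinv) where
  act_one h := by
    have e := congrArg (fun f => f.ofConv h) (flip_one hB hΩ hact hone)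
    simpa [LinearMap.convOne_def, Algebra.algebraMap_eq_smul_one] using e
  act_mul := flip_mul hB hΩ hact hmul hone
  mul_inv := by
    rw [← incl_comp_convOne hΩ hmul hone, ← hB.mul_inv]
    exact (incl_comp_convMul hΩ hmul hone _ _).symm
  inv_mul := by
    rw [← incl_comp_convOne hΩ hmul hone, ← hB.inv_mul]
    exact (incl_comp_convMul hΩ hmul hone _ _).symm
  one_act := by
    let T : Subalgebra k A :=
      { carrier := {x | actΩ 1 x = x}
        mul_mem' := fun {a b} ha hb => by
          have e : actΩ 1 (a * b) = LinearMap.mul' k A (TensorProduct.map (actΩ.flip a)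
              (actΩ.flip b) (Coalgebra.comul (R := k) (1 : H))) :=
            congrArg (fun f => f.ofConv 1) (flip_mul hB hΩ hact hmul hone a b)
          simp only [Set.mem_ofPred_eq] at ha hb ⊢
          simp [e, Algebra.TensorProduct.one_def, ha, hb]
        add_mem' := fun {a b} ha hb => by
          simp only [Set.mem_ofPred_eq] at ha hb ⊢
          rw [map_add, ha, hb]
        algebraMap_mem' := fun r => by
          have e := hact.map_incl 1 (algebraMap k B r)
          rwa [hB.one_act, show Ω.incl (algebraMap k B r) = algebraMap k A r from
            (inclHom hΩ hmul hone).commutes r] at e }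
    exact mem_subalgebra_of_incl_of_d hΩ hmul hone T
      (fun b => (hact.map_incl 1 b).trans (by rw [hB.one_act]))
      (fun b => (hact.map_d 1 b).trans (by rw [hB.one_act]))
  act_act := by
    have hlift : ∀ x y, toConv (TensorProduct.lift (actΩ.compl₂ (actΩ.flip (x * y)))) =
        toConv (TensorProduct.lift (actΩ.compl₂ (actΩ.flip x))) *
          toConv (TensorProduct.lift (actΩ.compl₂ (actΩ.flip y))) := by
      intro x y
      rw [show actΩ.flip (x * y) = (toConv (actΩ.flip x) * toConv (actΩ.flip y)).ofConv from
        congrArg WithConv.ofConv (flip_mul hB hΩ hact hmul hone x y),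
        lift_compl₂_convMul (flip_mul hB hΩ hact hmul hone)]
    have hcomp : ∀ x y, toConv (actΩ.flip (x * y) ∘ₗ LinearMap.mul' k H) =
        toConv (actΩ.flip x ∘ₗ LinearMap.mul' k H) *
          toConv (actΩ.flip y ∘ₗ LinearMap.mul' k H) := by
      intro x y
      rw [show actΩ.flip (x * y) = (toConv (actΩ.flip x) * toConv (actΩ.flip y)).ofConv from
        congrArg WithConv.ofConv (flip_mul hB hΩ hact hmul hone x y)]
      exact convMul_comp (Bialgebra.mulCoalgHom k H) _ _
    have hinv : toConv (Ω.incl ∘ₗ σinv) * toConv (Ω.incl ∘ₗ σ) = 1 := by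
      rw [← incl_comp_convOne hΩ hmul hone, ← hB.inv_mul]
      exact (incl_comp_convMul hΩ hmul hone _ _).symm
    have h0 : ∀ b, toConv (TensorProduct.lift (actΩ.compl₂ (actΩ.flip (Ω.incl b)))) =
        toConv (Ω.incl ∘ₗ σ) * toConv (actΩ.flip (Ω.incl b) ∘ₗ LinearMap.mul' k H) *
          toConv (Ω.incl ∘ₗ σinv) := by
      intro b
      have e := congrArg (fun f => toConv (Ω.incl ∘ₗ f.ofConv)) (hB.act_act b)
      simp only [incl_comp_convMul hΩ hmul hone] at e
      rw [flip_incl hact]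
      refine Eq.trans (congrArg toConv (TensorProduct.ext' fun h h' => ?_)) e
      simp [hact.map_incl]
    have h1 : ∀ b, toConv (TensorProduct.lift (actΩ.compl₂ (actΩ.flip (Ω.d (Ω.incl b))))) =
        toConv (Ω.incl ∘ₗ σ) * toConv (actΩ.flip (Ω.d (Ω.incl b)) ∘ₗ LinearMap.mul' k H) *
          toConv (Ω.incl ∘ₗ σinv) := by
      intro b
      have e := congrArg (fun f => toConv (Ω.d ∘ₗ f.ofConv)) (h0 b)
      have hσ : Ω.d ∘ₗ Ω.incl ∘ₗ σ = 0 := LinearMap.ext hact.d_σ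
      simp only [mul_assoc, flip_incl hact, d_comp_convMul hΩ hmul, LinearMap.comp_assoc, hσ,
        d_comp_σinv hB hΩ hact hmul hone, toConv_zero, zero_mul, zero_add, mul_zero,
        add_zero] at e
      rw [mul_assoc, flip_d_incl hact]
      refine Eq.trans (congrArg toConv (TensorProduct.ext' fun h h' => ?_)) e
      simp [hact.map_incl, hact.map_d]
    let T : Subalgebra k A :=
      { carrier := {x | toConv (TensorProduct.lift (actΩ.compl₂ (actΩ.flip x))) =
          toConv (Ω.incl ∘ₗ σ) * toConv (actΩ.flip x ∘ₗ LinearMap.mul' k H) *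
            toConv (Ω.incl ∘ₗ σinv)}
        mul_mem' := fun {a b} ha hb => by
          simp only [Set.mem_ofPred_eq] at ha hb ⊢
          rw [hlift, ha, hb, hcomp]
          simp only [mul_assoc]
          rw [← mul_assoc (toConv (Ω.incl ∘ₗ σinv)), hinv, one_mul]
        add_mem' := fun {a b} ha hb => by
          simp only [Set.mem_ofPred_eq] at ha hb ⊢
          have e : TensorProduct.lift (actΩ.compl₂ (actΩ.flip (a + b))) =
              TensorProduct.lift (actΩ.compl₂ (actΩ.flip a)) +
                TensorProduct.lift (actΩ.compl₂ (actΩ.flip b)) :=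
            TensorProduct.ext' fun h h' => by simp
          rw [e, toConv_add, ha, hb, map_add, LinearMap.add_comp, toConv_add, mul_add, add_mul]
        algebraMap_mem' := fun r => by
          have e := h0 (algebraMap k B r)
          rwa [show Ω.incl (algebraMap k B r) = algebraMap k A r from
            (inclHom hΩ hmul hone).commutes r] at e }
    exact mem_subalgebra_of_incl_of_d hΩ hmul hone T h0 h1
  map_tmul_one h := by
    have e : Ω.incl 1 = 1 := hΩ.incl_one.trans hone
    simp [hB.map_tmul_one, e]
  map_one_tmul h := by
    have e : Ω.incl 1 = 1 := hΩ.incl_one.trans hone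
    simp [hB.map_one_tmul, e]
  cocycle := by
    have e := congrArg (fun f => toConv (Ω.incl ∘ₗ f.ofConv)) hB.cocycle
    simp only [incl_comp_convMul hΩ hmul hone] at e
    refine Eq.trans (congrArg₂ (· * ·) ?_ rfl) (e.trans (congrArg₂ (· * ·) ?_ rfl))
    · refine congrArg toConv (TensorProduct.ext_threefold' fun a b c => ?_)
      simp [hact.map_incl]
    · refine congrArg toConv (TensorProduct.ext_threefold' fun a b c => ?_)
      simp

end TwistedForms

/-! ### Projection to degree zero -/

section DegZero

variable {k A V A' V' : Type*} [Field k] [AddCommGroup A] [Module k A] [AddCommGroup V]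
  [Module k V] [AddCommGroup A'] [Module k A'] [AddCommGroup V'] [Module k V']
  {Ω : CalcStruct k A V} {S : AlgStruct k A} {Ω' : CalcStruct k A' V'} {S' : AlgStruct k A'}

theorem CalcStruct.IsCalculus.degZero_incl (h : Ω.IsCalculus S) (a : A) :
    Ω.degZero (Ω.incl a) = a := by
  have e : degProj Ω.gr 0 (Ω.incl a) = Ω.incl a := by
    rw [degProj, degScale_apply h.isDGA.isInternal _ (h.incl_mem a)]
    simp
  rw [CalcStruct.degZero, LinearMap.comp_apply, e]
  exact LinearMap.leftInverse_apply_of_inj (LinearMap.ker_eq_bot.mpr h.incl_injective) a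

theorem CalcStruct.IsCalculus.degZero_of_mem (h : Ω.IsCalculus S) {n : ℕ} (hn : n ≠ 0) {x : V}
    (hx : x ∈ Ω.gr n) : Ω.degZero x = 0 := by
  rw [CalcStruct.degZero, LinearMap.comp_apply, degProj,
    degScale_apply h.isDGA.isInternal _ hx, if_neg hn, zero_smul, map_zero]

theorem CalcStruct.IsCalculus.incl_degZero (h : Ω.IsCalculus S) {x : V} (hx : x ∈ Ω.gr 0) :
    Ω.incl (Ω.degZero x) = x := by
  rw [← h.range_incl] at hx
  obtain ⟨a, rfl⟩ := hx
  rw [h.degZero_incl]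

/-- The projection onto the forms of degree zero is multiplicative. -/
theorem CalcStruct.IsCalculus.degZero_mul (h : Ω.IsCalculus S) (x y : V) :
    Ω.degZero (Ω.mul x y) = S.mul (Ω.degZero x) (Ω.degZero y) := by
  refine homogeneous_induction h.isDGA.isInternal (fun n x hx => ?_) (by simp)
    (fun x y hx hy => by simp only [map_add, LinearMap.add_apply, hx, hy]) x
  refine homogeneous_induction h.isDGA.isInternal (fun m y hy => ?_) (by simp)
    (fun x y hx hy => by simp only [map_add, hx, hy]) y
  have hxy := h.isDGA.mul_mem n m x hx y hy
  rcases Nat.eq_zero_or_pos n with rfl | hn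
  · rcases Nat.eq_zero_or_pos m with rfl | hm
    · apply h.incl_injective
      rw [h.incl_mul, h.incl_degZero hx, h.incl_degZero hy, h.incl_degZero hxy]
    · rw [h.degZero_of_mem (by omega) hxy, h.degZero_of_mem hm.ne' hy, map_zero]
  · rw [h.degZero_of_mem (by omega) hxy, h.degZero_of_mem hn.ne' hx, map_zero, LinearMap.zero_apply]

theorem CalcStruct.IsCalculus.degZero_d (h : Ω.IsCalculus S) (x : V) : Ω.degZero (Ω.d x) = 0 := by
  refine homogeneous_induction h.isDGA.isInternal (fun n x hx => ?_) (by simp)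
    (fun x y hx hy => by simp only [map_add, hx, hy, add_zero]) x
  exact h.degZero_of_mem (Nat.succ_ne_zero n) (h.isDGA.d_mem n x hx)

theorem CalcStruct.IsCalculus.degZero_degSign (h : Ω.IsCalculus S) (x : V) :
    Ω.degZero (degSign Ω.gr x) = Ω.degZero x := by
  refine homogeneous_induction h.isDGA.isInternal (fun n x hx => ?_) (by simp)
    (fun x y hx hy => by simp only [map_add, hx, hy]) x
  rw [degSign, degScale_apply h.isDGA.isInternal _ hx, map_smul]
  rcases Nat.eq_zero_or_pos n with rfl | hn
  · simp
  · rw [h.degZero_of_mem hn.ne' hx, smul_zero]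

/-- Projecting the first factor to degree zero turns the product of the tensor product calculus into
the product of the ordinary tensor product of algebras. -/
theorem CalcStruct.IsCalculus.rTensor_degZero_mul (h : Ω.IsCalculus S)
    (h' : DirectSum.IsInternal Ω'.gr) (t t' : V ⊗[k] V') :
    Ω.degZero.rTensor V' ((Ω.tensor Ω').mul t t') =
      TensorProduct.map₂ S.mul Ω'.mul (Ω.degZero.rTensor V' t) (Ω.degZero.rTensor V' t') := by
  refine homogeneous_tmul_induction h.isDGA.isInternal h' (fun i j v hv w hw => ?_) (by simp)
    (fun x y hx hy => by simp only [map_add, LinearMap.add_apply, hx, hy]) t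
  refine homogeneous_tmul_induction h.isDGA.isInternal h' (fun i' j' v' hv' w' hw' => ?_) (by simp)
    (fun x y hx hy => by simp only [map_add, hx, hy]) t'
  rw [CalcStruct.tensor, koszul_tmul h.isDGA.isInternal h' _ _ hw hv']
  rcases Nat.eq_zero_or_pos i' with rfl | hi
  · simp [h.degZero_mul]
  · simp [h.degZero_mul, h.degZero_of_mem hi.ne' hv']

/-- Projecting the second factor to degree zero turns the product of the tensor product calculus
into the product of the ordinary tensor product of algebras. -/
theorem CalcStruct.IsCalculus.lTensor_degZero_mul (h : DirectSum.IsInternal Ω.gr)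
    (h' : Ω'.IsCalculus S') (t t' : V ⊗[k] V') :
    Ω'.degZero.lTensor V ((Ω.tensor Ω').mul t t') =
      TensorProduct.map₂ Ω.mul S'.mul (Ω'.degZero.lTensor V t) (Ω'.degZero.lTensor V t') := by
  refine homogeneous_tmul_induction h h'.isDGA.isInternal (fun i j v hv w hw => ?_) (by simp)
    (fun x y hx hy => by simp only [map_add, LinearMap.add_apply, hx, hy]) t
  refine homogeneous_tmul_induction h h'.isDGA.isInternal (fun i' j' v' hv' w' hw' => ?_) (by simp)
    (fun x y hx hy => by simp only [map_add, hx, hy]) t'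
  rw [CalcStruct.tensor, koszul_tmul h h'.isDGA.isInternal _ _ hw hv']
  rcases Nat.eq_zero_or_pos j with rfl | hj
  · simp [h'.degZero_mul]
  · simp [h'.degZero_mul, h'.degZero_of_mem hj.ne' hw]

theorem CalcStruct.IsCalculus.rTensor_degZero_d (h : Ω.IsCalculus S) (t : V ⊗[k] V') :
    Ω.degZero.rTensor V' ((Ω.tensor Ω').d t) = Ω'.d.lTensor A (Ω.degZero.rTensor V' t) := by
  induction t with
  | zero => simp
  | add x y hx hy => simp only [map_add, hx, hy]
  | tmul v w => simp [CalcStruct.tensor, tensorD, h.degZero_d, h.degZero_degSign]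

theorem CalcStruct.IsCalculus.lTensor_degZero_d (h' : Ω'.IsCalculus S') (t : V ⊗[k] V') :
    Ω'.degZero.lTensor V ((Ω.tensor Ω').d t) = Ω.d.rTensor A' (Ω'.degZero.lTensor V t) := by
  induction t with
  | zero => simp
  | add x y hx hy => simp only [map_add, hx, hy]
  | tmul v w => simp [CalcStruct.tensor, tensorD, h'.degZero_d]

theorem CalcStruct.IsCalculus.rTensor_degZero_mem (h : Ω.IsCalculus S) {n : ℕ} {t : V ⊗[k] V'}
    (ht : t ∈ tensorGr Ω.gr Ω'.gr n) :
    Ω.degZero.rTensor V' t ∈ LinearMap.range ((Ω'.gr n).subtype.lTensor A) := by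
  refine tensorGr_induction (p := fun t => Ω.degZero.rTensor V' t ∈
    LinearMap.range ((Ω'.gr n).subtype.lTensor A)) (fun i j hij v hv w hw => ?_) (by simp)
    (fun x y hx hy => by rw [map_add]; exact Submodule.add_mem _ hx hy) ht
  rw [LinearMap.rTensor_tmul]
  rcases Nat.eq_zero_or_pos i with rfl | hi
  · obtain rfl : j = n := by omega
    exact ⟨Ω.degZero v ⊗ₜ ⟨w, hw⟩, rfl⟩
  · rw [h.degZero_of_mem hi.ne' hv, zero_tmul]
    exact Submodule.zero_mem _

theorem CalcStruct.IsCalculus.lTensor_degZero_mem (h' : Ω'.IsCalculus S') {n : ℕ} {t : V ⊗[k] V'}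
    (ht : t ∈ tensorGr Ω.gr Ω'.gr n) :
    Ω'.degZero.lTensor V t ∈ LinearMap.range ((Ω.gr n).subtype.rTensor A') := by
  refine tensorGr_induction (p := fun t => Ω'.degZero.lTensor V t ∈
    LinearMap.range ((Ω.gr n).subtype.rTensor A')) (fun i j hij v hv w hw => ?_) (by simp)
    (fun x y hx hy => by rw [map_add]; exact Submodule.add_mem _ hx hy) ht
  rw [LinearMap.lTensor_tmul]
  rcases Nat.eq_zero_or_pos j with rfl | hj
  · obtain rfl : i = n := by omega
    exact ⟨⟨v, hv⟩ ⊗ₜ Ω'.degZero w, rfl⟩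
  · rw [h'.degZero_of_mem hj.ne' hw, tmul_zero]
    exact Submodule.zero_mem _

end DegZero

/-! ### The left coaction on the forms of a Hopf algebra -/

section LeftCoaction

variable {k H VH : Type*} [Field k] [Ring H] [Bialgebra k H] [AddCommGroup VH] [Module k VH]
  {Ω : CalcStruct k H VH} {DΔ : VH →ₗ[k] VH ⊗[k] VH}

theorem leftCoaction_mul (hΩ : Ω.IsCalculus (AlgStruct.of k H))
    (hDΔ : IsDifferential Ω (Ω.tensor Ω) Coalgebra.comul DΔ) :
    IsMulCoaction (leftCoaction Ω DΔ) Ω.mul := fun x y => by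
  rw [leftCoaction, LinearMap.comp_apply, hDΔ.map_mul,
    hΩ.rTensor_degZero_mul hΩ.isDGA.isInternal]
  rfl

theorem leftCoaction_d (hΩ : Ω.IsCalculus (AlgStruct.of k H))
    (hDΔ : IsDifferential Ω (Ω.tensor Ω) Coalgebra.comul DΔ) (x : VH) :
    leftCoaction Ω DΔ (Ω.d x) = Ω.d.lTensor H (leftCoaction Ω DΔ x) := by
  rw [leftCoaction, LinearMap.comp_apply, hDΔ.map_d, hΩ.rTensor_degZero_d]
  rfl

theorem leftCoaction_incl (hΩ : Ω.IsCalculus (AlgStruct.of k H))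
    (hDΔ : IsDifferential Ω (Ω.tensor Ω) Coalgebra.comul DΔ) (h : H) :
    leftCoaction Ω DΔ (Ω.incl h) = Ω.incl.lTensor H (Coalgebra.comul (R := k) h) := by
  rw [leftCoaction, LinearMap.comp_apply, hDΔ.map_incl]
  generalize Coalgebra.comul (R := k) h = t
  induction t with
  | zero => simp
  | add x y hx hy => simp only [map_add, hx, hy]
  | tmul a b => simp [CalcStruct.tensor, hΩ.degZero_incl]

theorem leftCoaction_mem (hΩ : Ω.IsCalculus (AlgStruct.of k H))
    (hDΔ : IsDifferential Ω (Ω.tensor Ω) Coalgebra.comul DΔ) (n : ℕ) (x : VH) (hx : x ∈ Ω.gr n) :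
    leftCoaction Ω DΔ x ∈ LinearMap.range ((Ω.gr n).subtype.lTensor H) :=
  hΩ.rTensor_degZero_mem (hDΔ.map_mem n x hx)

theorem leftCoaction_one (hΩ : Ω.IsCalculus (AlgStruct.of k H))
    (hDΔ : IsDifferential Ω (Ω.tensor Ω) Coalgebra.comul DΔ) :
    leftCoaction Ω DΔ Ω.one = 1 ⊗ₜ Ω.one := by
  have e := leftCoaction_incl hΩ hDΔ 1
  have e1 : Ω.incl 1 = Ω.one := hΩ.incl_one
  simpa [Algebra.TensorProduct.one_def, e1] using e

theorem leftCoaction_degSign (hΩ : Ω.IsCalculus (AlgStruct.of k H))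
    (hDΔ : IsDifferential Ω (Ω.tensor Ω) Coalgebra.comul DΔ) (x : VH) :
    leftCoaction Ω DΔ (degSign Ω.gr x) = (degSign Ω.gr).lTensor H (leftCoaction Ω DΔ x) := by
  refine homogeneous_induction hΩ.isDGA.isInternal (fun n x hx => ?_) (by simp)
    (fun x y hx hy => by simp only [map_add, hx, hy]) x
  obtain ⟨t, ht⟩ := leftCoaction_mem hΩ hDΔ n x hx
  rw [degSign, degScale_apply hΩ.isDGA.isInternal _ hx, map_smul, ← ht]
  clear ht
  induction t with
  | zero => simp
  | add x y hx hy => simp only [map_add, smul_add, hx, hy]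
  | tmul h v => simp [degScale_apply hΩ.isDGA.isInternal _ v.2]

/-- The left coaction of `H` on its forms is coassociative and counital, because both sides of each
axiom are multiplicative, commute with `d` and agree in degree zero. -/
theorem isLeftCoaction_leftCoaction (hΩ : Ω.IsCalculus (AlgStruct.of k H))
    (hDΔ : IsDifferential Ω (Ω.tensor Ω) Coalgebra.comul DΔ) :
    IsLeftCoaction (leftCoaction Ω DΔ) where
  coassoc := by
    have hm := leftCoaction_mul hΩ hDΔ
    let F : VH →ₗ[k] H ⊗[k] (H ⊗[k] VH) := (TensorProduct.assoc k H H VH).toLinearMap ∘ₗ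
      Coalgebra.comul.rTensor VH ∘ₗ leftCoaction Ω DΔ
    let G : VH →ₗ[k] H ⊗[k] (H ⊗[k] VH) := (leftCoaction Ω DΔ).lTensor H ∘ₗ leftCoaction Ω DΔ
    refine LinearMap.congr_fun (f := F) (g := G) ?_
    refine hΩ.hom_ext (TensorProduct.map₂ (LinearMap.mul k H)
      (TensorProduct.map₂ (LinearMap.mul k H) Ω.mul)) ((Ω.d.lTensor H).lTensor H)
      (fun x y => ?_) (fun x y => ?_) (fun x => ?_) (fun x => ?_) (fun h => ?_)
    · simp only [F, LinearMap.comp_apply, hm x y]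
      generalize leftCoaction Ω DΔ x = t
      generalize leftCoaction Ω DΔ y = t'
      induction t with
      | zero => simp
      | add x y hx hy => simp only [map_add, LinearMap.add_apply, hx, hy]
      | tmul h v =>
        induction t' with
        | zero => simp
        | add x y hx hy => simp only [map_add, hx, hy]
        | tmul h' v' =>
          simp only [TensorProduct.map₂_apply_tmul, TensorProduct.map_tmul,
            LinearMap.mul_apply', LinearMap.rTensor_tmul,
            Bialgebra.comul_mul]
          generalize Coalgebra.comul (R := k) h = u
          generalize Coalgebra.comul (R := k) h' = u'
          induction u with
          | zero => simp
          | add x y hx hy => simp only [map_add, add_mul, add_tmul, LinearMap.add_apply, hx, hy]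
          | tmul a b =>
            induction u' with
            | zero => simp
            | add x y hx hy => simp only [map_add, mul_add, add_tmul, hx, hy]
            | tmul a' b' => simp
    · simp only [G, LinearMap.comp_apply, hm x y]
      generalize leftCoaction Ω DΔ x = t
      generalize leftCoaction Ω DΔ y = t'
      induction t with
      | zero => simp
      | add x y hx hy => simp only [map_add, LinearMap.add_apply, hx, hy]
      | tmul h v =>
        induction t' with
        | zero => simp
        | add x y hx hy => simp only [map_add, hx, hy]
        | tmul h' v' => simp [hm v v']
    · simp only [F, LinearMap.comp_apply, leftCoaction_d hΩ hDΔ]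
      generalize leftCoaction Ω DΔ x = t
      induction t with
      | zero => simp
      | add x y hx hy => simp only [map_add, hx, hy]
      | tmul h v =>
        simp only [LinearMap.lTensor_tmul, LinearMap.rTensor_tmul]
        generalize Coalgebra.comul (R := k) h = u
        induction u with
        | zero => simp
        | add x y hx hy => simp only [map_add, add_tmul, hx, hy]
        | tmul a b => simp
    · simp only [G, LinearMap.comp_apply, leftCoaction_d hΩ hDΔ]
      generalize leftCoaction Ω DΔ x = t
      induction t with
      | zero => simp
      | add x y hx hy => simp only [map_add, hx, hy]
      | tmul h v => simp [leftCoaction_d hΩ hDΔ]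
    · have e1 : ∀ t : H ⊗[k] H, TensorProduct.assoc k H H VH
          (Coalgebra.comul.rTensor VH (Ω.incl.lTensor H t)) = (Ω.incl.lTensor H).lTensor H
            (TensorProduct.assoc k H H H (Coalgebra.comul.rTensor H t)) := by
        intro t
        induction t with
        | zero => simp
        | add x y hx hy => simp only [map_add, hx, hy]
        | tmul h v =>
          simp only [LinearMap.lTensor_tmul, LinearMap.rTensor_tmul]
          generalize Coalgebra.comul (R := k) h = u
          induction u with
          | zero => simp
          | add x y hx hy => simp only [map_add, add_tmul, hx, hy]
          | tmul a b => simp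
      have e2 : ∀ t : H ⊗[k] H, (leftCoaction Ω DΔ).lTensor H (Ω.incl.lTensor H t) =
          (Ω.incl.lTensor H).lTensor H (Coalgebra.comul.lTensor H t) := by
        intro t
        induction t with
        | zero => simp
        | add x y hx hy => simp only [map_add, hx, hy]
        | tmul h v => simp [leftCoaction_incl hΩ hDΔ]
      simp only [F, G, LinearMap.comp_apply, LinearEquiv.coe_coe, leftCoaction_incl hΩ hDΔ, e1, e2,
        Coalgebra.coassoc_apply]
  counit := by
    have hm := leftCoaction_mul hΩ hDΔ
    let F : VH →ₗ[k] VH := (TensorProduct.lid k VH).toLinearMap ∘ₗ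
      Coalgebra.counit.rTensor VH ∘ₗ leftCoaction Ω DΔ
    refine LinearMap.congr_fun (f := F) (g := LinearMap.id) ?_
    refine hΩ.hom_ext Ω.mul Ω.d (fun x y => ?_) (fun x y => rfl) (fun x => ?_) (fun x => rfl)
      (fun h => ?_)
    · simp only [F, LinearMap.comp_apply, hm x y]
      generalize leftCoaction Ω DΔ x = t
      generalize leftCoaction Ω DΔ y = t'
      induction t with
      | zero => simp
      | add x y hx hy => simp only [map_add, LinearMap.add_apply, hx, hy]
      | tmul h v =>
        induction t' with
        | zero => simp
        | add x y hx hy => simp only [map_add, hx, hy]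
        | tmul h' v' => simp [smul_smul, mul_comm]
    · simp only [F, LinearMap.comp_apply, leftCoaction_d hΩ hDΔ]
      generalize leftCoaction Ω DΔ x = t
      induction t with
      | zero => simp
      | add x y hx hy => simp only [map_add, hx, hy]
      | tmul h v => simp
    · have e1 : ∀ t : H ⊗[k] H, TensorProduct.lid k VH
          (Coalgebra.counit.rTensor VH (Ω.incl.lTensor H t)) =
            Ω.incl (TensorProduct.lid k H (Coalgebra.counit.rTensor H t)) := by
        intro t
        induction t with
        | zero => simp
        | add x y hx hy => simp only [map_add, hx, hy]
        | tmul h v => simp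
      simp [F, leftCoaction_incl hΩ hDΔ, e1]

/-- The left coaction of `H` on the first factor of `Ω(H) ⊗ Ω(H)` is multiplicative for the product
of the tensor product calculus: the signs agree since `H` sits in degree zero. -/
theorem assoc_leftCoaction_mul (hΩ : Ω.IsCalculus (AlgStruct.of k H))
    (hDΔ : IsDifferential Ω (Ω.tensor Ω) Coalgebra.comul DΔ) :
    IsMulCoaction ((TensorProduct.assoc k H VH VH).toLinearMap ∘ₗ (leftCoaction Ω DΔ).rTensor VH)
      (Ω.tensor Ω).mul := by
  intro t t'
  have hI := hΩ.isDGA.isInternal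
  refine homogeneous_tmul_induction hI hI (fun i j v hv w hw => ?_) (by simp)
    (fun x y hx hy => by simp only [map_add, LinearMap.add_apply, hx, hy]) t
  refine homogeneous_tmul_induction hI hI (fun i' j' v' hv' w' hw' => ?_) (by simp)
    (fun x y hx hy => by simp only [map_add, hx, hy]) t'
  have hm := leftCoaction_mul hΩ hDΔ v v'
  simp only [CalcStruct.tensor, koszul_tmul hI hI _ _ hw hv', LinearMap.comp_apply, map_smul,
    TensorProduct.map₂_apply_tmul, TensorProduct.map_tmul, LinearMap.rTensor_tmul, hm]
  obtain ⟨u, hu⟩ := leftCoaction_mem hΩ hDΔ i' v' hv'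
  rw [← hu]
  clear hu hm
  generalize leftCoaction Ω DΔ v = s
  induction s with
  | zero => simp
  | add x y hx hy => simp only [map_add, add_tmul, LinearMap.add_apply, smul_add, hx, hy]
  | tmul h z =>
    induction u with
    | zero => simp
    | add x y hx hy => simp only [map_add, add_tmul, smul_add, hx, hy]
    | tmul h' z' => simp [koszul_tmul hI hI _ _ hw z'.2]

/-- `γ₋₁ ⊗ (γ₀)_[1] ⊗ (γ₀)_[2] = (γ_[1])₋₁ ⊗ (γ_[1])₀ ⊗ γ_[2]` -/
theorem lTensor_leftCoaction (hΩ : Ω.IsCalculus (AlgStruct.of k H))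
    (hDΔ : IsDifferential Ω (Ω.tensor Ω) Coalgebra.comul DΔ) (x : VH) :
    TensorProduct.assoc k H VH VH ((leftCoaction Ω DΔ).rTensor VH (DΔ x)) =
      DΔ.lTensor H (leftCoaction Ω DΔ x) := by
  have hm := leftCoaction_mul hΩ hDΔ
  let lam2 := (TensorProduct.assoc k H VH VH).toLinearMap ∘ₗ (leftCoaction Ω DΔ).rTensor VH
  let G : VH →ₗ[k] H ⊗[k] (VH ⊗[k] VH) := DΔ.lTensor H ∘ₗ leftCoaction Ω DΔ
  refine LinearMap.congr_fun (f := lam2 ∘ₗ DΔ) (g := G) ?_ x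
  refine hΩ.hom_ext (TensorProduct.map₂ (LinearMap.mul k H) (Ω.tensor Ω).mul)
    ((Ω.tensor Ω).d.lTensor H)
    (fun x y => ?_) (fun x y => ?_) (fun x => ?_) (fun x => ?_) (fun h => ?_)
  · rw [LinearMap.comp_apply, hDΔ.map_mul]
    exact assoc_leftCoaction_mul hΩ hDΔ _ _
  · simp only [G, LinearMap.comp_apply, hm x y]
    generalize leftCoaction Ω DΔ x = t
    generalize leftCoaction Ω DΔ y = t'
    induction t with
    | zero => simp
    | add x y hx hy => simp only [map_add, LinearMap.add_apply, hx, hy]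
    | tmul h v =>
      induction t' with
      | zero => simp
      | add x y hx hy => simp only [map_add, hx, hy]
      | tmul h' v' => simp [hDΔ.map_mul]
  · rw [LinearMap.comp_apply lam2, LinearMap.comp_apply lam2, hDΔ.map_d]
    generalize DΔ x = t
    induction t with
    | zero => simp
    | add x y hx hy => simp only [map_add, hx, hy]
    | tmul v w =>
      simp only [CalcStruct.tensor, tensorD, LinearMap.add_apply, LinearMap.rTensor_tmul, map_add,
        TensorProduct.map_tmul, lam2, LinearMap.comp_apply, leftCoaction_d hΩ hDΔ,
        leftCoaction_degSign hΩ hDΔ]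
      generalize leftCoaction Ω DΔ v = t
      induction t with
      | zero => simp
      | add x y hx hy =>
        simp only [map_add, add_tmul, ← hx, ← hy]
        abel
      | tmul h v => simp
  · simp only [G, LinearMap.comp_apply, leftCoaction_d hΩ hDΔ]
    generalize leftCoaction Ω DΔ x = t
    induction t with
    | zero => simp
    | add x y hx hy => simp only [map_add, hx, hy]
    | tmul h v => simp [hDΔ.map_d]
  · have e1 : ∀ t : H ⊗[k] H, lam2 (TensorProduct.map Ω.incl Ω.incl t) =
        (TensorProduct.map Ω.incl Ω.incl).lTensor H
          (TensorProduct.assoc k H H H (Coalgebra.comul.rTensor H t)) := by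
      intro t
      induction t with
      | zero => simp
      | add x y hx hy => simp only [map_add, hx, hy]
      | tmul h v =>
        simp only [TensorProduct.map_tmul, LinearMap.rTensor_tmul, lam2, LinearMap.comp_apply,
          leftCoaction_incl hΩ hDΔ]
        generalize Coalgebra.comul (R := k) h = u
        induction u with
        | zero => simp
        | add x y hx hy => simp only [map_add, add_tmul, hx, hy]
        | tmul a b => simp
    have e2 : ∀ t : H ⊗[k] H, DΔ.lTensor H (Ω.incl.lTensor H t) =
        (TensorProduct.map Ω.incl Ω.incl).lTensor H (Coalgebra.comul.lTensor H t) := by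
      intro t
      induction t with
      | zero => simp
      | add x y hx hy => simp only [map_add, hx, hy]
      | tmul h v => simp [hDΔ.map_incl, CalcStruct.tensor]
    rw [LinearMap.comp_apply, hDΔ.map_incl]
    simp only [G, LinearMap.comp_apply, leftCoaction_incl hΩ hDΔ, e2, ← Coalgebra.coassoc_apply]
    exact e1 _

end LeftCoaction

/-! ### Recognizing a differential calculus -/

section WordSpan

variable {k A V : Type*} [Field k] [AddCommGroup A] [Module k A] [AddCommGroup V] [Module k V]
  {Ω : CalcStruct k A V} {S : AlgStruct k A}

theorem CalcStruct.incl_mul_mem_wordSpan (hΩ : Ω.IsDGA)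
    (hmul : ∀ a b, Ω.incl (S.mul a b) = Ω.mul (Ω.incl a) (Ω.incl b)) (a : A) {n : ℕ} {x : V}
    (hx : x ∈ Ω.wordSpan n) : Ω.mul (Ω.incl a) x ∈ Ω.wordSpan n := by
  refine Submodule.span_induction (p := fun x _ => Ω.mul (Ω.incl a) x ∈ Ω.wordSpan n) ?_ (by simp)
    (fun x y _ _ hx hy => by rw [map_add]; exact Submodule.add_mem _ hx hy)
    (fun c x _ hx => by rw [map_smul]; exact Submodule.smul_mem _ c hx) hx
  rintro _ ⟨b, l, rfl, rfl⟩
  rw [← hΩ.isAlgebra.mul_assoc, ← hmul]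
  exact Ω.word_mem_wordSpan _ _

theorem CalcStruct.d_incl_mul_mem_wordSpan (hΩ : Ω.IsDGA) (hincl : ∀ a, Ω.incl a ∈ Ω.gr 0)
    (hone : Ω.incl S.one = Ω.one)
    (hmul : ∀ a b, Ω.incl (S.mul a b) = Ω.mul (Ω.incl a) (Ω.incl b)) (a : A) {n : ℕ} {x : V}
    (hx : x ∈ Ω.wordSpan n) : Ω.mul (Ω.d (Ω.incl a)) x ∈ Ω.wordSpan (n + 1) := by
  refine Submodule.span_induction (p := fun x _ => Ω.mul (Ω.d (Ω.incl a)) x ∈ Ω.wordSpan (n + 1)) ?_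
    (by simp) (fun x y _ _ hx hy => by rw [map_add]; exact Submodule.add_mem _ hx hy)
    (fun c x _ hx => by rw [map_smul]; exact Submodule.smul_mem _ c hx) hx
  rintro _ ⟨b, l, rfl, rfl⟩
  -- `da (b w) = d(ab) w - a db w`
  have e : Ω.mul (Ω.d (Ω.incl a)) (Ω.mul (Ω.incl b) (Ω.dWord l)) =
      Ω.mul (Ω.incl S.one) (Ω.dWord (S.mul a b :: l)) -
        Ω.mul (Ω.incl a) (Ω.dWord (b :: l)) := by
    rw [hone, hΩ.isAlgebra.one_mul, CalcStruct.dWord, CalcStruct.dWord, hmul,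
      hΩ.d_mul_of_zero (hincl a), map_add, LinearMap.add_apply, hΩ.isAlgebra.mul_assoc,
      hΩ.isAlgebra.mul_assoc]
    abel
  rw [e]
  exact Submodule.sub_mem _ (Ω.word_mem_wordSpan _ (S.mul a b :: l))
    (Ω.word_mem_wordSpan a (b :: l))

theorem CalcStruct.d_incl_mem_wordSpan (hΩ : Ω.IsDGA) (hincl : ∀ a, Ω.incl a ∈ Ω.gr 0)
    (hone : Ω.incl S.one = Ω.one)
    (hmul : ∀ a b, Ω.incl (S.mul a b) = Ω.mul (Ω.incl a) (Ω.incl b)) (a : A) :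
    Ω.d (Ω.incl a) ∈ Ω.wordSpan 1 := by
  have e := Ω.d_incl_mul_mem_wordSpan hΩ hincl hone hmul a
    (Ω.incl_mem_wordSpan hΩ S.one)
  rwa [hone, hΩ.isAlgebra.mul_one] at e

theorem CalcStruct.mul_mem_wordSpan (hΩ : Ω.IsDGA) (hincl : ∀ a, Ω.incl a ∈ Ω.gr 0)
    (hone : Ω.incl S.one = Ω.one)
    (hmul : ∀ a b, Ω.incl (S.mul a b) = Ω.mul (Ω.incl a) (Ω.incl b)) {n m : ℕ} {x y : V}
    (hx : x ∈ Ω.wordSpan n) (hy : y ∈ Ω.wordSpan m) : Ω.mul x y ∈ Ω.wordSpan (n + m) := by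
  have hw : ∀ l : List A, Ω.mul (Ω.dWord l) y ∈ Ω.wordSpan (l.length + m) := by
    intro l
    induction l with
    | nil => simpa [CalcStruct.dWord, hΩ.isAlgebra.one_mul] using hy
    | cons a l ih =>
      rw [CalcStruct.dWord, hΩ.isAlgebra.mul_assoc, List.length_cons,
        show l.length + 1 + m = l.length + m + 1 by omega]
      exact Ω.d_incl_mul_mem_wordSpan hΩ hincl hone hmul a ih
  refine Submodule.span_induction (p := fun x _ => Ω.mul x y ∈ Ω.wordSpan (n + m)) ?_ (by simp)
    (fun x y _ _ hx hy => by rw [map_add]; exact Submodule.add_mem _ hx hy)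
    (fun c x _ hx => by rw [map_smul]; exact Submodule.smul_mem _ c hx) hx
  rintro _ ⟨b, l, rfl, rfl⟩
  rw [hΩ.isAlgebra.mul_assoc]
  exact Ω.incl_mul_mem_wordSpan hΩ hmul b (hw l)

theorem CalcStruct.dWord_mem (hΩ : Ω.IsDGA) (hincl : ∀ a, Ω.incl a ∈ Ω.gr 0) (l : List A) :
    Ω.dWord l ∈ Ω.gr l.length := by
  induction l with
  | nil => exact hΩ.one_mem
  | cons a l ih =>
    have e := hΩ.mul_mem _ _ _ (hΩ.d_mem _ _ (hincl a)) _ ih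
    rwa [show 0 + 1 + l.length = (a :: l).length by simp [add_comm]] at e

/-- A differential graded algebra whose degree zero part is a copy of `A`, and which is spanned by
the forms `a₀ da₁ ∧ ⋯ ∧ daₙ`, is a differential calculus. -/
theorem CalcStruct.isCalculus_of_le_wordSpan (hΩ : Ω.IsDGA) (hinj : Function.Injective Ω.incl)
    (hrange : LinearMap.range Ω.incl = Ω.gr 0) (hone : Ω.incl S.one = Ω.one)
    (hmul : ∀ a b, Ω.incl (S.mul a b) = Ω.mul (Ω.incl a) (Ω.incl b))
    (hspan : ∀ n, Ω.gr n ≤ Ω.wordSpan n) : Ω.IsCalculus S where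
  base :=
    { mul_assoc := fun x y z => hinj (by simp only [hmul, hΩ.isAlgebra.mul_assoc])
      one_mul := fun x => hinj (by rw [hmul, hone, hΩ.isAlgebra.one_mul])
      mul_one := fun x => hinj (by rw [hmul, hone, hΩ.isAlgebra.mul_one]) }
  isDGA := hΩ
  incl_injective := hinj
  range_incl := hrange
  incl_one := hone
  incl_mul := hmul
  span_eq n _ := by
    refine le_antisymm (hspan n) (Submodule.span_le.mpr ?_)
    rintro _ ⟨a, l, rfl, rfl⟩
    have hincl : ∀ a, Ω.incl a ∈ Ω.gr 0 := fun a => hrange ▸ ⟨a, rfl⟩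
    have e := hΩ.mul_mem _ _ _ (hincl a) _ (CalcStruct.dWord_mem hΩ hincl l)
    rwa [zero_add] at e

end WordSpan

/-! ### The crossed product calculus -/

section CrossedCalculus

variable {k H B A VH : Type*} [Field k] [Ring H] [Bialgebra k H] [Ring B] [Algebra k B]
  [Ring A] [Algebra k A] [AddCommGroup VH] [Module k VH]
  {act : H →ₗ[k] B →ₗ[k] B} {σ σinv : H ⊗[k] H →ₗ[k] B}
  {ΩB : CalcStruct k B A} {actΩ : H →ₗ[k] A →ₗ[k] A}
  {ΩH : CalcStruct k H VH} {DΔ : VH →ₗ[k] VH ⊗[k] VH}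

/-- The data from which the crossed product calculus is built, where the product of the forms on `B`
is given by a ring structure on their total space. -/
structure IsCrossedData (act : H →ₗ[k] B →ₗ[k] B) (σ σinv : H ⊗[k] H →ₗ[k] B)
    (ΩB : CalcStruct k B A) (actΩ : H →ₗ[k] A →ₗ[k] A)
    (ΩH : CalcStruct k H VH) (DΔ : VH →ₗ[k] VH ⊗[k] VH) : Prop where
  twisted : IsTwistedModuleAlgebra act σ σinv
  calcB : ΩB.IsCalculus (AlgStruct.of k B)
  mul_eq : ΩB.mul = LinearMap.mul k A
  one_eq : ΩB.one = 1
  moduleCalc : IsTwistedModuleCalculus act σ ΩB actΩ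
  calcH : ΩH.IsCalculus (AlgStruct.of k H)
  diff : IsDifferential ΩH (ΩH.tensor ΩH) Coalgebra.comul DΔ

namespace IsCrossedData

theorem forms (hD : IsCrossedData act σ σinv ΩB actΩ ΩH DΔ) :
    IsTwistedModuleAlgebra actΩ (ΩB.incl ∘ₗ σ) (ΩB.incl ∘ₗ σinv) :=
  isTwistedModuleAlgebra_forms hD.twisted hD.calcB hD.moduleCalc hD.mul_eq hD.one_eq

theorem isBigraded (hD : IsCrossedData act σ σinv ΩB actΩ ΩH DΔ) :
    IsBigraded ΩB.gr ΩH.gr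
      (twistedMul ΩB.mul actΩ (ΩB.incl ∘ₗ σ) (leftCoaction ΩH DΔ) ΩH.mul) :=
  isBigraded_twistedMul hD.calcB.isDGA.mul_mem hD.moduleCalc.map_mem
    (fun _ => hD.calcB.incl_mem _) (leftCoaction_mem hD.calcH hD.diff) hD.calcH.isDGA.mul_mem

/-- The crossed product calculus is a differential graded algebra. -/
theorem isDGA (hD : IsCrossedData act σ σinv ΩB actΩ ΩH DΔ) :
    (crossedCalculus σ ΩB actΩ ΩH DΔ).IsDGA where
  isInternal := tensorGr_isInternal hD.calcB.isDGA.isInternal hD.calcH.isDGA.isInternal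
  isAlgebra :=
    { mul_assoc := koszul_assoc hD.calcB.isDGA.isInternal hD.calcH.isDGA.isInternal hD.isBigraded
        (by
          rw [hD.mul_eq]
          exact twistedMul_assoc hD.forms (isLeftCoaction_leftCoaction hD.calcH hD.diff)
            (leftCoaction_mul hD.calcH hD.diff) hD.calcH.isDGA.isAlgebra.mul_assoc)
      one_mul := fun x => by
        refine (koszul_left_of_zero hD.calcB.isDGA.isInternal hD.calcH.isDGA.isInternal _ _
          hD.calcH.isDGA.one_mem x).trans ?_
        rw [hD.mul_eq, hD.one_eq]
        exact one_twistedMul hD.forms (isLeftCoaction_leftCoaction hD.calcH hD.diff)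
          (leftCoaction_one hD.calcH hD.diff) hD.calcH.isDGA.isAlgebra.one_mul x
      mul_one := fun x => by
        refine (koszul_right_of_zero hD.calcB.isDGA.isInternal hD.calcH.isDGA.isInternal _ x
          hD.calcB.isDGA.one_mem _).trans ?_
        rw [hD.mul_eq, hD.one_eq]
        exact twistedMul_one hD.forms (isLeftCoaction_leftCoaction hD.calcH hD.diff)
          (leftCoaction_one hD.calcH hD.diff) hD.calcH.isDGA.isAlgebra.mul_one x }
  one_mem := tmul_mem_tensorGr (zero_add 0) hD.calcB.isDGA.one_mem hD.calcH.isDGA.one_mem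
  mul_mem _ _ _ hx _ hy :=
    koszul_mem hD.calcB.isDGA.isInternal hD.calcH.isDGA.isInternal hD.isBigraded hx hy
  d_mem _ _ hx := hD.calcB.isDGA.tensorD_mem hD.calcH.isDGA hx
  d_d := hD.calcB.isDGA.tensorD_tensorD hD.calcH.isDGA
  leibniz _ _ hx y := tensorD_koszul hD.calcB.isDGA hD.calcH.isDGA hD.isBigraded
    (fun x x' y y' => rTensor_twistedMul hD.calcB.isDGA.d_mul
      (d_act hD.twisted hD.calcB hD.moduleCalc hD.mul_eq hD.one_eq) hD.moduleCalc.d_σ x x' y y')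
    (fun x x' y y' => lTensor_twistedMul hD.calcH.isDGA.d_mul (leftCoaction_d hD.calcH hD.diff)
      (leftCoaction_degSign hD.calcH hD.diff) x x' y y') hx y

theorem incl_mem (hD : IsCrossedData act σ σinv ΩB actΩ ΩH DΔ) (a : B ⊗[k] H) :
    (crossedCalculus σ ΩB actΩ ΩH DΔ).incl a ∈ (crossedCalculus σ ΩB actΩ ΩH DΔ).gr 0 := by
  induction a with
  | zero => simp
  | add x y hx hy =>
    rw [map_add]
    exact Submodule.add_mem _ hx hy
  | tmul b h => exact tmul_mem_tensorGr (zero_add 0) (hD.calcB.incl_mem b) (hD.calcH.incl_mem h)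

theorem incl_one (hD : IsCrossedData act σ σinv ΩB actΩ ΩH DΔ) :
    (crossedCalculus σ ΩB actΩ ΩH DΔ).incl (crossedProduct act σ).one =
      (crossedCalculus σ ΩB actΩ ΩH DΔ).one :=
  congrArg₂ (· ⊗ₜ[k] ·) hD.calcB.incl_one hD.calcH.incl_one

theorem incl_mul (hD : IsCrossedData act σ σinv ΩB actΩ ΩH DΔ) (a b : B ⊗[k] H) :
    (crossedCalculus σ ΩB actΩ ΩH DΔ).incl ((crossedProduct act σ).mul a b) =
      (crossedCalculus σ ΩB actΩ ΩH DΔ).mul ((crossedCalculus σ ΩB actΩ ΩH DΔ).incl a)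
        ((crossedCalculus σ ΩB actΩ ΩH DΔ).incl b) := by
  refine (map_twistedMul (act₂ := actΩ) (s₂ := ΩB.incl ∘ₗ σ) (lam₂ := leftCoaction ΩH DΔ)
    (mul₂ := ΩB.mul) (mulY₂ := ΩH.mul) ΩB.incl ΩH.incl
    hD.calcB.incl_mul (fun h x => (hD.moduleCalc.map_incl h x).symm) (fun _ => rfl)
    hD.calcH.incl_mul (leftCoaction_incl hD.calcH hD.diff) a b).trans ?_
  induction a with
  | zero => simp
  | add x y hx hy => simp only [map_add, LinearMap.add_apply, hx, hy]
  | tmul x h => exact (koszul_left_of_zero hD.calcB.isDGA.isInternal hD.calcH.isDGA.isInternal _ _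
      (hD.calcH.incl_mem h) _).symm

/-- `(ω ⊗ 1) ∧ (ω' ⊗ γ) = (ω ∧ ω') ⊗ γ` -/
theorem tmul_one_mul (hD : IsCrossedData act σ σinv ΩB actΩ ΩH DΔ) (x x' : A) (y : VH) :
    (crossedCalculus σ ΩB actΩ ΩH DΔ).mul (x ⊗ₜ ΩH.one) (x' ⊗ₜ y) = (x * x') ⊗ₜ y := by
  refine (koszul_left_of_zero hD.calcB.isDGA.isInternal hD.calcH.isDGA.isInternal _ _
    hD.calcH.isDGA.one_mem _).trans ?_
  rw [hD.mul_eq, ← mul_one x, twistedMul_mul_left, one_twistedMul hD.forms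
    (isLeftCoaction_leftCoaction hD.calcH hD.diff) (leftCoaction_one hD.calcH hD.diff)
    hD.calcH.isDGA.isAlgebra.one_mul]
  simp

theorem d_tmul_one (hD : IsCrossedData act σ σinv ΩB actΩ ΩH DΔ) (x : A) :
    (crossedCalculus σ ΩB actΩ ΩH DΔ).d (x ⊗ₜ ΩH.one) = ΩB.d x ⊗ₜ ΩH.one := by
  simp [crossedCalculus, tensorD, hD.calcH.isDGA.d_one]

theorem d_one_tmul (hD : IsCrossedData act σ σinv ΩB actΩ ΩH DΔ) (y : VH) :
    (crossedCalculus σ ΩB actΩ ΩH DΔ).d (ΩB.one ⊗ₜ y) = ΩB.one ⊗ₜ ΩH.d y := by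
  refine (tensorD_tmul _ _ hD.calcB.isDGA.isInternal hD.calcB.isDGA.one_mem y).trans ?_
  simp [hD.calcB.isDGA.d_one]

theorem mul_mem_wordSpan (hD : IsCrossedData act σ σinv ΩB actΩ ΩH DΔ) {n m : ℕ} {x y : A ⊗[k] VH}
    (hx : x ∈ (crossedCalculus σ ΩB actΩ ΩH DΔ).wordSpan n)
    (hy : y ∈ (crossedCalculus σ ΩB actΩ ΩH DΔ).wordSpan m) :
    (crossedCalculus σ ΩB actΩ ΩH DΔ).mul x y ∈
      (crossedCalculus σ ΩB actΩ ΩH DΔ).wordSpan (n + m) :=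
  CalcStruct.mul_mem_wordSpan hD.isDGA hD.incl_mem hD.incl_one hD.incl_mul hx hy

theorem tmul_one_mem_wordSpan (hD : IsCrossedData act σ σinv ΩB actΩ ΩH DΔ) {n : ℕ} {x : A}
    (hx : x ∈ ΩB.gr n) : x ⊗ₜ ΩH.one ∈ (crossedCalculus σ ΩB actΩ ΩH DΔ).wordSpan n := by
  have hincl : ∀ b : B, (crossedCalculus σ ΩB actΩ ΩH DΔ).incl (b ⊗ₜ 1) = ΩB.incl b ⊗ₜ ΩH.one :=
    fun b => congrArg (ΩB.incl b ⊗ₜ[k] ·) hD.calcH.incl_one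
  have hw : ∀ l : List B, ΩB.dWord l ⊗ₜ ΩH.one =
      (crossedCalculus σ ΩB actΩ ΩH DΔ).dWord (l.map (· ⊗ₜ 1)) := by
    intro l
    induction l with
    | nil => rfl
    | cons b l ih =>
      rw [List.map_cons, CalcStruct.dWord, CalcStruct.dWord, ← ih, hincl, hD.d_tmul_one,
        hD.tmul_one_mul, hD.mul_eq, LinearMap.mul_apply']
  rw [hD.calcB.gr_eq] at hx
  refine Submodule.span_induction (p := fun x _ => x ⊗ₜ ΩH.one ∈
    (crossedCalculus σ ΩB actΩ ΩH DΔ).wordSpan n) ?_ (by simp)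
    (fun x y _ _ hx hy => by rw [add_tmul]; exact Submodule.add_mem _ hx hy)
    (fun c x _ hx => by rw [← smul_tmul']; exact Submodule.smul_mem _ c hx) hx
  rintro _ ⟨b, l, rfl, rfl⟩
  rw [hD.mul_eq, LinearMap.mul_apply', ← hD.tmul_one_mul, hw, ← hincl]
  simpa using (crossedCalculus σ ΩB actΩ ΩH DΔ).word_mem_wordSpan (b ⊗ₜ[k] 1) (l.map (· ⊗ₜ 1))

/-- `1 ⊗ (γ ∧ γ')` is a combination of products `(b ⊗ 1) ∧ (1 ⊗ γ₀) ∧ (1 ⊗ γ'₀)`, since `σ` is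
convolution invertible. -/
theorem one_tmul_mul_mem_wordSpan (hD : IsCrossedData act σ σinv ΩB actΩ ΩH DΔ) {n m : ℕ}
    {P P' : Submodule k VH}
    (hP : ∀ y ∈ P, leftCoaction ΩH DΔ y ∈ LinearMap.range (P.subtype.lTensor H))
    (hP' : ∀ y ∈ P', leftCoaction ΩH DΔ y ∈ LinearMap.range (P'.subtype.lTensor H))
    (hn : ∀ y ∈ P, ΩB.one ⊗ₜ y ∈ (crossedCalculus σ ΩB actΩ ΩH DΔ).wordSpan n)
    (hm : ∀ y ∈ P', ΩB.one ⊗ₜ y ∈ (crossedCalculus σ ΩB actΩ ΩH DΔ).wordSpan m)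
    {y y' : VH} (hy : y ∈ P) (hy' : y' ∈ P') :
    ΩB.one ⊗ₜ ΩH.mul y y' ∈ (crossedCalculus σ ΩB actΩ ΩH DΔ).wordSpan (n + m) := by
  have hl := isLeftCoaction_leftCoaction hD.calcH hD.diff
  let lam2 := tensorCoaction (leftCoaction ΩH DΔ) (leftCoaction ΩH DΔ)
  let Q : A ⊗[k] (VH ⊗[k] VH) →ₗ[k] A ⊗[k] VH := (TensorProduct.lift ΩH.mul).lTensor A ∘ₗ
    convAct lam2 (toConv (ΩB.incl ∘ₗ σ))
  have hQ : ∀ (z : A) (u u' : VH), Q (z ⊗ₜ (u ⊗ₜ u')) = (crossedCalculus σ ΩB actΩ ΩH DΔ).mul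
      ((crossedCalculus σ ΩB actΩ ΩH DΔ).mul (z ⊗ₜ ΩH.one) (ΩB.one ⊗ₜ u)) (ΩB.one ⊗ₜ u') := by
    intro z u u'
    rw [hD.tmul_one_mul, hD.one_eq, mul_one]
    have e : (crossedCalculus σ ΩB actΩ ΩH DΔ).mul (z ⊗ₜ u) (1 ⊗ₜ u') =
        twistedMul ΩB.mul actΩ (ΩB.incl ∘ₗ σ) (leftCoaction ΩH DΔ) ΩH.mul (z ⊗ₜ u) (1 ⊗ₜ u') :=
      koszul_right_of_zero hD.calcB.isDGA.isInternal hD.calcH.isDGA.isInternal _ _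
        (hD.one_eq ▸ hD.calcB.isDGA.one_mem) _
    have e1 : (actFst actΩ 1 : WithConv (H ⊗[k] H →ₗ[k] A)) = 1 := by
      refine congrArg toConv (TensorProduct.ext' fun a b => ?_)
      simp [hD.forms.act_one, Algebra.algebraMap_eq_smul_one, smul_smul, mul_comm]
    rw [e, hD.mul_eq, twistedMul_eq_convAct, twistedPair, e1, one_mul]
    rfl
  have h1 : ΩB.one ⊗ₜ ΩH.mul y y' =
      Q (convAct lam2 (toConv (ΩB.incl ∘ₗ σinv)) (1 ⊗ₜ (y ⊗ₜ y'))) := by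
    simp only [Q, LinearMap.comp_apply]
    rw [convAct_convAct (hl.tensor hl), hD.forms.inv_mul, convAct_one (hl.tensor hl), hD.one_eq]
    simp
  rw [h1, convAct_tmul]
  simp only [lam2, tensorCoaction_tmul]
  obtain ⟨t, ht⟩ := hP y hy
  obtain ⟨t', ht'⟩ := hP' y' hy'
  rw [← ht, ← ht']
  clear ht ht' h1
  induction t with
  | zero => simp
  | add x y hx hy =>
    simp only [map_add, add_tmul]
    exact Submodule.add_mem _ hx hy
  | tmul h u =>
    induction t' with
    | zero => simp
    | add x y hx hy =>
      simp only [map_add, tmul_add]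
      exact Submodule.add_mem _ hx hy
    | tmul h' u' =>
      simp only [LinearMap.lTensor_tmul, tensorTensorTensorComm_tmul, LinearMap.rTensor_tmul,
        LinearMap.comp_apply, hQ]
      have e := hD.mul_mem_wordSpan (hD.mul_mem_wordSpan (hD.tmul_one_mem_wordSpan
        (hD.calcB.incl_mem (σinv (h ⊗ₜ h')))) (hn u u.2)) (hm u' u'.2)
      rw [zero_add] at e
      simpa using e

theorem one_tmul_mem_wordSpan (hD : IsCrossedData act σ σinv ΩB actΩ ΩH DΔ) (n : ℕ) (y : VH)
    (hy : y ∈ ΩH.gr n) : ΩB.one ⊗ₜ y ∈ (crossedCalculus σ ΩB actΩ ΩH DΔ).wordSpan n := by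
  have hincl : ∀ h : H, (crossedCalculus σ ΩB actΩ ΩH DΔ).incl (1 ⊗ₜ h) = ΩB.one ⊗ₜ ΩH.incl h :=
    fun h => congrArg (· ⊗ₜ[k] ΩH.incl h) hD.calcB.incl_one
  have h0 : ∀ y ∈ ΩH.gr 0, ΩB.one ⊗ₜ y ∈ (crossedCalculus σ ΩB actΩ ΩH DΔ).wordSpan 0 := by
    intro y hy
    rw [← hD.calcH.range_incl] at hy
    obtain ⟨h, rfl⟩ := hy
    rw [← hincl]
    exact CalcStruct.incl_mem_wordSpan hD.isDGA _
  -- The exact forms `dh` are a subcomodule of the forms of degree one.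
  let E : Submodule k VH := LinearMap.range (ΩH.d ∘ₗ ΩH.incl)
  have hE : ∀ y ∈ E, leftCoaction ΩH DΔ y ∈ LinearMap.range (E.subtype.lTensor H) := by
    rintro _ ⟨h, rfl⟩
    rw [LinearMap.comp_apply, leftCoaction_d hD.calcH hD.diff, leftCoaction_incl hD.calcH hD.diff]
    generalize Coalgebra.comul (R := k) h = t
    induction t with
    | zero => simp
    | add x y hx hy =>
      simp only [map_add]
      exact Submodule.add_mem _ hx hy
    | tmul a b => exact ⟨a ⊗ₜ ⟨ΩH.d (ΩH.incl b), b, rfl⟩, rfl⟩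
  have hE1 : ∀ y ∈ E, ΩB.one ⊗ₜ y ∈ (crossedCalculus σ ΩB actΩ ΩH DΔ).wordSpan 1 := by
    rintro _ ⟨h, rfl⟩
    rw [LinearMap.comp_apply, ← hD.d_one_tmul, ← hincl]
    exact CalcStruct.d_incl_mem_wordSpan hD.isDGA hD.incl_mem hD.incl_one hD.incl_mul _
  have hspan : ∀ n (Q : Submodule k (A ⊗[k] VH)), (∀ (h : H) (l : List H), l.length = n →
      ΩB.one ⊗ₜ ΩH.mul (ΩH.incl h) (ΩH.dWord l) ∈ Q) → ∀ y ∈ ΩH.gr n, ΩB.one ⊗ₜ y ∈ Q := by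
    intro n Q hQ y hy
    rw [hD.calcH.gr_eq] at hy
    refine Submodule.span_induction (p := fun y _ => ΩB.one ⊗ₜ y ∈ Q) ?_ (by simp)
      (fun x y _ _ hx hy => by rw [tmul_add]; exact Submodule.add_mem _ hx hy)
      (fun c x _ hx => by rw [tmul_smul]; exact Submodule.smul_mem _ c hx) hy
    rintro _ ⟨h, l, hl, rfl⟩
    exact hQ h l hl
  have hlam := leftCoaction_mem hD.calcH hD.diff
  have hmem1 : ∀ h h' : H, ΩB.one ⊗ₜ ΩH.mul (ΩH.incl h) (ΩH.d (ΩH.incl h')) ∈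
      (crossedCalculus σ ΩB actΩ ΩH DΔ).wordSpan (0 + 1) := fun h h' =>
    hD.one_tmul_mul_mem_wordSpan (hlam 0) hE h0 hE1 (hD.calcH.incl_mem h) ⟨h', rfl⟩
  have h1 : ∀ y ∈ ΩH.gr 1, ΩB.one ⊗ₜ y ∈ (crossedCalculus σ ΩB actΩ ΩH DΔ).wordSpan 1 := by
    refine hspan 1 _ fun h l hl => ?_
    obtain ⟨h', rfl⟩ := List.length_eq_one_iff.mp hl
    rw [CalcStruct.dWord, CalcStruct.dWord, hD.calcH.isDGA.isAlgebra.mul_one]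
    exact hmem1 h h'
  induction n generalizing y with
  | zero => exact h0 y hy
  | succ n ih =>
    revert y
    refine hspan (n + 1) _ fun h l hl => ?_
    obtain ⟨h', l', rfl⟩ := List.exists_cons_of_length_eq_add_one hl
    rw [CalcStruct.dWord, ← hD.calcH.isDGA.isAlgebra.mul_assoc, add_comm n 1]
    refine hD.one_tmul_mul_mem_wordSpan (hlam 1) (hlam n) h1 ih
      (hD.calcH.isDGA.mul_mem 0 1 _ (hD.calcH.incl_mem h) _
        (hD.calcH.isDGA.d_mem 0 _ (hD.calcH.incl_mem h'))) ?_
    have e := CalcStruct.dWord_mem hD.calcH.isDGA hD.calcH.incl_mem l'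
    rwa [show l'.length = n by simpa using hl] at e

/-- The crossed product calculus is a differential calculus on the crossed product. -/
theorem isCalculus (hD : IsCrossedData act σ σinv ΩB actΩ ΩH DΔ) :
    (crossedCalculus σ ΩB actΩ ΩH DΔ).IsCalculus (crossedProduct act σ) := by
  refine CalcStruct.isCalculus_of_le_wordSpan hD.isDGA
    (TensorProduct.map_injective_of_flat_flat _ _ hD.calcB.incl_injective hD.calcH.incl_injective)
    (le_antisymm ?_ fun x hx => ?_) hD.incl_one hD.incl_mul fun n x hx => ?_
  · rintro _ ⟨a, rfl⟩
    exact hD.incl_mem a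
  · refine tensorGr_induction (p := fun x => x ∈
      LinearMap.range (crossedCalculus σ ΩB actΩ ΩH DΔ).incl) (fun i j hij v hv w hw => ?_)
      (Submodule.zero_mem _) (fun x y => Submodule.add_mem _) hx
    obtain ⟨rfl, rfl⟩ : i = 0 ∧ j = 0 := by omega
    rw [← hD.calcB.range_incl] at hv
    rw [← hD.calcH.range_incl] at hw
    obtain ⟨b, rfl⟩ := hv
    obtain ⟨h, rfl⟩ := hw
    exact ⟨b ⊗ₜ h, rfl⟩
  · refine tensorGr_induction (p := fun x => x ∈
      (crossedCalculus σ ΩB actΩ ΩH DΔ).wordSpan n) (fun i j hij v hv w hw => ?_)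
      (Submodule.zero_mem _) (fun x y => Submodule.add_mem _) hx
    have e := hD.mul_mem_wordSpan (hD.tmul_one_mem_wordSpan hv) (hD.one_tmul_mem_wordSpan j w hw)
    rwa [hD.tmul_one_mul, hD.one_eq, mul_one, hij] at e

end IsCrossedData

end CrossedCalculus

/-! ### Differentiability of the coaction -/

section CoactionDifferential

variable {k H B VB VH : Type*} [Field k] [Ring H] [Bialgebra k H] [Ring B] [Algebra k B]
  [AddCommGroup VB] [Module k VB] [AddCommGroup VH] [Module k VH]
  {act : H →ₗ[k] B →ₗ[k] B} {σ σinv : H ⊗[k] H →ₗ[k] B}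
  {ΩB : CalcStruct k B VB} {actΩ : H →ₗ[k] VB →ₗ[k] VB}
  {ΩH : CalcStruct k H VH} {DΔ : VH →ₗ[k] VH ⊗[k] VH}

/-- The twisted product on `X ⊗ (Ω(H) ⊗ Ω(H))`, with respect to the left coaction on the first
factor of `Ω(H) ⊗ Ω(H)`, is the product on `(X ⊗ Ω(H)) ⊗ Ω(H)` up to a Koszul sign. -/
theorem assoc_symm_twistedMul (hΩ : ΩH.IsCalculus (AlgStruct.of k H))
    (hDΔ : IsDifferential ΩH (ΩH.tensor ΩH) Coalgebra.comul DΔ)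
    {X : Type*} [AddCommGroup X] [Module k X] (mulX : X →ₗ[k] X →ₗ[k] X)
    (actX : H →ₗ[k] X →ₗ[k] X) (s : H ⊗[k] H →ₗ[k] X) (x x' : X) (y : VH) {j i' : ℕ} {z y' : VH}
    (hz : z ∈ ΩH.gr j) (hy' : y' ∈ ΩH.gr i') (z' : VH) :
    (TensorProduct.assoc k X VH VH).symm (twistedMul mulX actX s
        ((TensorProduct.assoc k H VH VH).toLinearMap ∘ₗ (leftCoaction ΩH DΔ).rTensor VH)
        (ΩH.tensor ΩH).mul (x ⊗ₜ (y ⊗ₜ z)) (x' ⊗ₜ (y' ⊗ₜ z'))) =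
      (-1 : k) ^ (j * i') • (twistedMul mulX actX s (leftCoaction ΩH DΔ) ΩH.mul
        (x ⊗ₜ y) (x' ⊗ₜ y') ⊗ₜ ΩH.mul z z') := by
  have hI := hΩ.isDGA.isInternal
  simp only [twistedMul, LinearMap.compl₁₂_apply, LinearMap.comp_apply, LinearMap.lTensor_tmul,
    LinearEquiv.coe_coe, LinearMap.rTensor_tmul]
  obtain ⟨u, hu⟩ := leftCoaction_mem hΩ hDΔ i' y' hy'
  rw [← hu]
  clear hu
  generalize leftCoaction ΩH DΔ y = t
  induction t with
  | zero => simp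
  | add x y hx hy => simp only [map_add, add_tmul, tmul_add, LinearMap.add_apply, smul_add, hx, hy]
  | tmul h v =>
    induction u with
    | zero => simp
    | add x y hx hy => simp only [map_add, add_tmul, tmul_add, smul_add, hx, hy]
    | tmul h' v' =>
      simp only [LinearMap.rTensor_tmul, LinearMap.lTensor_tmul, assoc_tmul]
      generalize Coalgebra.comul (R := k) h = w
      induction w with
      | zero => simp
      | add x y hx hy =>
        simp only [map_add, add_tmul, tmul_add, LinearMap.add_apply, smul_add, hx, hy]
      | tmul a b => simp [CalcStruct.tensor, koszul_tmul hI hI _ _ hz v'.2]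

/-- `ω ⊗ γ ↦ (ω ⊗ γ_[1]) ⊗ γ_[2]` is multiplicative. -/
theorem crossedCoactionDifferential_mul (hB : DirectSum.IsInternal ΩB.gr)
    (hΩ : ΩH.IsCalculus (AlgStruct.of k H))
    (hDΔ : IsDifferential ΩH (ΩH.tensor ΩH) Coalgebra.comul DΔ) (a b : VB ⊗[k] VH) :
    crossedCoactionDifferential VB DΔ ((crossedCalculus σ ΩB actΩ ΩH DΔ).mul a b) =
      ((crossedCalculus σ ΩB actΩ ΩH DΔ).tensor ΩH).mul
        (crossedCoactionDifferential VB DΔ a) (crossedCoactionDifferential VB DΔ b) := by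
  have hI := hΩ.isDGA.isInternal
  have hT := tensorGr_isInternal hB hI
  let m2 := twistedMul ΩB.mul actΩ (ΩB.incl ∘ₗ σ)
    ((TensorProduct.assoc k H VH VH).toLinearMap ∘ₗ (leftCoaction ΩH DΔ).rTensor VH)
    (ΩH.tensor ΩH).mul
  -- On `x ⊗ (y ⊗ z)` and `x' ⊗ (y' ⊗ z')` both sides have the sign
  -- `(-1) ^ ((|y| + |z|) |x'| + |z| |y'|)`.
  have key : ∀ (x x' : VB) (i' j : ℕ), x' ∈ ΩB.gr i' → ∀ t ∈ tensorGr ΩH.gr ΩH.gr j, ∀ t',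
      (-1 : k) ^ (j * i') • (TensorProduct.assoc k VB VH VH).symm (m2 (x ⊗ₜ t) (x' ⊗ₜ t')) =
        ((crossedCalculus σ ΩB actΩ ΩH DΔ).tensor ΩH).mul
          ((TensorProduct.assoc k VB VH VH).symm (x ⊗ₜ t))
          ((TensorProduct.assoc k VB VH VH).symm (x' ⊗ₜ t')) := by
    intro x x' i' j hx' t ht t'
    refine tensorGr_induction (p := fun t => (-1 : k) ^ (j * i') •
      (TensorProduct.assoc k VB VH VH).symm (m2 (x ⊗ₜ t) (x' ⊗ₜ t')) =
        ((crossedCalculus σ ΩB actΩ ΩH DΔ).tensor ΩH).mul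
          ((TensorProduct.assoc k VB VH VH).symm (x ⊗ₜ t))
          ((TensorProduct.assoc k VB VH VH).symm (x' ⊗ₜ t')))
      (fun p q hpq y hy z hz => ?_) (by simp)
      (fun x y hx hy => by simp only [map_add, tmul_add, LinearMap.add_apply, smul_add, hx, hy]) ht
    refine homogeneous_tmul_induction hI hI (fun p' q' y' hy' z' hz' => ?_) (by simp)
      (fun x y hx hy => by simp only [map_add, tmul_add, smul_add, hx, hy]) t'
    rw [assoc_symm_twistedMul hΩ hDΔ _ _ _ _ _ _ hz hy', assoc_symm_tmul, assoc_symm_tmul]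
    have e1 := koszul_tmul hT hI (TensorProduct.map₂ (crossedCalculus σ ΩB actΩ ΩH DΔ).mul ΩH.mul)
      (x ⊗ₜ y) hz (tmul_mem_tensorGr rfl hx' hy') z'
    have e2 := koszul_tmul hB hI
      (twistedMul ΩB.mul actΩ (ΩB.incl ∘ₗ σ) (leftCoaction ΩH DΔ) ΩH.mul) x hy hx' y'
    refine Eq.trans ?_ e1.symm
    rw [TensorProduct.map₂_apply_tmul, TensorProduct.map_tmul,
      show (crossedCalculus σ ΩB actΩ ΩH DΔ).mul (x ⊗ₜ y)
      (x' ⊗ₜ y') = _ from e2, ← smul_tmul', smul_smul, smul_smul]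
    congr 1
    subst hpq
    ring
  refine homogeneous_tmul_induction hB hI (fun i j x hx y hy => ?_) (by simp)
    (fun x y hx hy => by simp only [map_add, LinearMap.add_apply, hx, hy]) a
  refine homogeneous_tmul_induction hB hI (fun i' j' x' hx' y' hy' => ?_) (by simp)
    (fun x y hx hy => by simp only [map_add, hx, hy]) b
  have e := koszul_tmul hB hI
    (twistedMul ΩB.mul actΩ (ΩB.incl ∘ₗ σ) (leftCoaction ΩH DΔ) ΩH.mul) x hy hx' y'
  have e2 := map_twistedMul (mul₁ := ΩB.mul) (mul₂ := ΩB.mul) (act₁ := actΩ) (act₂ := actΩ)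
    (s₁ := ΩB.incl ∘ₗ σ) (s₂ := ΩB.incl ∘ₗ σ) (lam₁ := leftCoaction ΩH DΔ)
    (lam₂ := (TensorProduct.assoc k H VH VH).toLinearMap ∘ₗ (leftCoaction ΩH DΔ).rTensor VH)
    (mulY₁ := ΩH.mul) (mulY₂ := (ΩH.tensor ΩH).mul) LinearMap.id DΔ (fun _ _ => rfl)
    (fun _ _ => rfl) (fun _ => rfl) hDΔ.map_mul (lTensor_leftCoaction hΩ hDΔ)
    (x ⊗ₜ y) (x' ⊗ₜ y')
  rw [show (crossedCalculus σ ΩB actΩ ΩH DΔ).mul (x ⊗ₜ y) (x' ⊗ₜ y') = _ from e, map_smul]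
  refine Eq.trans ?_ (key x x' i' j hx' (DΔ y) (hDΔ.map_mem j y hy) (DΔ y'))
  exact congrArg (fun t => (-1 : k) ^ (j * i') • (TensorProduct.assoc k VB VH VH).symm t) e2

/-- `ω ⊗ γ ↦ (ω ⊗ γ_[1]) ⊗ γ_[2]` commutes with the differentials. -/
theorem crossedCoactionDifferential_d (hB : DirectSum.IsInternal ΩB.gr)
    (hΩ : ΩH.IsCalculus (AlgStruct.of k H))
    (hDΔ : IsDifferential ΩH (ΩH.tensor ΩH) Coalgebra.comul DΔ) (a : VB ⊗[k] VH) :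
    crossedCoactionDifferential VB DΔ ((crossedCalculus σ ΩB actΩ ΩH DΔ).d a) =
      ((crossedCalculus σ ΩB actΩ ΩH DΔ).tensor ΩH).d (crossedCoactionDifferential VB DΔ a) := by
  have hI := hΩ.isDGA.isInternal
  have hT := tensorGr_isInternal hB hI
  refine homogeneous_tmul_induction hB hI (fun i j x hx y hy => ?_) (by simp)
    (fun x y hx hy => by simp only [map_add, hx, hy]) a
  have key : ∀ t : VH ⊗[k] VH, (TensorProduct.assoc k VB VH VH).symm
      (ΩB.d x ⊗ₜ t + (-1 : k) ^ i • x ⊗ₜ (ΩH.tensor ΩH).d t) =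
        ((crossedCalculus σ ΩB actΩ ΩH DΔ).tensor ΩH).d
          ((TensorProduct.assoc k VB VH VH).symm (x ⊗ₜ t)) := by
    intro t
    refine homogeneous_tmul_induction hI hI (fun p q v hv w hw => ?_) (by simp)
      (fun x y hx hy => ?_) t
    · rw [assoc_symm_tmul]
      refine Eq.trans ?_ (tensorD_tmul (crossedCalculus σ ΩB actΩ ΩH DΔ).toDGStruct ΩH.toDGStruct
        hT (tmul_mem_tensorGr rfl hx hv) w).symm
      rw [show (crossedCalculus σ ΩB actΩ ΩH DΔ).d (x ⊗ₜ v) = _ from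
        tensorD_tmul ΩB.toDGStruct ΩH.toDGStruct hB hx v, show (ΩH.tensor ΩH).d (v ⊗ₜ w) = _ from
        tensorD_tmul ΩH.toDGStruct ΩH.toDGStruct hI hv w]
      simp [tmul_add, add_tmul, smul_add, smul_smul, pow_add, ← smul_tmul', add_assoc]
    · simp only [map_add, tmul_add, smul_add, ← hx, ← hy]
      abel
  have e := tensorD_tmul ΩB.toDGStruct ΩH.toDGStruct hB hx y
  rw [show (crossedCalculus σ ΩB actΩ ΩH DΔ).d (x ⊗ₜ y) = _ from e]
  refine Eq.trans ?_ (key (DΔ y))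
  simp [crossedCoactionDifferential, hDΔ.map_d]

/-- The coaction of the crossed product is differentiable. -/
theorem isDifferential_crossedCoaction (hB : DirectSum.IsInternal ΩB.gr)
    (hΩ : ΩH.IsCalculus (AlgStruct.of k H))
    (hDΔ : IsDifferential ΩH (ΩH.tensor ΩH) Coalgebra.comul DΔ) :
    IsDifferential (crossedCalculus σ ΩB actΩ ΩH DΔ)
      ((crossedCalculus σ ΩB actΩ ΩH DΔ).tensor ΩH) (crossedCoaction k H B)
      (crossedCoactionDifferential VB DΔ) where
  map_mem n a ha := by
    refine tensorGr_induction (p := fun a => crossedCoactionDifferential VB DΔ a ∈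
      ((crossedCalculus σ ΩB actΩ ΩH DΔ).tensor ΩH).gr n) (fun i j hij x hx y hy => ?_) (by simp)
      (fun x y hx hy => by rw [map_add]; exact Submodule.add_mem _ hx hy) ha
    refine tensorGr_induction (p := fun t => (TensorProduct.assoc k VB VH VH).symm (x ⊗ₜ t) ∈
      ((crossedCalculus σ ΩB actΩ ΩH DΔ).tensor ΩH).gr n) (fun p q hpq v hv w hw => ?_) (by simp)
      (fun x y hx hy => by rw [tmul_add, map_add]; exact Submodule.add_mem _ hx hy)
      (hDΔ.map_mem j y hy)
    exact tmul_mem_tensorGr (by omega) (tmul_mem_tensorGr rfl hx hv) hw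
  map_mul := crossedCoactionDifferential_mul hB hΩ hDΔ
  map_d := crossedCoactionDifferential_d hB hΩ hDΔ
  map_incl a := by
    induction a with
    | zero => simp
    | add x y hx hy => simp only [map_add, hx, hy]
    | tmul b h =>
      simp only [crossedCalculus, crossedCoactionDifferential, crossedCoaction, CalcStruct.tensor,
        TensorProduct.map_tmul, LinearMap.comp_apply, LinearMap.lTensor_tmul, hDΔ.map_incl,
        LinearEquiv.coe_coe]
      generalize Coalgebra.comul (R := k) h = t
      induction t with
      | zero => simp
      | add x y hx hy => simp only [map_add, tmul_add, hx, hy]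
      | tmul u v => simp

end CoactionDifferential

/-! ### Covariance from differentiability of the coaction -/

section Covariance

variable {k H A V VH : Type*} [Field k] [Ring H] [Bialgebra k H] [AddCommGroup A] [Module k A]
  [AddCommGroup V] [Module k V] [AddCommGroup VH] [Module k VH]
  {Ω : CalcStruct k A V} {S : AlgStruct k A} {ΩH : CalcStruct k H VH}
  {ρ : A →ₗ[k] A ⊗[k] H} {F : V →ₗ[k] V ⊗[k] VH}

/-- If a counital coassociative coaction `ρ` of `H` on `A` is differentiable, then the calculus on
`A` is right covariant: the coaction on forms is the component of `Ω(ρ)` in `Ω(A) ⊗ Ω⁰(H)`. -/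
theorem IsDifferential.isRightCovariant (hΩ : Ω.IsCalculus S)
    (hH : ΩH.IsCalculus (AlgStruct.of k H)) (hF : IsDifferential Ω (Ω.tensor ΩH) ρ F)
    (coassoc : TensorProduct.assoc k A H H ∘ₗ ρ.rTensor H ∘ₗ ρ =
      (Coalgebra.comul (R := k) (A := H)).lTensor A ∘ₗ ρ)
    (counit : TensorProduct.rid k A ∘ₗ (Coalgebra.counit (R := k) (A := H)).lTensor A ∘ₗ ρ =
      LinearMap.id)
    (map_one : ρ S.one = S.one ⊗ₜ 1) : Ω.IsRightCovariant H S ρ := by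
  let R : V →ₗ[k] V ⊗[k] H := ΩH.degZero.lTensor V ∘ₗ F
  have hmul : ∀ x y, R (Ω.mul x y) = TensorProduct.map₂ Ω.mul (LinearMap.mul k H) (R x) (R y) := by
    intro x y
    rw [LinearMap.comp_apply, hF.map_mul, hH.lTensor_degZero_mul hΩ.isDGA.isInternal]
    rfl
  have hd : ∀ x, R (Ω.d x) = Ω.d.rTensor H (R x) := by
    intro x
    rw [LinearMap.comp_apply, hF.map_d, hH.lTensor_degZero_d]
    rfl
  have hincl : ∀ a, R (Ω.incl a) = Ω.incl.rTensor H (ρ a) := by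
    intro a
    rw [LinearMap.comp_apply, hF.map_incl]
    generalize ρ a = t
    induction t with
    | zero => simp
    | add x y hx hy => simp only [map_add, hx, hy]
    | tmul b h => simp [CalcStruct.tensor, hH.degZero_incl]
  have hone : R Ω.one = Ω.one ⊗ₜ 1 := by
    rw [← hΩ.incl_one, hincl, map_one, LinearMap.rTensor_tmul]
  refine ⟨hΩ, ⟨coassoc, counit, hΩ.base, map_one, fun a b => ?_⟩, R,
    ⟨?_, ?_, hΩ.isDGA.isAlgebra, hone, hmul⟩, fun n x hx => hH.lTensor_degZero_mem
    (hF.map_mem n x hx), LinearMap.ext hincl, LinearMap.ext hd⟩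
  -- `ρ` is multiplicative because `R` is, and `incl ⊗ H` is injective.
  · apply Module.Flat.rTensor_preserves_injective_linearMap (M := H) _ hΩ.incl_injective
    rw [← hincl, hΩ.incl_mul, hmul, hincl, hincl]
    generalize ρ a = t
    generalize ρ b = t'
    induction t with
    | zero => simp
    | add x y hx hy => simp only [map_add, LinearMap.add_apply, hx, hy]
    | tmul a h =>
      induction t' with
      | zero => simp
      | add x y hx hy => simp only [map_add, hx, hy]
      | tmul a' h' => simp [hΩ.incl_mul]
  · refine hΩ.hom_ext (TensorProduct.map₂ Ω.mul (TensorProduct.map₂ (LinearMap.mul k H)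
      (LinearMap.mul k H))) (Ω.d.rTensor (H ⊗[k] H))
      (fun x y => ?_) (fun x y => ?_) (fun x => ?_) (fun x => ?_) (fun a => ?_)
    · simp only [LinearMap.comp_apply, hmul x y]
      generalize R x = t
      generalize R y = t'
      induction t with
      | zero => simp
      | add x y hx hy => simp only [map_add, LinearMap.add_apply, hx, hy]
      | tmul v h =>
        induction t' with
        | zero => simp
        | add x y hx hy => simp only [map_add, hx, hy]
        | tmul v' h' =>
          simp only [TensorProduct.map₂_apply_tmul, TensorProduct.map_tmul,
            LinearMap.rTensor_tmul, hmul v v']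
          generalize R v = u
          generalize R v' = u'
          induction u with
          | zero => simp
          | add x y hx hy => simp only [map_add, add_tmul, LinearMap.add_apply, hx, hy]
          | tmul a b =>
            induction u' with
            | zero => simp
            | add x y hx hy => simp only [map_add, add_tmul, hx, hy]
            | tmul a' b' => simp
    · simp only [LinearMap.comp_apply, hmul x y]
      generalize R x = t
      generalize R y = t'
      induction t with
      | zero => simp
      | add x y hx hy => simp only [map_add, LinearMap.add_apply, hx, hy]
      | tmul v h =>
        induction t' with
        | zero => simp
        | add x y hx hy => simp only [map_add, hx, hy]
        | tmul v' h' =>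
          simp only [TensorProduct.map₂_apply_tmul, TensorProduct.map_tmul,
            LinearMap.lTensor_tmul, LinearMap.mul_apply',
            Bialgebra.comul_mul]
          generalize Coalgebra.comul (R := k) h = u
          generalize Coalgebra.comul (R := k) h' = u'
          induction u with
          | zero => simp
          | add x y hx hy => simp only [map_add, tmul_add, add_mul, LinearMap.add_apply, hx, hy]
          | tmul a b =>
            induction u' with
            | zero => simp
            | add x y hx hy => simp only [map_add, tmul_add, mul_add, hx, hy]
            | tmul a' b' => simp
    · simp only [LinearMap.comp_apply, hd]
      generalize R x = t
      induction t with
      | zero => simp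
      | add x y hx hy => simp only [map_add, hx, hy]
      | tmul v h =>
        simp only [LinearMap.rTensor_tmul, hd]
        generalize R v = u
        induction u with
        | zero => simp
        | add x y hx hy => simp only [map_add, add_tmul, hx, hy]
        | tmul a b => simp
    · simp only [LinearMap.comp_apply, hd]
      generalize R x = t
      induction t with
      | zero => simp
      | add x y hx hy => simp only [map_add, hx, hy]
      | tmul v h => simp
    · have e1 : ∀ t : A ⊗[k] H, TensorProduct.assoc k V H H (R.rTensor H (Ω.incl.rTensor H t)) =
          Ω.incl.rTensor (H ⊗[k] H) (TensorProduct.assoc k A H H (ρ.rTensor H t)) := by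
        intro t
        induction t with
        | zero => simp
        | add x y hx hy => simp only [map_add, hx, hy]
        | tmul a h =>
          simp only [LinearMap.rTensor_tmul, hincl]
          generalize ρ a = u
          induction u with
          | zero => simp
          | add x y hx hy => simp only [map_add, add_tmul, hx, hy]
          | tmul a b => simp
      have e2 : ∀ t : A ⊗[k] H, Coalgebra.comul.lTensor V (Ω.incl.rTensor H t) =
          Ω.incl.rTensor (H ⊗[k] H) (Coalgebra.comul.lTensor A t) := by
        intro t
        induction t with
        | zero => simp
        | add x y hx hy => simp only [map_add, hx, hy]
        | tmul a h => simp
      simp only [LinearMap.comp_apply, LinearEquiv.coe_coe, hincl, e1, e2]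
      exact congrArg _ (LinearMap.congr_fun coassoc a)
  · refine hΩ.hom_ext Ω.mul Ω.d (fun x y => ?_) (fun x y => rfl) (fun x => ?_) (fun x => rfl)
      (fun a => ?_)
    · simp only [LinearMap.comp_apply, hmul x y]
      generalize R x = t
      generalize R y = t'
      induction t with
      | zero => simp
      | add x y hx hy => simp only [map_add, LinearMap.add_apply, hx, hy]
      | tmul v h =>
        induction t' with
        | zero => simp
        | add x y hx hy => simp only [map_add, hx, hy]
        | tmul v' h' => simp [smul_smul, mul_comm]
    · simp only [LinearMap.comp_apply, hd]
      generalize R x = t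
      induction t with
      | zero => simp
      | add x y hx hy => simp only [map_add, hx, hy]
      | tmul v h => simp
    · have e : ∀ t : A ⊗[k] H, TensorProduct.rid k V
          (Coalgebra.counit.lTensor V (Ω.incl.rTensor H t)) =
            Ω.incl (TensorProduct.rid k A (Coalgebra.counit.lTensor A t)) := by
        intro t
        induction t with
        | zero => simp
        | add x y hx hy => simp only [map_add, hx, hy]
        | tmul a h => simp
      simp only [LinearMap.comp_apply, LinearEquiv.coe_coe, hincl, e]
      exact congrArg _ (LinearMap.congr_fun counit a)

end Covariance

/-! ### The coaction of the crossed product -/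

section CrossedCoaction

variable {k H B : Type*} [Field k] [Ring H] [Bialgebra k H] [Ring B] [Algebra k B]

theorem crossedCoaction_coassoc :
    TensorProduct.assoc k (B ⊗[k] H) H H ∘ₗ (crossedCoaction k H B).rTensor H ∘ₗ
      crossedCoaction k H B =
      (Coalgebra.comul (R := k) (A := H)).lTensor (B ⊗[k] H) ∘ₗ crossedCoaction k H B := by
  refine TensorProduct.ext' fun b h => ?_
  have e1 : ∀ t : H ⊗[k] H, TensorProduct.assoc k (B ⊗[k] H) H H
      ((crossedCoaction k H B).rTensor H ((TensorProduct.assoc k B H H).symm (b ⊗ₜ t))) =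
      (TensorProduct.assoc k B H (H ⊗[k] H)).symm
        (b ⊗ₜ TensorProduct.assoc k H H H (Coalgebra.comul.rTensor H t)) := by
    intro t
    induction t with
    | zero => simp
    | add x y hx hy => simp only [map_add, tmul_add, hx, hy]
    | tmul u v =>
      simp only [assoc_symm_tmul, LinearMap.rTensor_tmul, crossedCoaction, LinearMap.comp_apply,
        LinearMap.lTensor_tmul, LinearEquiv.coe_coe]
      generalize Coalgebra.comul (R := k) u = w
      induction w with
      | zero => simp
      | add x y hx hy => simp only [map_add, tmul_add, add_tmul, hx, hy]
      | tmul u v => simp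
  have e2 : ∀ t : H ⊗[k] H, (Coalgebra.comul (R := k) (A := H)).lTensor (B ⊗[k] H)
      ((TensorProduct.assoc k B H H).symm (b ⊗ₜ t)) =
      (TensorProduct.assoc k B H (H ⊗[k] H)).symm (b ⊗ₜ Coalgebra.comul.lTensor H t) := by
    intro t
    induction t with
    | zero => simp
    | add x y hx hy => simp only [map_add, tmul_add, hx, hy]
    | tmul u v => simp
  have e3 : crossedCoaction k H B (b ⊗ₜ h) =
    (TensorProduct.assoc k B H H).symm (b ⊗ₜ Coalgebra.comul (R := k) h) := rfl
  simp only [LinearMap.comp_apply, LinearEquiv.coe_coe, e3, e1, e2, Coalgebra.coassoc_apply]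

theorem crossedCoaction_counit :
    TensorProduct.rid k (B ⊗[k] H) ∘ₗ
      (Coalgebra.counit (R := k) (A := H)).lTensor (B ⊗[k] H) ∘ₗ crossedCoaction k H B =
      LinearMap.id := by
  refine TensorProduct.ext' fun b h => ?_
  have e : ∀ t : H ⊗[k] H, TensorProduct.rid k (B ⊗[k] H)
      ((Coalgebra.counit (R := k) (A := H)).lTensor (B ⊗[k] H)
        ((TensorProduct.assoc k B H H).symm (b ⊗ₜ t))) =
      b ⊗ₜ TensorProduct.rid k H (Coalgebra.counit.lTensor H t) := by
    intro t
    induction t with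
    | zero => simp
    | add x y hx hy => simp only [map_add, tmul_add, hx, hy]
    | tmul u v => simp
  have e3 : crossedCoaction k H B (b ⊗ₜ h) =
    (TensorProduct.assoc k B H H).symm (b ⊗ₜ Coalgebra.comul (R := k) h) := rfl
  simp only [LinearMap.comp_apply, LinearEquiv.coe_coe, e3, e]
  simp

theorem crossedCoaction_one :
    crossedCoaction k H B (1 ⊗ₜ 1) = (1 ⊗ₜ 1) ⊗ₜ 1 := by
  simp [crossedCoaction, Algebra.TensorProduct.one_def]

end CrossedCoaction

end CrossedCalc

end

theorem theorem3p8 {k H B VB VH : Type*} [Field k] [Ring H] [HopfAlgebra k H]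
    [Ring B] [Algebra k B] [AddCommGroup VB] [Module k VB] [AddCommGroup VH] [Module k VH]
    -- the `σ`-twisted left `H`-module algebra `B`
    (act : H →ₗ[k] B →ₗ[k] B) (σ σinv : H ⊗[k] H →ₗ[k] B)
    (hB : CrossedCalc.IsTwistedModuleAlgebra act σ σinv)
    -- the `σ`-twisted `H`-module differential calculus on `B`
    (ΩB : CrossedCalc.CalcStruct k B VB)
    (hΩB : ΩB.IsCalculus (CrossedCalc.AlgStruct.of k B))
    (actΩ : H →ₗ[k] VB →ₗ[k] VB)
    (hactΩ : CrossedCalc.IsTwistedModuleCalculus act σ ΩB actΩ)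
    -- the differential calculus on `H`, for which the coproduct has the differential `DΔ`
    (ΩH : CrossedCalc.CalcStruct k H VH)
    (hΩH : ΩH.IsCalculus (CrossedCalc.AlgStruct.of k H))
    (DΔ : VH →ₗ[k] VH ⊗[k] VH)
    (hDΔ : CrossedCalc.IsDifferential ΩH (ΩH.tensor ΩH) Coalgebra.comul DΔ) :
    (CrossedCalc.crossedCalculus σ ΩB actΩ ΩH DΔ).IsRightCovariant H
        (CrossedCalc.crossedProduct act σ) (CrossedCalc.crossedCoaction k H B) ∧
    CrossedCalc.IsDifferential (CrossedCalc.crossedCalculus σ ΩB actΩ ΩH DΔ)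
        ((CrossedCalc.crossedCalculus σ ΩB actΩ ΩH DΔ).tensor ΩH)
        (CrossedCalc.crossedCoaction k H B)
        (CrossedCalc.crossedCoactionDifferential VB DΔ) := by
  have hdiff := CrossedCalc.isDifferential_crossedCoaction (σ := σ) (actΩ := actΩ)
    hΩB.isDGA.isInternal hΩH hDΔ
  have hcalc : (CrossedCalc.crossedCalculus σ ΩB actΩ ΩH DΔ).IsCalculus
      (CrossedCalc.crossedProduct act σ) := by
    -- Forms on `B` become a ring under the wedge product, so that convolution products of maps with
    -- values in forms make sense.
    let _ : Ring VB :=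
      { ‹AddCommGroup VB› with
        mul := fun x y => ΩB.mul x y
        one := ΩB.one
        mul_assoc := hΩB.isDGA.isAlgebra.mul_assoc
        one_mul := hΩB.isDGA.isAlgebra.one_mul
        mul_one := hΩB.isDGA.isAlgebra.mul_one
        zero_mul := fun x => LinearMap.map_zero₂ ΩB.mul x
        mul_zero := fun x => map_zero (ΩB.mul x)
        left_distrib := fun x y z => map_add (ΩB.mul x) y z
        right_distrib := fun x y z => LinearMap.map_add₂ ΩB.mul x y z }
    let _ : Algebra k VB := Algebra.ofModule
      (fun c x y => LinearMap.map_smul₂ ΩB.mul c x y) (fun c x y => map_smul (ΩB.mul x) c y)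
    exact CrossedCalc.IsCrossedData.isCalculus (σinv := σinv)
      ⟨hB, hΩB, rfl, rfl, hactΩ, hΩH, hDΔ⟩
  exact ⟨hdiff.isRightCovariant hcalc hΩH CrossedCalc.crossedCoaction_coassoc
    CrossedCalc.crossedCoaction_counit CrossedCalc.crossedCoaction_one, hdiff⟩
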